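/- Let $\mathbb S^3=\{(z,w)\in\mathbb C^2: |z|^2+|w|^2=1\}$, let $\langle\,,\rangle$ be its round metric, $J(z,w)=(iz,iw)$ and $V_{(z,w)}=J(z,w)$. For $\kappa>0$ and $\tau\neq 0$ the Berger metric on $\mathbb S^3$ is $$g_{\kappa,\tau}(X,Y)=\frac4\kappa\Bigl[\langle X,Y\rangle+\Bigl(\frac{4\tau^2}{\kappa}-1\Bigr)\langle X,V\rangle\langle Y,V\rangle\Bigr].$$ Let $\Phi:\Sigma\to\mathbb S^3$ be a smooth immersion of a connected surface $\Sigma$ (without boundary). Suppose that $\Phi$ is minimal (has vanishing mean curvature) with respect to every Berger metric $g_{\kappa,\tau}$, $\kappa>0$, $\tau\neq0$. Then $\Phi$ is congruent to a piece of one of the maps $\Phi_c:\mathbb R^2\to\mathbb S^3$, $c\in\mathbb R$, $$\Phi_c(s,t)=\bigl(\cos(s)\,e^{ict},\ \sin(s)\,e^{it}\bigr).$$ That is, there are $c\in\mathbb R$ and $A\in\mathrm O(4)$ with $AJ=JA$ or $AJ=-JA$ (hence $A$ is an isometry of every Berger metric) such that for every $p\in\Sigma$ there is $q\in\mathbb R^2$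 with $\Phi(p)=A\,\Phi_c(q)$, and, if $\Phi_c$ is an immersion at $q$, then $\Phi=A\circ\Phi_c\circ h$ near $p$ for a map $h$ into $\mathbb R^2$ with $h(p)=q$ that is smooth at $p$ and has bijective differential there. (The map $\Phi_c$ is an immersion everywhere if $c\ne0$; $\Phi_0$ parametrizes the equator $\{\operatorname{Im}z=0\}$ and is an immersion exactly where $\sin s\neq0$.) -/

import Mathlib

open scoped Manifold ContDiff Topology

noncomputable section

/-- The complex plane `ℂ²` with its usual Hermitian, hence real Euclidean, structure. -/
abbrev C2 : Type := EuclideanSpace ℂ (Fin 2)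

instance fact_finrank_C2 : Fact (Module.finrank ℝ C2 = 3 + 1) :=
  ⟨by
    rw [← Module.finrank_mul_finrank ℝ ℂ C2, Complex.finrank_real_complex, finrank_euclideanSpace,
      Fintype.card_fin]⟩

/-- The unit sphere `S³ = {(z, w) : |z|² + |w|² = 1}` of `ℂ²`; Mathlib gives it the structure of a
smooth `3`-manifold. -/
abbrev S3 : Type := Metric.sphere (0 : C2) 1

/-- The parameter plane `ℝ²`. -/
abbrev R2 : Type := EuclideanSpace ℝ (Fin 2)

/-- The complex structure `J (z, w) = (i z, i w)`. The vector field `x ↦ hopfJ x`, restricted to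
the sphere, is the Hopf field `V`. -/
def hopfJ (x : C2) : C2 := Complex.I • x

/-- The Berger metric
`g(X, Y) = 4/κ (⟨X, Y⟩ + (4τ²/κ - 1) ⟨X, V⟩ ⟨Y, V⟩)` at the point `x`, where `V = J x`.
The formula makes sense for all `x`, `X`, `Y` in `ℂ²`; on tangent vectors at points of
`S³` it is the Berger metric, and the whole is a symmetric tensor field on `ℂ²` extending it. -/
def bergerMetric (κ τ : ℝ) (x X Y : C2) : ℝ :=
  4 / κ * (inner ℝ X Y + (4 * τ ^ 2 / κ - 1) * inner ℝ X (hopfJ x) * inner ℝ Y (hopfJ x))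

/-- The Christoffel symbols of the first kind of a field `g` of bilinear forms on `ℂ²`:
`Γ(X, Y; Z) = (1/2) (D_X g (Y, Z) + D_Y g (X, Z) - D_Z g (X, Y))` at the point `x`. -/
def christoffel (g : C2 → C2 → C2 → ℝ) (x X Y Z : C2) : ℝ :=
  (1 / 2) * (fderiv ℝ (fun y => g y Y Z) x X + fderiv ℝ (fun y => g y X Z) x Y
    - fderiv ℝ (fun y => g y X Y) x Z)

/-- The coordinate tangent vector `∂ₐ f` at `u` of a map `f` from (an open subset of) `ℝ²`. -/
def partialD (f : R2 → C2) (a : Fin 2) (u : R2) : C2 :=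
  fderiv ℝ f u (EuclideanSpace.single a 1)

/-- `g(∇_{∂ₐ} ∂_b f, Z)`, where `f` takes values in `S³`, `Z` is tangent to `S³` at `f u`, and `∇` is
the Levi-Civita connection of the Berger metric on `S³`. By the Koszul formula it is
`g(∂ₐ ∂_b f, Z) + Γ(∂ₐ f, ∂_b f; Z)`. Here the Koszul formula may be evaluated with any
symmetric extension of the metric to a neighbourhood of `S³`, because it only involves derivatives
of products of fields tangent to `S³` along `S³`. -/
def bergerCovDeriv (κ τ : ℝ) (f : R2 → C2) (u : R2) (a b : Fin 2) (Z : C2) : ℝ :=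
  bergerMetric κ τ (f u) (partialD (partialD f b) a u) Z
    + christoffel (bergerMetric κ τ) (f u) (partialD f a u) (partialD f b u) Z

/-- The matrix of the first fundamental form `g(∂ₐ f, ∂_b f)`. -/
def bergerGram (κ τ : ℝ) (f : R2 → C2) (u : R2) : Matrix (Fin 2) (Fin 2) ℝ :=
  Matrix.of fun a b => bergerMetric κ τ (f u) (partialD f a u) (partialD f b u)

/-- `N` is a unit normal vector of `f` at `u` in the Berger sphere: it is tangent to `S³`, of unit
length and orthogonal to `∂₀ f`, `∂₁ f` for the Berger metric. -/
structure IsBergerUnitNormal (κ τ : ℝ) (f : R2 → C2) (u : R2) (N : C2) : Prop where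
  tangent : inner ℝ (f u) N = 0
  unit : bergerMetric κ τ (f u) N N = 1
  normal : ∀ a : Fin 2, bergerMetric κ τ (f u) (partialD f a u) N = 0

/-- The mean curvature at `u`, with respect to the unit normal `N`, of an immersion `f` into the
Berger sphere: half the trace of the second fundamental form `h_{ab} = g(∇_{∂ₐ} ∂_b f, N)` with
respect to the first fundamental form. -/
def bergerMeanCurvature (κ τ : ℝ) (f : R2 → C2) (u : R2) (N : C2) : ℝ :=
  (1 / 2) * ∑ a, ∑ b, (bergerGram κ τ f u)⁻¹ a b * bergerCovDeriv κ τ f u a b N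

section Surfaces

variable {M : Type*} [TopologicalSpace M] [ChartedSpace R2 M]

/-- `Φ` is a smooth immersion of the surface `M` into `S³`. -/
def IsSmoothImmersion (Φ : M → S3) : Prop :=
  ContMDiff (𝓡 2) (𝓡 3) ∞ Φ ∧ ∀ p, Function.Injective (mfderiv (𝓡 2) (𝓡 3) Φ p)

/-- The immersion `Φ : M → S³` is minimal for the Berger metric with parameters `κ`, `τ`: its mean
curvature vanishes at every point, as computed in every chart of the smooth structure of `M`. -/
def IsBergerMinimal (κ τ : ℝ) (Φ : M → S3) : Prop :=
  ∀ φ ∈ IsManifold.maximalAtlas (𝓡 2) ∞ M, ∀ u ∈ φ.target, ∀ N : C2,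
    IsBergerUnitNormal κ τ (fun v => (Φ (φ.symm v) : C2)) u N →
      bergerMeanCurvature κ τ (fun v => (Φ (φ.symm v) : C2)) u N = 0

end Surfaces

/-- The map `Φ_c (s, t) = (cos s · e^{i c t}, sin s · e^{i t})`. -/
def helicoidMap (c : ℝ) (q : ℝ × ℝ) : C2 :=
  !₂[(Real.cos q.1 : ℂ) * Complex.exp (Complex.I * (c * q.2 : ℝ)),
    (Real.sin q.1 : ℂ) * Complex.exp (Complex.I * (q.2 : ℝ))]

/-- `A` is a congruence of the Berger spheres: an element of the group
`{A ∈ O(4) : A J = ± J A}`, which is the isometry group of every non-round Berger sphere. -/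
def IsBergerCongruence (A : C2 ≃ₗᵢ[ℝ] C2) : Prop :=
  (∀ x, A (hopfJ x) = hopfJ (A x)) ∨ (∀ x, A (hopfJ x) = -hopfJ (A x))

/-- `Φ : M → ℂ²` is a piece of the (parametrized) surface `Ψ : ℝ² → ℂ²`: every point of `M` is
mapped to a point `Ψ q`, and whenever `Ψ` is an immersion at the parameter `q`, then
`Φ` is, near that point of `M`, a reparametrization of `Ψ` near `q`. -/
def IsPieceOf {M : Type*} [TopologicalSpace M] [ChartedSpace R2 M]
    (Φ : M → C2) (Ψ : ℝ × ℝ → C2) : Prop :=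
  ∀ p : M, ∃ q : ℝ × ℝ, Φ p = Ψ q ∧
    (Function.Injective (fderiv ℝ Ψ q) →
      ∃ h : M → ℝ × ℝ, h p = q ∧
        ContMDiffAt (𝓡 2) 𝓘(ℝ, ℝ × ℝ) ∞ h p ∧
        Function.Bijective (mfderiv (𝓡 2) 𝓘(ℝ, ℝ × ℝ) h p) ∧
        ∀ᶠ x in 𝓝 p, Φ x = Ψ (h x))

end

/-!
Write `σ` for the second fundamental form of the surface in the round sphere, `T` for the
tangential part of the Hopf field and `Z` for `T` turned by a right angle. The mean curvature for
`g_{4,τ}` is, up to a nonzero factor, `tr σ + (τ² - 1) σ(Z, Z)` (`mean_curvature_identity`). So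
the hypothesis says that the surface is minimal in the round sphere and that `Z` is asymptotic; as
`tr σ = 0`, so is `T` (`exists_surfaceFrame`).

Near a point which is not umbilic the asymptotic directions are smooth, and one of them, `β`, is
orthogonal to the Hopf field (`SurfaceFrame.exists_helicoidalFrame_of_not_umbilic`). Its integral
curves are
then horizontal great circles, and the structure equations of this frame, a `HelicoidalFrame`,
form a closed system of ordinary differential equations along curves. They say that the field in
the other direction, suitably normalized, is the restriction of a linear vector field `i S`, with
`S` a Hermitian matrix which is real in the unitary basis of the position `f` and the ruling `e`.
The eigenvectors of `S` are constant and only rotate against `(f, e)`, so the surface is a piece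
of the helicoid with these eigenvectors as axes and the ratio of the eigenvalues as the parameter
`c` (`HelicoidalFrame.exists_matches`, `HelicoidalFrame.exists_matches_of_segment`).

At an umbilic point `T` does not vanish, or it has an isolated zero; so there is again a
helicoidal frame, with `α` along `T`, on a punctured neighbourhood. A first integral of the
structure equations, `b r² / (1 - b)²`, shows that `σ` vanishes near the point
(`SurfaceFrame.exists_inner_eq_zero_of_umbilic`). So each point either has a neighbourhood in a
hyperplane or one with a helicoidal frame without umbilic points
(`exists_hyperplane_or_helicoidalFrame`).

Both alternatives are open conditions and exclude each other, so one of them holds everywhere on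
the connected surface. In the first case the hyperplane is the same everywhere
(`exists_forall_inner_eq_zero`), the surface lies in an equator, and `c = 0`. In the second case
the helicoid is the same everywhere (`matchesNear_of_connected`): helicoidal frames are unique up
to signs where `r ≠ 0`, that is on a dense set, and they propagate along segments in a chart. In
both cases the surface is covered near each point by small pieces of the helicoid near one
parameter `q`, and a local left inverse of the helicoid at `q` gives the reparametrization
(`exists_reparametrization`).
-/

/-! ### The complex structure and unitary pairs -/

/-- The complex structure `J` of `ℂ²` as a real-linear operator. -/
noncomputable def complexJ : C2 →L[ℝ] C2 := Complex.I • ContinuousLinearMap.id ℝ C2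

theorem complexJ_apply (x : C2) : complexJ x = Complex.I • x := rfl

theorem hopfJ_eq_complexJ (x : C2) : hopfJ x = complexJ x := rfl

@[simp] theorem complexJ_complexJ (x : C2) : complexJ (complexJ x) = -x := by
  simp only [complexJ_apply, smul_smul, Complex.I_mul_I, neg_smul, one_smul]

theorem inner_real_eq_re (x y : C2) : inner ℝ x y = (inner ℂ x y).re := rfl

@[simp] theorem inner_complexJ_complexJ (x y : C2) :
    inner ℝ (complexJ x) (complexJ y) = inner ℝ x y := by
  simp only [inner_real_eq_re, complexJ_apply, inner_smul_left, inner_smul_right, ← mul_assoc]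
  simp

theorem inner_complexJ_right (x y : C2) : inner ℝ x (complexJ y) = -inner ℝ (complexJ x) y := by
  rw [← inner_complexJ_complexJ x, complexJ_complexJ, inner_neg_right]

@[simp] theorem inner_complexJ_self (x : C2) : inner ℝ (complexJ x) x = 0 := by
  have h := inner_complexJ_right x x
  rw [real_inner_comm] at h
  linarith

@[simp] theorem inner_self_complexJ (x : C2) : inner ℝ x (complexJ x) = 0 := by
  rw [inner_complexJ_right, inner_complexJ_self, neg_zero]

/-- `(x, e)` is a unitary basis of `ℂ²`, expressed through the real inner product: `x`, `Jx`, `e`,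
`Je` is a real orthonormal basis. -/
structure IsUnitaryPair (x e : C2) : Prop where
  xx : inner ℝ x x = 1
  ee : inner ℝ e e = 1
  xe : inner ℝ x e = 0
  Jxe : inner ℝ (complexJ x) e = 0

namespace IsUnitaryPair

variable {x e : C2} (h : IsUnitaryPair x e)
include h

theorem ex : inner ℝ e x = 0 := by rw [real_inner_comm]; exact h.xe

theorem eJx : inner ℝ e (complexJ x) = 0 := by rw [real_inner_comm]; exact h.Jxe

theorem xJe : inner ℝ x (complexJ e) = 0 := by rw [inner_complexJ_right, h.Jxe, neg_zero]

theorem Jex : inner ℝ (complexJ e) x = 0 := by rw [real_inner_comm]; exact h.xJe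

theorem inner_comb (a b c d a' b' c' d' : ℝ) :
    inner ℝ (a • x + b • complexJ x + c • e + d • complexJ e)
      (a' • x + b' • complexJ x + c' • e + d' • complexJ e)
      = a * a' + b * b' + c * c' + d * d' := by
  simp only [inner_add_left, inner_add_right, real_inner_smul_left, real_inner_smul_right,
    inner_complexJ_complexJ, inner_complexJ_self, inner_self_complexJ, h.xx, h.ee, h.xe, h.ex,
    h.Jxe, h.eJx, h.xJe, h.Jex]
  ring

theorem coeff_eq_zero {a b c d : ℝ}
    (h0 : a • x + b • complexJ x + c • e + d • complexJ e = 0) :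
    a = 0 ∧ b = 0 ∧ c = 0 ∧ d = 0 := by
  have h1 := h.inner_comb a b c d a b c d
  rw [h0, inner_zero_left] at h1
  refine ⟨?_, ?_, ?_, ?_⟩ <;> nlinarith [sq_nonneg a, sq_nonneg b, sq_nonneg c, sq_nonneg d]

theorem orthonormal : Orthonormal ℝ ![x, complexJ x, e, complexJ e] := by
  rw [orthonormal_iff_ite]
  intro i j
  fin_cases i <;> fin_cases j <;>
    simp [-inner_self_eq_norm_sq_to_K, h.xx, h.ee, h.xe, h.ex, h.Jxe, h.eJx, h.xJe,
      h.Jex]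

end IsUnitaryPair

/-- Four real orthonormal vectors of `ℂ²` form a basis. -/
theorem sum_inner_smul_of_orthonormal {v : Fin 4 → C2} (hv : Orthonormal ℝ v) (y : C2) :
    ∑ i, inner ℝ (v i) y • v i = y := by
  have hs : ⊤ ≤ Submodule.span ℝ (Set.range v) := by
    have := hv.linearIndependent.span_eq_top_of_card_eq_finrank'
      (by rw [fact_finrank_C2.out]; simp)
    exact this.ge
  have := (OrthonormalBasis.mk hv hs).sum_repr' y
  simpa using this

theorem IsUnitaryPair.expand {x e : C2} (h : IsUnitaryPair x e) (y : C2) :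
    y = (inner ℝ x y) • x + (inner ℝ (complexJ x) y) • complexJ x + (inner ℝ e y) • e
      + (inner ℝ (complexJ e) y) • complexJ e := by
  have := sum_inner_smul_of_orthonormal h.orthonormal y
  simpa [Fin.sum_univ_four] using this.symm

/-! ### Derivatives along vector fields -/

/-- The derivative of `F` along the vector field `v`. -/
noncomputable def dirD {E : Type*} [NormedAddCommGroup E] [NormedSpace ℝ E] (v : R2 → R2)
    (F : R2 → E) (u : R2) : E :=
  fderiv ℝ F u (v u)

/-- `v (w F) - w (v F) = [v, w] F`. -/
theorem dirD_comm {E : Type*} [NormedAddCommGroup E] [NormedSpace ℝ E] {F : R2 → E} {v w : R2 → R2}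
    {u : R2} (hF : ContDiffAt ℝ 2 F u) (hv : DifferentiableAt ℝ v u)
    (hw : DifferentiableAt ℝ w u) :
    fderiv ℝ (dirD w F) u (v u) - fderiv ℝ (dirD v F) u (w u)
      = fderiv ℝ F u (fderiv ℝ w u (v u) - fderiv ℝ v u (w u)) := by
  have hd : DifferentiableAt ℝ (fderiv ℝ F) u :=
    (hF.fderiv_right (m := 1) (by norm_num)).differentiableAt (by norm_num)
  have hs := (hF.isSymmSndFDerivAt (by simp)).eq (v u) (w u)
  have key : ∀ z : R2 → R2, DifferentiableAt ℝ z u → ∀ y, fderiv ℝ (dirD z F) u y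
      = fderiv ℝ F u (fderiv ℝ z u y) + fderiv ℝ (fderiv ℝ F) u y (z u) := by
    intro z hz y
    have := (hd.hasFDerivAt.clm_apply hz.hasFDerivAt).fderiv
    unfold dirD
    rw [this]
    simp
  rw [key w hw, key v hv, map_sub, hs]
  abel

theorem ContDiffOn.dirD {E : Type*} [NormedAddCommGroup E] [NormedSpace ℝ E] {F : R2 → E}
    {v : R2 → R2} {U : Set R2} (hU : IsOpen U) (hF : ContDiffOn ℝ ∞ F U)
    (hv : ContDiffOn ℝ ∞ v U) : ContDiffOn ℝ ∞ (dirD v F) U :=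
  (hF.fderiv_of_isOpen hU (m := ∞) (by simp)).clm_apply hv

/-! ### Helicoidal frames and their structure equations -/

/-- A frame of a surface `f : U → S³` adapted to a ruling by great circles orthogonal to the Hopf
field. The fields `α`, `β` are orthonormal for the induced metric: `β` is tangent to the rulings,
`e` is its image, so that `(f, e)` is a unitary basis of `ℂ²`, and the image of `α` is
`r Jf + C Je`, with unit normal `N = C Jf - r Je`. The equations for `N` say that `α` and `β` are
asymptotic directions and that the surface is minimal, with second fundamental form
`(0, b; b, 0)`. -/
structure HelicoidalFrame (f : R2 → C2) (U : Set R2) where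
  α : R2 → R2
  β : R2 → R2
  e : R2 → C2
  r : R2 → ℝ
  C : R2 → ℝ
  b : R2 → ℝ
  isOpen : IsOpen U
  smooth_f : ContDiffOn ℝ ∞ f U
  smooth_α : ContDiffOn ℝ ∞ α U
  smooth_β : ContDiffOn ℝ ∞ β U
  smooth_e : ContDiffOn ℝ ∞ e U
  smooth_r : ContDiffOn ℝ ∞ r U
  smooth_C : ContDiffOn ℝ ∞ C U
  smooth_b : ContDiffOn ℝ ∞ b U
  pair : ∀ u ∈ U, IsUnitaryPair (f u) (e u)
  r_C : ∀ u ∈ U, r u ^ 2 + C u ^ 2 = 1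
  f_α : ∀ u ∈ U, fderiv ℝ f u (α u) = r u • complexJ (f u) + C u • complexJ (e u)
  f_β : ∀ u ∈ U, fderiv ℝ f u (β u) = e u
  N_α : ∀ u ∈ U, fderiv ℝ (fun u => C u • complexJ (f u) - r u • complexJ (e u)) u (α u)
    = -b u • e u
  N_β : ∀ u ∈ U, fderiv ℝ (fun u => C u • complexJ (f u) - r u • complexJ (e u)) u (β u)
    = -b u • (r u • complexJ (f u) + C u • complexJ (e u))

namespace HelicoidalFrame

variable {f : R2 → C2} {U : Set R2} (F : HelicoidalFrame f U)

/-- The unit normal of `f` in `S³` attached to the frame. -/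
noncomputable def N (u : R2) : C2 := F.C u • complexJ (f u) - F.r u • complexJ (F.e u)

/-- The remaining connection coefficient `⟨D_α e, J e⟩` of the frame. -/
noncomputable def ρ (u : R2) : ℝ := inner ℝ (complexJ (F.e u)) (dirD F.α F.e u)

theorem _root_.ContDiffOn.differentiableAt_of_isOpen {E G : Type*} [NormedAddCommGroup E]
    [NormedSpace ℝ E] [NormedAddCommGroup G] [NormedSpace ℝ G] {g : E → G} {s : Set E}
    (h : ContDiffOn ℝ ∞ g s) (hs : IsOpen s) {u : E} (hu : u ∈ s) : DifferentiableAt ℝ g u :=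
  (h.contDiffAt (hs.mem_nhds hu)).differentiableAt (by simp)

theorem smooth_N : ContDiffOn ℝ ∞ F.N U :=
  (F.smooth_C.smul (complexJ.contDiff.comp_contDiffOn F.smooth_f)).sub
    (F.smooth_r.smul (complexJ.contDiff.comp_contDiffOn F.smooth_e))

theorem smooth_ρ : ContDiffOn ℝ ∞ F.ρ U :=
  (complexJ.contDiff.comp_contDiffOn F.smooth_e).inner ℝ
    (ContDiffOn.dirD F.isOpen F.smooth_e F.smooth_α)

variable {u : R2}

theorem fderiv_N (hu : u ∈ U) (v : R2) :
    fderiv ℝ F.N u v = fderiv ℝ F.C u v • complexJ (f u) + F.C u • complexJ (fderiv ℝ f u v)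
      - (fderiv ℝ F.r u v • complexJ (F.e u) + F.r u • complexJ (fderiv ℝ F.e u v)) := by
  have hf := (F.smooth_f.differentiableAt_of_isOpen F.isOpen hu).hasFDerivAt
  have he := (F.smooth_e.differentiableAt_of_isOpen F.isOpen hu).hasFDerivAt
  have hC := (F.smooth_C.differentiableAt_of_isOpen F.isOpen hu).hasFDerivAt
  have hr := (F.smooth_r.differentiableAt_of_isOpen F.isOpen hu).hasFDerivAt
  have h := (hC.smul (complexJ.hasFDerivAt.comp u hf)).sub
    (hr.smul (complexJ.hasFDerivAt.comp u he))
  have := h.fderiv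
  unfold N
  simp only [Function.comp_def] at this
  erw [this]
  simp
  abel

/-- The components of the derivative of `e` on `f`, `Jf`, `e` follow from differentiating the
relations of a unitary pair. -/
theorem fderiv_e (hu : u ∈ U) (v : R2) :
    fderiv ℝ F.e u v = -inner ℝ (fderiv ℝ f u v) (F.e u) • f u
      - inner ℝ (complexJ (fderiv ℝ f u v)) (F.e u) • complexJ (f u)
      + inner ℝ (complexJ (F.e u)) (fderiv ℝ F.e u v) • complexJ (F.e u) := by
  have hf := (F.smooth_f.differentiableAt_of_isOpen F.isOpen hu).hasFDerivAt
  have he := (F.smooth_e.differentiableAt_of_isOpen F.isOpen hu).hasFDerivAt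
  have hU := F.isOpen.mem_nhds hu
  have hc : ∀ (c : ℝ) (g : R2 → ℝ), (∀ w ∈ U, g w = c) → fderiv ℝ g u v = 0 := by
    intro c g hg
    rw [(Filter.eventuallyEq_of_mem hU hg : g =ᶠ[𝓝 u] fun _ => c).fderiv_eq]
    simp
  have h1 := hc 1 _ fun w hw => (F.pair w hw).ee
  have h2 := hc 0 _ fun w hw => (F.pair w hw).xe
  have h3 := hc 0 _ fun w hw => (F.pair w hw).Jxe
  rw [(he.inner ℝ he).fderiv] at h1
  rw [(hf.inner ℝ he).fderiv] at h2
  have hJ : HasFDerivAt (fun w => complexJ (f w)) (complexJ ∘L fderiv ℝ f u) u :=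
    complexJ.hasFDerivAt.comp u hf
  rw [(hJ.inner ℝ he).fderiv] at h3
  simp [fderivInnerCLM_apply] at h1 h2 h3
  have ex := (F.pair u hu).expand (fderiv ℝ F.e u v)
  have h1' : inner ℝ (F.e u) (fderiv ℝ F.e u v) = 0 := by
    rw [real_inner_comm (F.e u)] at h1; linarith
  have h2' : inner ℝ (f u) (fderiv ℝ F.e u v) = -inner ℝ (fderiv ℝ f u v) (F.e u) := by linarith
  have h3' : inner ℝ (complexJ (f u)) (fderiv ℝ F.e u v)
    = -inner ℝ (complexJ (fderiv ℝ f u v)) (F.e u) := by linarith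
  rw [h1', h2', h3'] at ex
  rw [ex]
  simp only [inner_add_right, real_inner_smul_right, (F.pair u hu).Jex,
    inner_complexJ_complexJ, (F.pair u hu).ee, (F.pair u hu).ex, inner_complexJ_self]
  module

theorem e_α (hu : u ∈ U) :
    fderiv ℝ F.e u (F.α u) = F.C u • complexJ (f u) + F.ρ u • complexJ (F.e u) := by
  have h := F.fderiv_e hu (F.α u)
  have hp := F.pair u hu
  rw [F.f_α u hu] at h
  simp only [map_add, map_smul, complexJ_complexJ, inner_add_left, real_inner_smul_left,
    inner_neg_left, hp.Jxe, hp.xe, hp.ee, inner_complexJ_self] at h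
  rw [h, ρ, dirD]
  module

/-- The components along `α` of the Weingarten equation. -/
theorem structure_α (hu : u ∈ U) : fderiv ℝ F.C u (F.α u) = 0 ∧ fderiv ℝ F.r u (F.α u) = 0 ∧
    F.r u * F.ρ u = F.C u ^ 2 - F.b u := by
  have h := F.fderiv_N hu (F.α u)
  have h' : fderiv ℝ F.N u (F.α u) = _ := F.N_α u hu
  rw [h', F.f_α u hu, F.e_α hu] at h
  simp only [map_add, map_smul, complexJ_complexJ] at h
  obtain ⟨-, h1, h2, h3⟩ := (F.pair u hu).coeff_eq_zero (a := 0)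
    (b := fderiv ℝ F.C u (F.α u)) (c := F.r u * F.ρ u - F.C u ^ 2 + F.b u)
    (d := -fderiv ℝ F.r u (F.α u)) (by linear_combination (norm := module) (-1 : ℝ) • h)
  exact ⟨h1, by linarith, by linarith⟩

/-- The components along `β` of the Weingarten equation. The last one gives `e_β`, since the zeros
of `r` are nowhere dense. -/
theorem structure_β_aux (hu : u ∈ U) : fderiv ℝ F.C u (F.β u) = -(1 + F.b u) * F.r u ∧
    fderiv ℝ F.r u (F.β u) = F.C u * (1 + F.b u) ∧
    F.r u * inner ℝ (complexJ (F.e u)) (dirD F.β F.e u) = 0 := by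
  have h := F.fderiv_N hu (F.β u)
  have h' : fderiv ℝ F.N u (F.β u) = _ := F.N_β u hu
  have hp := F.pair u hu
  have h2 := F.fderiv_e hu (F.β u)
  rw [F.f_β u hu, hp.ee, inner_complexJ_self] at h2
  rw [h', F.f_β u hu, h2] at h
  simp only [map_add, map_sub, map_smul, complexJ_complexJ] at h
  obtain ⟨-, h1, h2, h3⟩ := (F.pair u hu).coeff_eq_zero (a := 0)
    (b := fderiv ℝ F.C u (F.β u) + (1 + F.b u) * F.r u)
    (c := F.r u * inner ℝ (complexJ (F.e u)) (dirD F.β F.e u))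
    (d := F.C u * (1 + F.b u) - fderiv ℝ F.r u (F.β u))
    (by rw [dirD]; linear_combination (norm := module) (-1 : ℝ) • h)
  exact ⟨by linarith, by linarith, h2⟩

/-- The zeros of `r` are nowhere dense: there `C ^ 2 = 1 = b`, so the derivative `C (1 + b)` of `r`
along `β` does not vanish. -/
theorem not_eventually_r_eq_zero (hu : u ∈ U) : ¬ F.r =ᶠ[𝓝 u] fun _ => 0 := by
  intro hr
  have hr0 : F.r u = 0 := hr.eq_of_nhds
  have hd : fderiv ℝ F.r u (F.β u) = 0 := by rw [hr.fderiv_eq]; simp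
  obtain ⟨-, -, h1⟩ := F.structure_α hu
  obtain ⟨-, h2, -⟩ := F.structure_β_aux hu
  have h3 := F.r_C u hu
  rw [hr0] at h1 h3
  rw [hd] at h2
  have hb : F.b u = 1 := by linarith
  rw [hb] at h2
  nlinarith

theorem eq_zero_of_r_mul {h : R2 → ℝ} (hc : ContinuousOn h U) (h0 : ∀ u ∈ U, F.r u * h u = 0)
    (hu : u ∈ U) : h u = 0 := by
  by_contra hne
  have hU := F.isOpen.mem_nhds hu
  have hev : ∀ᶠ w in 𝓝 u, h w ≠ 0 := (hc.continuousAt hU).eventually_ne hne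
  refine F.not_eventually_r_eq_zero hu ?_
  filter_upwards [hev, hU] with w hw hwU
  simpa [hw] using h0 w hwU

theorem exists_r_ne_zero (hu : u ∈ U) {V : Set R2} (hV : V ∈ 𝓝 u) : ∃ w ∈ V, F.r w ≠ 0 := by
  by_contra! hcon
  exact F.not_eventually_r_eq_zero hu (Filter.eventually_of_mem hV hcon)

theorem e_β (hu : u ∈ U) : fderiv ℝ F.e u (F.β u) = -f u := by
  have h0 : inner ℝ (complexJ (F.e u)) (dirD F.β F.e u) = 0 :=
    F.eq_zero_of_r_mul (h := fun u => inner ℝ (complexJ (F.e u)) (dirD F.β F.e u))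
      (((complexJ.contDiff.comp_contDiffOn F.smooth_e).inner ℝ
        (ContDiffOn.dirD F.isOpen F.smooth_e F.smooth_β)).continuousOn)
      (fun w hw => (F.structure_β_aux hw).2.2) hu
  have h2 := F.fderiv_e hu (F.β u)
  rw [dirD] at h0
  rw [h0, F.f_β u hu, (F.pair u hu).ee, inner_complexJ_self] at h2
  rw [h2]; module

theorem C_α (hu : u ∈ U) : fderiv ℝ F.C u (F.α u) = 0 := (F.structure_α hu).1
theorem r_α (hu : u ∈ U) : fderiv ℝ F.r u (F.α u) = 0 := (F.structure_α hu).2.1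
theorem r_mul_ρ (hu : u ∈ U) : F.r u * F.ρ u = F.C u ^ 2 - F.b u := (F.structure_α hu).2.2
theorem C_β (hu : u ∈ U) : fderiv ℝ F.C u (F.β u) = -(1 + F.b u) * F.r u :=
  (F.structure_β_aux hu).1
theorem r_β (hu : u ∈ U) : fderiv ℝ F.r u (F.β u) = F.C u * (1 + F.b u) :=
  (F.structure_β_aux hu).2.1


theorem expand_tangent (hu : u ∈ U) (v : R2) :
    v = inner ℝ (fderiv ℝ f u v) (F.r u • complexJ (f u) + F.C u • complexJ (F.e u)) • F.α u
      + inner ℝ (fderiv ℝ f u v) (F.e u) • F.β u := by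
  have hp := F.pair u hu
  have hrC := F.r_C u hu
  have hsq : F.r u * F.r u + F.C u * F.C u = 1 := by linarith
  have hli : LinearIndependent ℝ ![F.α u, F.β u] := by
    rw [LinearIndependent.pair_iff]
    intro s t hst
    have h := congrArg (fderiv ℝ f u) hst
    rw [map_add, map_smul, map_smul, F.f_α u hu, F.f_β u hu, map_zero] at h
    obtain ⟨-, h1, h2, h3⟩ := hp.coeff_eq_zero (a := 0) (b := s * F.r u) (c := t) (d := s * F.C u)
      (by linear_combination (norm := module) (1 : ℝ) • h)
    refine ⟨?_, h2⟩
    linear_combination F.r u * h1 + F.C u * h3 - s * hsq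
  have hspan := hli.span_eq_top_of_card_eq_finrank' (by simp)
  have hv : v ∈ Submodule.span ℝ (Set.range ![F.α u, F.β u]) := by rw [hspan]; trivial
  simp only [Matrix.range_cons, Matrix.range_empty, Set.union_empty, Set.singleton_union] at hv
  obtain ⟨s, t, rfl⟩ := Submodule.mem_span_pair.1 hv
  rw [map_add, map_smul, map_smul, F.f_α u hu, F.f_β u hu]
  simp only [inner_add_left, inner_add_right, real_inner_smul_left, real_inner_smul_right,
    inner_complexJ_complexJ, inner_complexJ_self, inner_self_complexJ, hp.xx, hp.ee, hp.xe, hp.ex,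
    hp.Jxe, hp.eJx]
  congr 2
  · linear_combination -s * hsq
  · ring

include F in
theorem fderiv_injective (hu : u ∈ U) : Function.Injective (fderiv ℝ f u) := by
  intro v w h
  rw [F.expand_tangent hu v, F.expand_tangent hu w, h]

/-- The bracket of the two frame fields. -/
theorem bracket (hu : u ∈ U) :
    fderiv ℝ F.β u (F.α u) - fderiv ℝ F.α u (F.β u) = (F.C u * (F.r u + F.ρ u)) • F.α u := by
  have hU := F.isOpen.mem_nhds hu
  apply F.fderiv_injective hu
  rw [← dirD_comm ((F.smooth_f.contDiffAt hU).of_le (by norm_cast))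
    (F.smooth_α.differentiableAt_of_isOpen F.isOpen hu)
    (F.smooth_β.differentiableAt_of_isOpen F.isOpen hu)]
  have hβ : dirD F.β f =ᶠ[𝓝 u] F.e := Filter.eventually_of_mem hU F.f_β
  have hα : dirD F.α f =ᶠ[𝓝 u] fun u => F.r u • complexJ (f u) + F.C u • complexJ (F.e u) :=
    Filter.eventually_of_mem hU F.f_α
  have hf := (F.smooth_f.differentiableAt_of_isOpen F.isOpen hu).hasFDerivAt
  have he := (F.smooth_e.differentiableAt_of_isOpen F.isOpen hu).hasFDerivAt
  have hC := (F.smooth_C.differentiableAt_of_isOpen F.isOpen hu).hasFDerivAt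
  have hr := (F.smooth_r.differentiableAt_of_isOpen F.isOpen hu).hasFDerivAt
  have h := (hr.smul (complexJ.hasFDerivAt.comp u hf)).add
    (hC.smul (complexJ.hasFDerivAt.comp u he))
  have := h.fderiv
  simp only [Function.comp_def] at this
  rw [hβ.fderiv_eq, hα.fderiv_eq, F.e_α hu]
  erw [this]
  simp only [map_smul, F.f_α u hu, add_apply, smul_apply,
    ContinuousLinearMap.smulRight_apply, ContinuousLinearMap.comp_apply, F.r_β hu, F.C_β hu,
    F.e_β hu, F.f_β u hu, map_neg]
  have h1 := F.r_mul_ρ hu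
  have h2 := F.r_C u hu
  match_scalars
  · simp; linear_combination -F.C u * h1 - F.C u * h2
  · simp; linear_combination F.r u * h1 - F.ρ u * h2

/-- The Codazzi equations, from the symmetry of the second derivative of `N`. -/
theorem codazzi (hu : u ∈ U) : fderiv ℝ F.b u (F.α u) = 0 ∧
    fderiv ℝ F.b u (F.β u) = -2 * F.b u * F.C u * (F.r u + F.ρ u) := by
  have hU := F.isOpen.mem_nhds hu
  have hcomm := dirD_comm ((F.smooth_N.contDiffAt hU).of_le (by norm_cast))
    (F.smooth_α.differentiableAt_of_isOpen F.isOpen hu)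
    (F.smooth_β.differentiableAt_of_isOpen F.isOpen hu)
  have hNα : fderiv ℝ F.N u (F.α u) = _ := F.N_α u hu
  rw [F.bracket hu, map_smul, hNα] at hcomm
  have hβ : dirD F.β F.N =ᶠ[𝓝 u] fun u => -F.b u •
      (F.r u • complexJ (f u) + F.C u • complexJ (F.e u)) := Filter.eventually_of_mem hU F.N_β
  have hα : dirD F.α F.N =ᶠ[𝓝 u] fun u => -F.b u • F.e u := Filter.eventually_of_mem hU F.N_α
  have hf := (F.smooth_f.differentiableAt_of_isOpen F.isOpen hu).hasFDerivAt
  have he := (F.smooth_e.differentiableAt_of_isOpen F.isOpen hu).hasFDerivAt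
  have hC := (F.smooth_C.differentiableAt_of_isOpen F.isOpen hu).hasFDerivAt
  have hr := (F.smooth_r.differentiableAt_of_isOpen F.isOpen hu).hasFDerivAt
  have hb := (F.smooth_b.differentiableAt_of_isOpen F.isOpen hu).hasFDerivAt
  have h := (hr.smul (complexJ.hasFDerivAt.comp u hf)).add
    (hC.smul (complexJ.hasFDerivAt.comp u he))
  have h3 := (hb.neg.smul h).fderiv
  have h4 := (hb.neg.smul he).fderiv
  simp only [Function.comp_def] at h3
  rw [hβ.fderiv_eq, hα.fderiv_eq] at hcomm
  erw [h3, h4] at hcomm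
  simp only [map_smul, map_add, F.f_α u hu, add_apply,
    smul_apply, neg_apply,
    ContinuousLinearMap.smulRight_apply, ContinuousLinearMap.comp_apply, F.r_α hu, F.C_α hu,
    F.e_α hu, F.e_β hu, complexJ_complexJ, Pi.neg_apply, Pi.add_apply, Pi.smul_apply'] at hcomm
  have hrC := F.r_C u hu
  obtain ⟨-, h1, h2, h3⟩ := (F.pair u hu).coeff_eq_zero
    (a := F.b u * (F.r u ^ 2 + F.C u ^ 2) - F.b u)
    (b := -fderiv ℝ F.b u (F.α u) * F.r u)
    (c := fderiv ℝ F.b u (F.β u) + 2 * F.b u * F.C u * (F.r u + F.ρ u))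
    (d := -fderiv ℝ F.b u (F.α u) * F.C u)
    (by linear_combination (norm := module) (1 : ℝ) • hcomm)
  refine ⟨?_, by linarith⟩
  linear_combination -F.r u * h1 - F.C u * h3 - fderiv ℝ F.b u (F.α u) * hrC

/-- The derivative of the relation `r ρ = C² - b`. -/
theorem r_mul_fderiv_ρ (hu : u ∈ U) (v : R2) :
    F.r u * fderiv ℝ F.ρ u v
      = 2 * F.C u * fderiv ℝ F.C u v - fderiv ℝ F.b u v - F.ρ u * fderiv ℝ F.r u v := by
  have hC := (F.smooth_C.differentiableAt_of_isOpen F.isOpen hu).hasFDerivAt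
  have hr := (F.smooth_r.differentiableAt_of_isOpen F.isOpen hu).hasFDerivAt
  have hb := (F.smooth_b.differentiableAt_of_isOpen F.isOpen hu).hasFDerivAt
  have hρ := (F.smooth_ρ.differentiableAt_of_isOpen F.isOpen hu).hasFDerivAt
  have h : (fun w => F.r w * F.ρ w) =ᶠ[𝓝 u] fun w => F.C w ^ 2 - F.b w :=
    Filter.eventually_of_mem (F.isOpen.mem_nhds hu) fun w hw => F.r_mul_ρ hw
  have h' := ((hr.mul hρ).congr_of_eventuallyEq h.symm).unique ((hC.pow 2).sub hb)
  have := congrArg (fun L : R2 →L[ℝ] ℝ => L v) h'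
  simp at this
  linarith

theorem ρ_α (hu : u ∈ U) : fderiv ℝ F.ρ u (F.α u) = 0 :=
  F.eq_zero_of_r_mul (h := dirD F.α F.ρ)
    (ContDiffOn.dirD F.isOpen F.smooth_ρ F.smooth_α).continuousOn
    (fun w hw => by rw [dirD, F.r_mul_fderiv_ρ hw, F.C_α hw, F.r_α hw, (F.codazzi hw).1]; ring) hu

theorem ρ_β (hu : u ∈ U) :
    fderiv ℝ F.ρ u (F.β u) = -F.C u * (2 + F.r u * F.ρ u + F.ρ u ^ 2) := by
  refine sub_eq_zero.1 (F.eq_zero_of_r_mul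
    (h := fun u => dirD F.β F.ρ u - -F.C u * (2 + F.r u * F.ρ u + F.ρ u ^ 2)) ?_ ?_ hu)
  · have h1 := F.smooth_ρ.continuousOn
    have h2 := F.smooth_r.continuousOn
    have h3 := F.smooth_C.continuousOn
    have h4 := (ContDiffOn.dirD F.isOpen F.smooth_ρ F.smooth_β).continuousOn
    fun_prop
  · intro w hw
    have h1 := F.r_mul_ρ hw
    have h2 := F.r_C w hw
    rw [mul_sub, dirD, F.r_mul_fderiv_ρ hw, F.C_β hw, F.r_β hw, (F.codazzi hw).2]
    obtain hb : F.b w = F.C w ^ 2 - F.r w * F.ρ w := by linarith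
    rw [hb]
    linear_combination F.C w * F.ρ w * h2

end HelicoidalFrame

/-! ### Comparison of a helicoidal frame with a helicoid -/

/-- The unitary rotation `v ↦ exp (i θ) v`, in real terms. -/
noncomputable def rotJ (θ : ℝ) (v : C2) : C2 := Real.cos θ • v + Real.sin θ • complexJ v

/-- The helicoid `(s, t) ↦ cos s · e^{i c t} v₁ + sin s · e^{i t} v₂`. -/
noncomputable def helicoid (c : ℝ) (v₁ v₂ : C2) (s t : ℝ) : C2 :=
  Real.cos s • rotJ (c * t) v₁ + Real.sin s • rotJ t v₂

/-- The derivative of `helicoid` in the ruling direction `s`. -/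
noncomputable def helicoidRuling (c : ℝ) (v₁ v₂ : C2) (s t : ℝ) : C2 :=
  -Real.sin s • rotJ (c * t) v₁ + Real.cos s • rotJ t v₂

/-- The derivative of a rotated vector. It vanishes if `v' = -θ' J v`. -/
theorem hasDerivAt_rotJ {θ : ℝ → ℝ} {v : ℝ → C2} {θ' : ℝ} {v' : C2} {τ : ℝ}
    (hθ : HasDerivAt θ θ' τ) (hv : HasDerivAt v v' τ) :
    HasDerivAt (fun τ => rotJ (θ τ) (v τ)) (rotJ (θ τ) (v' + θ' • complexJ (v τ))) τ := by
  have h := (hθ.cos.smul hv).add (hθ.sin.smul (complexJ.hasFDerivAt.comp_hasDerivAt τ hv))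
  refine h.congr_deriv ?_
  simp only [rotJ, Function.comp, map_add, map_smul, complexJ_complexJ]
  module

theorem rotJ_neg_rotJ (θ : ℝ) (v : C2) : rotJ θ (rotJ (-θ) v) = v := by
  simp only [rotJ, map_add, map_smul, complexJ_complexJ, Real.cos_neg, Real.sin_neg]
  have := Real.sin_sq_add_cos_sq θ
  match_scalars
  · linear_combination this
  · ring

@[simp] theorem rotJ_zero_right (θ : ℝ) : rotJ θ 0 = 0 := by simp [rotJ]

@[simp] theorem rotJ_zero_left (v : C2) : rotJ 0 v = v := by simp [rotJ]

theorem eq_rotJ_of_rotJ_neg_eq {θ : ℝ} {v w : C2} (h : rotJ (-θ) v = w) : v = rotJ θ w := by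
  rw [← h, rotJ_neg_rotJ]

theorem cos_helicoid_sub_sin_ruling (c : ℝ) (v₁ v₂ : C2) (s t : ℝ) :
    Real.cos s • helicoid c v₁ v₂ s t - Real.sin s • helicoidRuling c v₁ v₂ s t
      = rotJ (c * t) v₁ := by
  have := Real.sin_sq_add_cos_sq s
  unfold helicoid helicoidRuling
  match_scalars
  · linear_combination this
  · ring

theorem sin_helicoid_add_cos_ruling (c : ℝ) (v₁ v₂ : C2) (s t : ℝ) :
    Real.sin s • helicoid c v₁ v₂ s t + Real.cos s • helicoidRuling c v₁ v₂ s t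
      = rotJ t v₂ := by
  have := Real.sin_sq_add_cos_sq s
  unfold helicoid helicoidRuling
  match_scalars
  · ring
  · linear_combination this

theorem rotJ_rotJ_neg (θ : ℝ) (v : C2) : rotJ (-θ) (rotJ θ v) = v := by
  simpa using rotJ_neg_rotJ (-θ) v

theorem eq_of_hasDerivAt_zero {E : Type*} [NormedAddCommGroup E] [NormedSpace ℝ E] {G : ℝ → E}
    (h : ∀ τ ∈ Set.Icc (0 : ℝ) 1, HasDerivAt G 0 τ) {τ : ℝ} (hτ : τ ∈ Set.Icc (0 : ℝ) 1) :
    G τ = G 0 :=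
  constant_of_has_deriv_right_zero (fun τ hτ => (h τ hτ).continuousAt.continuousWithinAt)
    (fun τ hτ => (h τ ⟨hτ.1, hτ.2.le⟩).hasDerivWithinAt) τ hτ

namespace HelicoidalFrame

variable {f : R2 → C2} {U : Set R2} (F : HelicoidalFrame f U)

/-- The factor `|b| ^ (-1/2)` which normalizes the tangent field orthogonal to the rulings to the
restriction of a linear vector field of `ℂ²`. -/
noncomputable def g (u : R2) : ℝ := (√(√(F.b u ^ 2)))⁻¹

theorem g_pos {u : R2} (hb : F.b u ≠ 0) : 0 < F.g u := by
  unfold g; positivity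

theorem g_pow_mul {u : R2} (hb : F.b u ≠ 0) : F.g u ^ 4 * F.b u ^ 2 = 1 := by
  have h1 : √(√(F.b u ^ 2)) ^ 4 = F.b u ^ 2 := by
    rw [show (4 : ℕ) = 2 * 2 from rfl, pow_mul, Real.sq_sqrt (by positivity),
      Real.sq_sqrt (by positivity)]
  unfold g
  rw [inv_pow, h1]
  field_simp

theorem smooth_g (hb : ∀ u ∈ U, F.b u ≠ 0) : ContDiffOn ℝ ∞ F.g U := by
  unfold g
  refine ContDiffOn.inv (ContDiffOn.sqrt (ContDiffOn.sqrt (F.smooth_b.pow 2) ?_) ?_) ?_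
  all_goals
    intro u hu
    have := hb u hu
    positivity

/-- `g⁴ b² = 1`, differentiated. -/
theorem fderiv_g (hb : ∀ u ∈ U, F.b u ≠ 0) {u : R2} (hu : u ∈ U) (v : R2) :
    2 * F.b u * fderiv ℝ F.g u v = -F.g u * fderiv ℝ F.b u v := by
  have h1 := ((F.smooth_g hb).differentiableAt_of_isOpen F.isOpen hu).hasFDerivAt
  have h2 := (F.smooth_b.differentiableAt_of_isOpen F.isOpen hu).hasFDerivAt
  have h : (fun w => F.g w ^ 4 * F.b w ^ 2) =ᶠ[𝓝 u] fun _ => 1 :=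
    Filter.eventually_of_mem (F.isOpen.mem_nhds hu) fun w hw => F.g_pow_mul (hb w hw)
  have h' := (((h1.pow 4).mul (h2.pow 2)).congr_of_eventuallyEq h.symm).unique
    (hasFDerivAt_const (1 : ℝ) u)
  have h3 := congrArg (fun L : R2 →L[ℝ] ℝ => L v) h'
  simp at h3
  have hg := (F.g_pos (hb u hu)).ne'
  have hb' := hb u hu
  have : (2 * F.g u ^ 3 * F.b u)
      * (2 * F.b u * fderiv ℝ F.g u v + F.g u * fderiv ℝ F.b u v) = 0 := by
    linear_combination h3
  have := (mul_eq_zero.1 this).resolve_left (by positivity)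
  linarith

/-- The frame at `u` is that of the helicoid with parameters `c`, `v₁`, `v₂` at `(s, t)`: position
and ruling agree, and the symmetric matrix `g (r, C; C, ρ)`, which is the matrix in the unitary
basis `(f, e)` of (the multiple by `-i` of) the linear vector field tangent to the surface, is `k`
times the matrix of `diag (c, 1)`. -/
structure Matches (c k : ℝ) (v₁ v₂ : C2) (u : R2) (s t : ℝ) : Prop where
  f_eq : f u = helicoid c v₁ v₂ s t
  e_eq : F.e u = helicoidRuling c v₁ v₂ s t
  S₁₁ : F.g u * F.r u = k * (c * Real.cos s ^ 2 + Real.sin s ^ 2)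
  S₁₂ : F.g u * F.C u = k * ((1 - c) * (Real.sin s * Real.cos s))
  S₂₂ : F.g u * F.ρ u = k * (c * Real.sin s ^ 2 + Real.cos s ^ 2)

/-- The first form of the coframe dual to `(α, β)`. -/
noncomputable def θ₁ (u v : R2) : ℝ :=
  inner ℝ (fderiv ℝ f u v) (F.r u • complexJ (f u) + F.C u • complexJ (F.e u))

/-- The second form of the coframe dual to `(α, β)`. -/
noncomputable def θ₂ (u v : R2) : ℝ := inner ℝ (fderiv ℝ f u v) (F.e u)

/-- Derivatives expressed through those along `α` and `β`. -/
theorem fderiv_apply {E : Type*} [NormedAddCommGroup E] [NormedSpace ℝ E] (G : R2 → E) {u : R2}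
    (hu : u ∈ U) (v : R2) :
    fderiv ℝ G u v = F.θ₁ u v • fderiv ℝ G u (F.α u) + F.θ₂ u v • fderiv ℝ G u (F.β u) := by
  conv_lhs => rw [F.expand_tangent hu v]
  rw [map_add, map_smul, map_smul]
  rfl

theorem g_β (hb : ∀ u ∈ U, F.b u ≠ 0) {u : R2} (hu : u ∈ U) :
    fderiv ℝ F.g u (F.β u) = F.g u * F.C u * (F.r u + F.ρ u) := by
  have h := F.fderiv_g hb hu (F.β u)
  rw [(F.codazzi hu).2] at h
  have := hb u hu
  apply mul_left_cancel₀ (mul_ne_zero two_ne_zero this)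
  linear_combination h

theorem g_α (hb : ∀ u ∈ U, F.b u ≠ 0) {u : R2} (hu : u ∈ U) : fderiv ℝ F.g u (F.α u) = 0 := by
  have h := F.fderiv_g hb hu (F.α u)
  rw [(F.codazzi hu).1] at h
  have := hb u hu
  simpa [this] using h

theorem continuousOn_θ₂ (v : R2) : ContinuousOn (fun u => F.θ₂ u v) U :=
  ((F.smooth_f.continuousOn_fderiv_of_isOpen F.isOpen (by simp)).clm_apply
    continuousOn_const).inner F.smooth_e.continuousOn

theorem continuousOn_θ₁ (v : R2) : ContinuousOn (fun u => F.θ₁ u v) U := by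
  have h1 := F.smooth_f.continuousOn
  have h2 := F.smooth_r.continuousOn
  have h3 := F.smooth_C.continuousOn
  have h4 := F.smooth_e.continuousOn
  exact ((F.smooth_f.continuousOn_fderiv_of_isOpen F.isOpen (by simp)).clm_apply
    continuousOn_const).inner (by fun_prop)

/-- Along a segment the frame runs through the frames of one helicoid. The parameters are the
integrals of `s' = θ₂` and `t' = k θ₁ / g`, which gives the bound for their variation. -/
theorem exists_matches_of_segment (hb : ∀ u ∈ U, F.b u ≠ 0) {c k : ℝ} {v₁ v₂ : C2}
    {u₀ u : R2} {s₀ t₀ : ℝ} (h₀ : F.Matches c k v₁ v₂ u₀ s₀ t₀) (hseg : segment ℝ u₀ u ⊆ U) :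
    ∃ s t, F.Matches c k v₁ v₂ u s t ∧
      ∀ K, (∀ y ∈ segment ℝ u₀ u, |F.θ₂ y (u - u₀)| ≤ K ∧
        |k * (F.g y)⁻¹ * F.θ₁ y (u - u₀)| ≤ K) → |s - s₀| ≤ K ∧ |t - t₀| ≤ K := by
  set w := u - u₀ with hw
  set γ : ℝ → R2 := fun τ => u₀ + τ • w with hγ
  have hγU : ∀ τ ∈ Set.Icc (0 : ℝ) 1, γ τ ∈ segment ℝ u₀ u := fun τ hτ => by
    rw [segment_eq_image']; exact ⟨τ, hτ, rfl⟩
  have hγc : Continuous γ := by fun_prop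
  -- The integrands are extended continuously beyond `[0, 1]`, where `γ` may leave `U`.
  let cl : ℝ → ℝ := fun τ => Set.projIcc (0 : ℝ) 1 zero_le_one τ
  have hcl : Continuous cl := continuous_subtype_val.comp continuous_projIcc
  have hclm : ∀ τ, cl τ ∈ Set.Icc (0 : ℝ) 1 := fun τ => (Set.projIcc (0 : ℝ) 1 zero_le_one τ).2
  have hcle : ∀ τ ∈ Set.Icc (0 : ℝ) 1, cl τ = τ := fun τ hτ => by
    simp only [cl, Set.projIcc_of_mem zero_le_one hτ]
  have hcU : ∀ τ, γ (cl τ) ∈ U := fun τ => hseg (hγU _ (hclm τ))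
  have hcc : Continuous fun τ => γ (cl τ) := hγc.comp hcl
  let s' : ℝ → ℝ := fun τ => F.θ₂ (γ (cl τ)) w
  let t' : ℝ → ℝ := fun τ => k * (F.g (γ (cl τ)))⁻¹ * F.θ₁ (γ (cl τ)) w
  have hs'c : Continuous s' := (F.continuousOn_θ₂ w).comp_continuous hcc hcU
  have ht'c : Continuous t' := (((continuousOn_const).mul ((F.smooth_g hb).continuousOn.inv₀
    fun y hy => (F.g_pos (hb y hy)).ne')).mul (F.continuousOn_θ₁ w)).comp_continuous hcc hcU
  let s : ℝ → ℝ := fun τ => s₀ + ∫ x in (0 : ℝ)..τ, s' x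
  let t : ℝ → ℝ := fun τ => t₀ + ∫ x in (0 : ℝ)..τ, t' x
  have hs : ∀ τ ∈ Set.Icc (0 : ℝ) 1, HasDerivAt s (F.θ₂ (γ τ) w) τ := fun τ hτ => by
    have := (hs'c.integral_hasStrictDerivAt 0 τ).hasDerivAt.const_add s₀
    simpa only [s', hcle τ hτ] using this
  have ht : ∀ τ ∈ Set.Icc (0 : ℝ) 1,
      HasDerivAt t (k * (F.g (γ τ))⁻¹ * F.θ₁ (γ τ) w) τ := fun τ hτ => by
    have := (ht'c.integral_hasStrictDerivAt 0 τ).hasDerivAt.const_add t₀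
    simpa only [t', hcle τ hτ] using this
  have hs0 : s 0 = s₀ := by simp [s]
  have ht0 : t 0 = t₀ := by simp [t]
  have hγ0 : γ 0 = u₀ := by simp [hγ]
  have hγ1 : γ 1 = u := by simp [hγ, hw]
  have hγd : ∀ τ, HasDerivAt γ w τ := fun τ => by
    exact (((hasDerivAt_id τ).smul_const w).const_add u₀).congr_deriv (one_smul _ _)
  have hder : ∀ {E : Type} [NormedAddCommGroup E] [NormedSpace ℝ E] (G : R2 → E),
      ContDiffOn ℝ ∞ G U → ∀ τ ∈ Set.Icc (0 : ℝ) 1,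
        HasDerivAt (fun τ => G (γ τ)) (F.θ₁ (γ τ) w • fderiv ℝ G (γ τ) (F.α (γ τ))
          + F.θ₂ (γ τ) w • fderiv ℝ G (γ τ) (F.β (γ τ))) τ := by
    intro E _ _ G hG τ hτ
    have hu := hseg (hγU τ hτ)
    have := (hG.differentiableAt_of_isOpen F.isOpen hu).hasFDerivAt.comp_hasDerivAt τ (hγd τ)
    rwa [F.fderiv_apply G hu] at this
  have hfd := hder f F.smooth_f
  have hed := hder F.e F.smooth_e
  have hA := hder (fun y => F.g y * F.r y) ((F.smooth_g hb).mul F.smooth_r)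
  have hB := hder (fun y => F.g y * F.C y) ((F.smooth_g hb).mul F.smooth_C)
  have hD := hder (fun y => F.g y * F.ρ y) ((F.smooth_g hb).mul F.smooth_ρ)
  have hmul : ∀ (q : R2 → ℝ), ContDiffOn ℝ ∞ q U → ∀ y ∈ U, ∀ v, fderiv ℝ (fun y => F.g y * q y) y v
      = F.g y * fderiv ℝ q y v + q y * fderiv ℝ F.g y v := by
    intro q hq y hy v
    have h1 := ((F.smooth_g hb).differentiableAt_of_isOpen F.isOpen hy).hasFDerivAt
    have h2 := (hq.differentiableAt_of_isOpen F.isOpen hy).hasFDerivAt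
    exact congrArg (fun L : R2 →L[ℝ] ℝ => L v) (h1.mul h2).fderiv
  have hA' : ∀ τ ∈ Set.Icc (0 : ℝ) 1, HasDerivAt (fun τ => F.g (γ τ) * F.r (γ τ))
      (F.θ₂ (γ τ) w * (2 * (F.g (γ τ) * F.C (γ τ)))) τ := fun τ hτ => by
    have hu := hseg (hγU τ hτ)
    refine (hA τ hτ).congr_deriv ?_
    rw [hmul _ F.smooth_r _ hu, hmul _ F.smooth_r _ hu, F.r_α hu, F.g_α hb hu, F.r_β hu,
      F.g_β hb hu]
    simp only [smul_eq_mul]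
    linear_combination F.θ₂ (γ τ) w * F.g (γ τ) * F.C (γ τ) * (F.r_mul_ρ hu + F.r_C _ hu)
  have hB' : ∀ τ ∈ Set.Icc (0 : ℝ) 1, HasDerivAt (fun τ => F.g (γ τ) * F.C (γ τ))
      (F.θ₂ (γ τ) w * (F.g (γ τ) * F.ρ (γ τ) - F.g (γ τ) * F.r (γ τ))) τ := fun τ hτ => by
    have hu := hseg (hγU τ hτ)
    refine (hB τ hτ).congr_deriv ?_
    rw [hmul _ F.smooth_C _ hu, hmul _ F.smooth_C _ hu, F.C_α hu, F.g_α hb hu, F.C_β hu,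
      F.g_β hb hu]
    simp only [smul_eq_mul]
    linear_combination F.θ₂ (γ τ) w * F.g (γ τ) * (-F.r (γ τ) * F.r_mul_ρ hu
      + F.ρ (γ τ) * F.r_C _ hu)
  have hD' : ∀ τ ∈ Set.Icc (0 : ℝ) 1, HasDerivAt (fun τ => F.g (γ τ) * F.ρ (γ τ))
      (F.θ₂ (γ τ) w * (-2 * (F.g (γ τ) * F.C (γ τ)))) τ := fun τ hτ => by
    have hu := hseg (hγU τ hτ)
    refine (hD τ hτ).congr_deriv ?_
    rw [hmul _ F.smooth_ρ _ hu, hmul _ F.smooth_ρ _ hu, F.ρ_α hu, F.g_α hb hu, F.ρ_β hu,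
      F.g_β hb hu]
    simp only [smul_eq_mul]
    ring
  -- The matrix `S = g (r, C; C, ρ)` rotates with `s`: its trace is constant, and the vector
  -- `(S₁₁ - S₂₂, 2 S₁₂)` turns by the angle `-2 s`.
  have hP := fun τ hτ => eq_of_hasDerivAt_zero (τ := τ) (fun τ hτ =>
    ((hA' τ hτ).add (hD' τ hτ)).congr_deriv (by ring)) hτ
  have hQ := fun τ hτ => eq_of_hasDerivAt_zero (τ := τ) (fun τ hτ =>
    ((((hA' τ hτ).sub (hD' τ hτ)).mul ((hs τ hτ).const_mul 2).cos).sub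
      (((hB' τ hτ).const_mul 2).mul ((hs τ hτ).const_mul 2).sin)).congr_deriv
        (by simp; ring)) hτ
  have hR := fun τ hτ => eq_of_hasDerivAt_zero (τ := τ) (fun τ hτ =>
    ((((hA' τ hτ).sub (hD' τ hτ)).mul ((hs τ hτ).const_mul 2).sin).add
      (((hB' τ hτ).const_mul 2).mul ((hs τ hτ).const_mul 2).cos)).congr_deriv
        (by simp; ring)) hτ
  simp only [Pi.add_apply, Pi.sub_apply, Pi.mul_apply, hs0, hγ0, h₀.S₁₁, h₀.S₁₂, h₀.S₂₂,
    Real.sin_two_mul, Real.cos_two_mul'] at hP hQ hR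
  have hS : ∀ τ ∈ Set.Icc (0 : ℝ) 1,
      F.g (γ τ) * F.r (γ τ) = k * (c * Real.cos (s τ) ^ 2 + Real.sin (s τ) ^ 2) ∧
      F.g (γ τ) * F.C (γ τ) = k * ((1 - c) * (Real.sin (s τ) * Real.cos (s τ))) ∧
      F.g (γ τ) * F.ρ (γ τ) = k * (c * Real.sin (s τ) ^ 2 + Real.cos (s τ) ^ 2) := by
    intro τ hτ
    have h1 := hP τ hτ
    have h2 := hQ τ hτ
    have h3 := hR τ hτ
    have e0 := Real.sin_sq_add_cos_sq s₀
    have e1 := Real.sin_sq_add_cos_sq (s τ)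
    generalize Real.sin s₀ = a, Real.cos s₀ = a', Real.sin (s τ) = x, Real.cos (s τ) = x',
      F.g (γ τ) * F.r (γ τ) = A, F.g (γ τ) * F.C (γ τ) = B, F.g (γ τ) * F.ρ (γ τ) = D at *
    have k1 : A + D = k * (c + 1) := by linear_combination h1 + k * (c + 1) * e0
    have k2 : (A - D) * (x' ^ 2 - x ^ 2) - 2 * B * (2 * x * x') = k * (c - 1) := by
      linear_combination h2 + k * (c - 1) * (a ^ 2 + a' ^ 2 + 1) * e0
    have k3 : (A - D) * (2 * x * x') + 2 * B * (x' ^ 2 - x ^ 2) = 0 := by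
      linear_combination h3
    have k4 : A - D = k * (c - 1) * (x' ^ 2 - x ^ 2) := by
      linear_combination (x' ^ 2 - x ^ 2) * k2 + 2 * x * x' * k3
        - (A - D) * (x ^ 2 + x' ^ 2 + 1) * e1
    have k5 : 2 * B = k * (1 - c) * (2 * x * x') := by
      linear_combination (x' ^ 2 - x ^ 2) * k3 - 2 * x * x' * k2
        - 2 * B * (x ^ 2 + x' ^ 2 + 1) * e1
    refine ⟨?_, ?_, ?_⟩
    · linear_combination (k1 + k4 - k * (c + 1) * e1) / 2
    · linear_combination k5 / 2
    · linear_combination (k1 - k4 - k * (c + 1) * e1) / 2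
  have hx : ∀ τ ∈ Set.Icc (0 : ℝ) 1, HasDerivAt (fun τ => f (γ τ))
      ((F.θ₁ (γ τ) w) • (F.r (γ τ) • complexJ (f (γ τ)) + F.C (γ τ) • complexJ (F.e (γ τ)))
        + F.θ₂ (γ τ) w • F.e (γ τ)) τ := fun τ hτ => by
    have hu := hseg (hγU τ hτ)
    have := hfd τ hτ
    rwa [F.f_α _ hu, F.f_β _ hu] at this
  have he : ∀ τ ∈ Set.Icc (0 : ℝ) 1, HasDerivAt (fun τ => F.e (γ τ))
      ((F.θ₁ (γ τ) w) • (F.C (γ τ) • complexJ (f (γ τ)) + F.ρ (γ τ) • complexJ (F.e (γ τ)))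
        + F.θ₂ (γ τ) w • -f (γ τ)) τ := fun τ hτ => by
    have hu := hseg (hγU τ hτ)
    have := hed τ hτ
    rwa [F.e_α hu, F.e_β hu] at this
  -- The eigenvectors of the linear vector field, transported back to `t = 0`, are constant.
  have hv₁ := fun τ hτ => eq_of_hasDerivAt_zero (τ := τ) (fun τ hτ =>
    (hasDerivAt_rotJ (((ht τ hτ).const_mul c).neg)
      (((hs τ hτ).cos.smul (hx τ hτ)).sub ((hs τ hτ).sin.smul (he τ hτ)))).congr_deriv (by
        obtain ⟨k1, k2, k3⟩ := hS τ hτ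
        have hg := (F.g_pos (hb _ (hseg (hγU τ hτ)))).ne'
        rw [mul_comm, ← eq_div_iff hg] at k1 k2 k3
        have e1 := Real.sin_sq_add_cos_sq (s τ)
        convert rotJ_zero_right _ using 2
        simp only [Pi.sub_apply, Pi.smul_apply', map_sub, map_smul]
        match_scalars
        · simp only [k1, k2]
          field_simp
          linear_combination F.θ₁ (γ τ) w * k * c * Real.cos (s τ) * e1
        · simp only [k2, k3]
          field_simp
          linear_combination F.θ₁ (γ τ) w * k * (-c) * Real.sin (s τ) * e1
        · ring
        · ring)) hτ
  have hv₂ := fun τ hτ => eq_of_hasDerivAt_zero (τ := τ) (fun τ hτ =>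
    (hasDerivAt_rotJ ((ht τ hτ).neg)
      (((hs τ hτ).sin.smul (hx τ hτ)).add ((hs τ hτ).cos.smul (he τ hτ)))).congr_deriv (by
        obtain ⟨k1, k2, k3⟩ := hS τ hτ
        have hg := (F.g_pos (hb _ (hseg (hγU τ hτ)))).ne'
        rw [mul_comm, ← eq_div_iff hg] at k1 k2 k3
        have e1 := Real.sin_sq_add_cos_sq (s τ)
        convert rotJ_zero_right _ using 2
        simp only [Pi.add_apply, Pi.smul_apply', map_add, map_smul]
        match_scalars
        · simp only [k1, k2]
          field_simp
          linear_combination F.θ₁ (γ τ) w * k * Real.sin (s τ) * e1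
        · simp only [k2, k3]
          field_simp
          linear_combination F.θ₁ (γ τ) w * k * Real.cos (s τ) * e1
        · ring
        · ring)) hτ
  have one_mem : (1 : ℝ) ∈ Set.Icc (0 : ℝ) 1 := by simp
  have hv₁ := hv₁ 1 one_mem
  have hv₂ := hv₂ 1 one_mem
  obtain ⟨k1, k2, k3⟩ := hS 1 one_mem
  simp only [Pi.sub_apply, Pi.add_apply, Pi.smul_apply', Pi.neg_apply, hγ0, hγ1, hs0, ht0,
    h₀.f_eq, h₀.e_eq] at hv₁ hv₂
  rw [hγ1] at k1 k2 k3
  rw [cos_helicoid_sub_sin_ruling, rotJ_rotJ_neg] at hv₁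
  rw [sin_helicoid_add_cos_ruling, rotJ_rotJ_neg] at hv₂
  replace hv₁ := eq_rotJ_of_rotJ_neg_eq hv₁
  replace hv₂ := eq_rotJ_of_rotJ_neg_eq hv₂
  have e1 := Real.sin_sq_add_cos_sq (s 1)
  refine ⟨s 1, t 1, ⟨?_, ?_, k1, k2, k3⟩, ?_⟩
  · rw [helicoid, ← hv₁, ← hv₂]
    match_scalars
    · linear_combination -e1
    · ring
  · rw [helicoidRuling, ← hv₁, ← hv₂]
    match_scalars
    · linear_combination -e1
    · ring
  · intro K hK
    have hbd : ∀ q : ℝ → ℝ, (∀ τ, |q τ| ≤ K) → |∫ x in (0 : ℝ)..1, q x| ≤ K := fun q hq => by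
      simpa using intervalIntegral.norm_integral_le_of_norm_le_const (a := 0) (b := 1) (f := q)
        (C := K) (fun x _ => hq x)
    have h1 := hbd s' fun τ => (hK _ (hγU _ (hclm τ))).1
    have h2 := hbd t' fun τ => (hK _ (hγU _ (hclm τ))).2
    simp only [s, t, add_sub_cancel_left]
    exact ⟨h1, h2⟩

end HelicoidalFrame

namespace HelicoidalFrame

variable {f : R2 → C2} {U : Set R2}

/-- At each point with `b ≠ 0` the frame is that of a suitable helicoid: `v₁`, `v₂` are the
eigenvectors of the linear vector field tangent to the surface, and `s` is the angle between this
basis and `(f, e)`. -/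
theorem exists_matches (F : HelicoidalFrame f U) {u : R2} (hu : u ∈ U) (hb : F.b u ≠ 0) :
    ∃ c k : ℝ, ∃ v₁ v₂ : C2, ∃ s : ℝ, IsUnitaryPair v₁ v₂ ∧ F.Matches c k v₁ v₂ u s 0 := by
  have hg := F.g_pos hb
  set A := F.g u * F.r u with hA
  set B := F.g u * F.C u with hB
  set D := F.g u * F.ρ u with hD
  have hdet : A * D - B ^ 2 ≠ 0 := by
    have : A * D - B ^ 2 = -(F.g u ^ 2 * F.b u) := by
      rw [hA, hB, hD]; linear_combination F.g u ^ 2 * F.r_mul_ρ hu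
    rw [this]
    exact neg_ne_zero.2 (mul_ne_zero (pow_ne_zero _ hg.ne') hb)
  -- The eigenvalues of the symmetric matrix `(A, B; B, D)` are `k` and `k c`; the double angle of
  -- an eigenvector is minus the argument of `w`.
  set w : ℂ := ⟨A - D, 2 * B⟩ with hw
  have hn : ‖w‖ ^ 2 = (A - D) ^ 2 + (2 * B) ^ 2 := by
    rw [← Complex.normSq_eq_norm_sq, Complex.normSq_mk]; ring
  set s := -(w.arg / 2) with hs
  have hre : ‖w‖ * Real.cos (2 * s) = A - D := by
    rw [hs, show 2 * -(w.arg / 2) = -w.arg by ring, Real.cos_neg, Complex.norm_mul_cos_arg]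
  have him : ‖w‖ * Real.sin (2 * s) = -(2 * B) := by
    rw [hs, show 2 * -(w.arg / 2) = -w.arg by ring, Real.sin_neg, mul_neg,
      Complex.norm_mul_sin_arg]
  set k := (A + D - ‖w‖) / 2 with hk
  set m := (A + D + ‖w‖) / 2 with hm
  have hkm : k * m = A * D - B ^ 2 := by
    rw [hk, hm]; linear_combination -hn / 4
  have hk0 : k ≠ 0 := fun h => hdet (by rw [← hkm, h, zero_mul])
  have hkc : k * (m / k) = m := by field_simp
  have hp := F.pair u hu
  have e1 := Real.sin_sq_add_cos_sq s
  rw [Real.cos_two_mul'] at hre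
  rw [Real.sin_two_mul] at him
  refine ⟨m / k, k, Real.cos s • f u - Real.sin s • F.e u, Real.sin s • f u + Real.cos s • F.e u, s,
    ?_, ?_⟩
  · constructor
    all_goals
      simp only [map_sub, map_smul, inner_sub_left, inner_sub_right, inner_add_left,
        inner_add_right, real_inner_smul_left, real_inner_smul_right, hp.xx, hp.ee, hp.xe, hp.ex,
        hp.Jxe, hp.Jex, inner_complexJ_self]
    · linear_combination e1
    · linear_combination e1
    · ring
    · ring
  · refine ⟨?_, ?_, ?_, ?_, ?_⟩
    · simp only [helicoid, mul_zero, rotJ_zero_left]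
      match_scalars
      · linear_combination -e1
      · ring
    · simp only [helicoidRuling, mul_zero, rotJ_zero_left]
      match_scalars
      · linear_combination -e1
      · ring
    · rw [mul_add, ← mul_assoc, hkc, hk, hm]
      linear_combination -hre / 2 - (A + D) / 2 * e1
    · rw [← mul_assoc, mul_sub, hkc, hk, hm]
      linear_combination him / 2
    · rw [mul_add, ← mul_assoc, hkc, hk, hm]
      linear_combination hre / 2 - (A + D) / 2 * e1

/-! ### Changes of helicoidal frames -/

/-- The restriction of a frame to a smaller open set. -/
def restrict (F : HelicoidalFrame f U) {V : Set R2} (hV : IsOpen V) (h : V ⊆ U) :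
    HelicoidalFrame f V where
  α := F.α
  β := F.β
  e := F.e
  r := F.r
  C := F.C
  b := F.b
  isOpen := hV
  smooth_f := F.smooth_f.mono h
  smooth_α := F.smooth_α.mono h
  smooth_β := F.smooth_β.mono h
  smooth_e := F.smooth_e.mono h
  smooth_r := F.smooth_r.mono h
  smooth_C := F.smooth_C.mono h
  smooth_b := F.smooth_b.mono h
  pair u hu := F.pair u (h hu)
  r_C u hu := F.r_C u (h hu)
  f_α u hu := F.f_α u (h hu)
  f_β u hu := F.f_β u (h hu)
  N_α u hu := F.N_α u (h hu)
  N_β u hu := F.N_β u (h hu)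

theorem _root_.IsUnitaryPair.neg {x e : C2} (h : IsUnitaryPair x e) : IsUnitaryPair x (-e) :=
  ⟨h.xx, by simpa using h.ee, by simpa using h.xe, by simpa using h.Jxe⟩

/-- Reversing the rulings and the normal. -/
def flipNormal (F : HelicoidalFrame f U) : HelicoidalFrame f U where
  α := F.α
  β := fun u => -F.β u
  e := fun u => -F.e u
  r := F.r
  C := fun u => -F.C u
  b := F.b
  isOpen := F.isOpen
  smooth_f := F.smooth_f
  smooth_α := F.smooth_α
  smooth_β := F.smooth_β.neg
  smooth_e := F.smooth_e.neg
  smooth_r := F.smooth_r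
  smooth_C := F.smooth_C.neg
  smooth_b := F.smooth_b
  pair u hu := (F.pair u hu).neg
  r_C u hu := by rw [neg_sq]; exact F.r_C u hu
  f_α u hu := by rw [F.f_α u hu, map_neg]; module
  f_β u hu := by rw [map_neg, F.f_β u hu]
  N_α u hu := by
    have : (fun u => -F.C u • complexJ (f u) - F.r u • complexJ (-F.e u))
        = fun u => -(F.C u • complexJ (f u) - F.r u • complexJ (F.e u)) := by
      funext u; rw [map_neg]; module
    rw [this, fderiv_fun_neg, neg_apply, F.N_α u hu]; module
  N_β u hu := by
    have : (fun u => -F.C u • complexJ (f u) - F.r u • complexJ (-F.e u))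
        = fun u => -(F.C u • complexJ (f u) - F.r u • complexJ (F.e u)) := by
      funext u; rw [map_neg]; module
    rw [this, fderiv_fun_neg, neg_apply, map_neg, F.N_β u hu, map_neg]; module

/-- Reversing both tangent fields of the frame. -/
def flipTangent (F : HelicoidalFrame f U) : HelicoidalFrame f U where
  α := fun u => -F.α u
  β := fun u => -F.β u
  e := fun u => -F.e u
  r := fun u => -F.r u
  C := F.C
  b := F.b
  isOpen := F.isOpen
  smooth_f := F.smooth_f
  smooth_α := F.smooth_α.neg
  smooth_β := F.smooth_β.neg
  smooth_e := F.smooth_e.neg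
  smooth_r := F.smooth_r.neg
  smooth_C := F.smooth_C
  smooth_b := F.smooth_b
  pair u hu := (F.pair u hu).neg
  r_C u hu := by rw [neg_sq]; exact F.r_C u hu
  f_α u hu := by rw [map_neg, F.f_α u hu, map_neg]; module
  f_β u hu := by rw [map_neg, F.f_β u hu]
  N_α u hu := by
    have : (fun u => F.C u • complexJ (f u) - -F.r u • complexJ (-F.e u))
        = fun u => (F.C u • complexJ (f u) - F.r u • complexJ (F.e u)) := by
      funext u; rw [map_neg]; module
    rw [this, map_neg, F.N_α u hu]; module
  N_β u hu := by
    have : (fun u => F.C u • complexJ (f u) - -F.r u • complexJ (-F.e u))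
        = fun u => (F.C u • complexJ (f u) - F.r u • complexJ (F.e u)) := by
      funext u; rw [map_neg]; module
    rw [this, map_neg, F.N_β u hu, map_neg]; module

/-- The pull-back of a frame by a diffeomorphism `τ : V → U` with inverse `σ`. -/
noncomputable def pullback (F : HelicoidalFrame f U) {V : Set R2} (hV : IsOpen V)
    {f' : R2 → C2} {τ σ : R2 → R2}
    (hτ : ContDiffOn ℝ ∞ τ V) (hσ : ContDiffOn ℝ ∞ σ U) (hτU : Set.MapsTo τ V U)
    (hτσ : ∀ y ∈ U, τ (σ y) = y) (hστ : ∀ u ∈ V, σ (τ u) = u)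
    (hf' : ∀ u ∈ V, f' u = f (τ u)) : HelicoidalFrame f' V :=
  have hchain : ∀ {E : Type} [NormedAddCommGroup E] [NormedSpace ℝ E] (G : R2 → E) (G' : R2 → E),
      ContDiffOn ℝ ∞ G U → (∀ u ∈ V, G' u = G (τ u)) → ∀ u ∈ V, ∀ v : R2,
      fderiv ℝ G' u (fderiv ℝ σ (τ u) v) = fderiv ℝ G (τ u) v := by
    intro E _ _ G G' hG hGG' u hu v
    have h1 : G' =ᶠ[𝓝 u] fun u => G (τ u) := Filter.eventually_of_mem (hV.mem_nhds hu) hGG'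
    have hdG := (hG.differentiableAt_of_isOpen F.isOpen (hτU hu)).hasFDerivAt
    have hdσ := (hσ.differentiableAt_of_isOpen F.isOpen (hτU hu)).hasFDerivAt
    have hdτ := (hτ.differentiableAt_of_isOpen hV hu).hasFDerivAt
    have h2 := hdG.comp u hdτ
    rw [h1.fderiv_eq]
    erw [h2.fderiv]
    rw [← hστ u hu] at hdτ
    have h3 := hdτ.comp (τ u) hdσ
    have h4 : (τ ∘ σ) =ᶠ[𝓝 (τ u)] id :=
      Filter.eventually_of_mem (F.isOpen.mem_nhds (hτU hu)) hτσ
    have h5 := (h3.congr_of_eventuallyEq h4.symm).unique (hasFDerivAt_id (τ u))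
    have h6 := congrArg (fun L : R2 →L[ℝ] R2 => L v) h5
    simp only [ContinuousLinearMap.comp_apply, ContinuousLinearMap.id_apply, hστ u hu] at h6
    rw [ContinuousLinearMap.comp_apply, h6]
  { α := fun u => fderiv ℝ σ (τ u) (F.α (τ u))
    β := fun u => fderiv ℝ σ (τ u) (F.β (τ u))
    e := fun u => F.e (τ u)
    r := fun u => F.r (τ u)
    C := fun u => F.C (τ u)
    b := fun u => F.b (τ u)
    isOpen := hV
    smooth_f := (F.smooth_f.comp hτ hτU).congr hf'
    smooth_α := (ContDiffOn.dirD F.isOpen hσ F.smooth_α).comp hτ hτU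
    smooth_β := (ContDiffOn.dirD F.isOpen hσ F.smooth_β).comp hτ hτU
    smooth_e := F.smooth_e.comp hτ hτU
    smooth_r := F.smooth_r.comp hτ hτU
    smooth_C := F.smooth_C.comp hτ hτU
    smooth_b := F.smooth_b.comp hτ hτU
    pair := fun u hu => by rw [hf' u hu]; exact F.pair _ (hτU hu)
    r_C := fun u hu => F.r_C _ (hτU hu)
    f_α := fun u hu => by
      rw [hchain f f' F.smooth_f hf' u hu, hf' u hu]; exact F.f_α _ (hτU hu)
    f_β := fun u hu => by rw [hchain f f' F.smooth_f hf' u hu]; exact F.f_β _ (hτU hu)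
    N_α := fun u hu => by
      rw [hchain F.N _ F.smooth_N (fun w hw => by rw [N, hf' w hw]) u hu]
      exact F.N_α _ (hτU hu)
    N_β := fun u hu => by
      rw [hchain F.N _ F.smooth_N (fun w hw => by rw [N, hf' w hw]) u hu, hf' u hu]
      exact F.N_β _ (hτU hu) }

end HelicoidalFrame

/-! ### Uniqueness of helicoidal frames -/

namespace HelicoidalFrame

variable {f : R2 → C2} {U : Set R2}

theorem inner_N_N (F : HelicoidalFrame f U) {u : R2} (hu : u ∈ U) :
    inner ℝ (F.N u) (F.N u) = 1 := by
  have hp := F.pair u hu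
  have := hp.inner_comb 0 (F.C u) 0 (-F.r u) 0 (F.C u) 0 (-F.r u)
  have hN : F.N u = (0 : ℝ) • f u + F.C u • complexJ (f u) + (0 : ℝ) • F.e u
    + (-F.r u) • complexJ (F.e u) := by rw [N]; module
  rw [hN, this]
  linear_combination F.r_C u hu

theorem eq_smul_N (F : HelicoidalFrame f U) {u : R2} (hu : u ∈ U) {n : C2}
    (h0 : inner ℝ (f u) n = 0) (h1 : inner ℝ (fderiv ℝ f u (F.α u)) n = 0)
    (h2 : inner ℝ (F.e u) n = 0) : n = inner ℝ (F.N u) n • F.N u := by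
  have hp := F.pair u hu
  have hrC := F.r_C u hu
  have ex := hp.expand n
  rw [F.f_α u hu] at h1
  rw [h0, h2] at ex
  rw [N]
  simp only [inner_sub_left, inner_add_left, real_inner_smul_left] at h1 ⊢
  conv_lhs => rw [ex]
  match_scalars
  · ring
  · linear_combination (-inner ℝ (complexJ (f u)) n) * hrC + F.r u * h1
  · ring
  · linear_combination (-inner ℝ (complexJ (F.e u)) n) * hrC + F.C u * h1

theorem inner_f_N (F : HelicoidalFrame f U) {u : R2} (hu : u ∈ U) :
    inner ℝ (f u) (F.N u) = 0 := by
  have hp := F.pair u hu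
  simp only [N, inner_sub_right, real_inner_smul_right, inner_self_complexJ, hp.xJe]
  ring

theorem inner_fderiv_N (F : HelicoidalFrame f U) {u : R2} (hu : u ∈ U) (v : R2) :
    inner ℝ (fderiv ℝ f u v) (F.N u) = 0 := by
  have hp := F.pair u hu
  rw [F.fderiv_apply f hu v, F.f_α u hu, F.f_β u hu]
  simp only [N, inner_sub_right, inner_add_left, real_inner_smul_right, real_inner_smul_left,
    inner_complexJ_complexJ, inner_self_complexJ, hp.eJx, hp.xx, hp.ee, hp.xe, hp.ex]
  ring

/-- Two frames of the same surface have, up to sign, the same normal; if the normals agree at `u`,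
then so do their derivatives. -/
theorem fderiv_N_eq {U' : Set R2} (F : HelicoidalFrame f U) (F' : HelicoidalFrame f U') {u : R2}
    (hu : u ∈ U) (hu' : u ∈ U') (hN : F'.N u = F.N u) : fderiv ℝ F'.N u = fderiv ℝ F.N u := by
  have hev : F'.N =ᶠ[𝓝 u] fun w => inner ℝ (F.N w) (F'.N w) • F.N w := by
    filter_upwards [F.isOpen.mem_nhds hu, F'.isOpen.mem_nhds hu'] with w hw hw'
    refine F.eq_smul_N hw (F'.inner_f_N hw') (F'.inner_fderiv_N hw' _) ?_
    rw [← F.f_β w hw]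
    exact F'.inner_fderiv_N hw' _
  have hd := (F.smooth_N.differentiableAt_of_isOpen F.isOpen hu).hasFDerivAt
  have hd' := (F'.smooth_N.differentiableAt_of_isOpen F'.isOpen hu').hasFDerivAt
  have hs := hd.inner ℝ hd'
  have hmul := hs.smul hd
  have heq := hd'.unique (hmul.congr_of_eventuallyEq hev)
  have h1 := F.inner_N_N hu
  -- The sign is locally constant because its square is `1`.
  have hsq : ∀ v, inner ℝ (F.N u) (fderiv ℝ F.N u v) = 0 := by
    intro v
    have : (fun w => inner ℝ (F.N w) (F.N w)) =ᶠ[𝓝 u] fun _ => (1 : ℝ) :=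
      Filter.eventually_of_mem (F.isOpen.mem_nhds hu) fun w hw => F.inner_N_N hw
    have h := ((hd.inner ℝ hd).congr_of_eventuallyEq this.symm).unique (hasFDerivAt_const (1 : ℝ) u)
    have h := congrArg (fun L : R2 →L[ℝ] ℝ => L v) h
    simp [fderivInnerCLM_apply] at h
    rw [real_inner_comm (F.N u)] at h
    linarith
  have hsq' : ∀ v, inner ℝ (F'.N u) (fderiv ℝ F'.N u v) = 0 := by
    intro v
    have : (fun w => inner ℝ (F'.N w) (F'.N w)) =ᶠ[𝓝 u] fun _ => (1 : ℝ) :=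
      Filter.eventually_of_mem (F'.isOpen.mem_nhds hu') fun w hw => F'.inner_N_N hw
    have h := ((hd'.inner ℝ hd').congr_of_eventuallyEq this.symm).unique
      (hasFDerivAt_const (1 : ℝ) u)
    have h := congrArg (fun L : R2 →L[ℝ] ℝ => L v) h
    simp [fderivInnerCLM_apply] at h
    rw [real_inner_comm (F'.N u)] at h
    linarith
  ext1 v
  have h3 := hsq' v
  rw [hN] at h3
  have h4 := congrArg (fun L : R2 →L[ℝ] C2 => L v) heq
  simp only [add_apply, smul_apply, ContinuousLinearMap.smulRight_apply,
    ContinuousLinearMap.comp_apply, ContinuousLinearMap.prod_apply, fderivInnerCLM_apply] at h4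
  rw [hN, h3, real_inner_comm (F.N u) (fderiv ℝ F.N u v), hsq v, h1] at h4
  simpa using h4

/-- Two frames with the same vectors at `u` have the same second fundamental form there. -/
theorem invariants_eq {U' : Set R2} (F : HelicoidalFrame f U) (F' : HelicoidalFrame f U') {u : R2}
    (hu : u ∈ U) (hu' : u ∈ U') (he : F'.e u = F.e u) (hr : F'.r u = F.r u) (hC : F'.C u = F.C u) :
    F'.b u = F.b u := by
  have hN : F'.N u = F.N u := by rw [N, N, he, hr, hC]
  have hα : F'.α u = F.α u := by
    apply F.fderiv_injective hu
    rw [F.f_α u hu, F'.f_α u hu', he, hr, hC]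
  have h1 : fderiv ℝ F.N u (F.α u) = _ := F.N_α u hu
  have h2 : fderiv ℝ F'.N u (F'.α u) = _ := F'.N_α u hu'
  rw [F.fderiv_N_eq F' hu hu' hN, hα, h1, he] at h2
  have := congrArg (inner ℝ (F.e u)) h2
  simp only [real_inner_smul_right, (F.pair u hu).ee] at this
  linarith

/-- Where `r ≠ 0` the coefficient `ρ` is determined by `r`, `C`, `b`, so that frames with the same
values of `f`, `e`, `r`, `C`, `b` match the same helicoid. -/
theorem Matches.congr {f' : R2 → C2} {U' : Set R2} {F : HelicoidalFrame f U}
    (F' : HelicoidalFrame f' U') {u u' : R2} (hu : u ∈ U) (hu' : u' ∈ U') (hf : f' u' = f u)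
    (he : F'.e u' = F.e u) (hr : F'.r u' = F.r u) (hC : F'.C u' = F.C u) (hb : F'.b u' = F.b u)
    (hr0 : F.r u ≠ 0) {c k : ℝ} {v₁ v₂ : C2} {s t : ℝ} (h : F.Matches c k v₁ v₂ u s t) :
    F'.Matches c k v₁ v₂ u' s t := by
  have hg : F'.g u' = F.g u := by rw [g, g, hb]
  have hρ : F'.ρ u' = F.ρ u := by
    apply mul_left_cancel₀ hr0
    rw [F.r_mul_ρ hu, ← hr, F'.r_mul_ρ hu', hb, hC]
  exact ⟨hf ▸ h.f_eq, he ▸ h.e_eq, by rw [hg, hr]; exact h.S₁₁, by rw [hg, hC]; exact h.S₁₂,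
    by rw [hg, hρ]; exact h.S₂₂⟩

theorem Matches.transfer {U' : Set R2} {F : HelicoidalFrame f U} (F' : HelicoidalFrame f U')
    {u : R2} (hu : u ∈ U) (hu' : u ∈ U') (he : F'.e u = F.e u) (hr : F'.r u = F.r u)
    (hC : F'.C u = F.C u) (hr0 : F.r u ≠ 0) {c k : ℝ} {v₁ v₂ : C2} {s t : ℝ}
    (h : F.Matches c k v₁ v₂ u s t) : F'.Matches c k v₁ v₂ u s t :=
  h.congr F' hu hu' rfl he hr hC (F.invariants_eq F' hu hu' he hr hC) hr0

/-- Where `r ≠ 0`, two frames of the same surface agree after sign changes. -/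
theorem exists_frame_eq {U' : Set R2} (F : HelicoidalFrame f U) (F' : HelicoidalFrame f U') {u : R2}
    (hu : u ∈ U) (hu' : u ∈ U') (hr0 : F.r u ≠ 0) :
    ∃ G : HelicoidalFrame f U', G.b = F'.b ∧ G.e u = F.e u ∧ G.r u = F.r u ∧ G.C u = F.C u := by
  have hp := F.pair u hu
  have hp' := F'.pair u hu'
  have hrC := F.r_C u hu
  -- The horizontal directions of the tangent plane form the line of `e`.
  have h1 := F.fderiv_apply f hu (F'.β u)
  have h2 := F.fderiv_apply f hu (F'.α u)
  rw [F'.f_β u hu', F.f_α u hu, F.f_β u hu] at h1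
  rw [F'.f_α u hu', F.f_α u hu, F.f_β u hu] at h2
  generalize F.θ₁ u (F'.β u) = a, F.θ₂ u (F'.β u) = ε, F.θ₁ u (F'.α u) = δ,
    F.θ₂ u (F'.α u) = d at h1 h2
  have ha : a = 0 := by
    have := hp'.Jxe
    rw [h1] at this
    simp only [inner_add_right, real_inner_smul_right, inner_complexJ_complexJ, hp.xx, hp.Jxe,
      hp.xe] at this
    have : a * F.r u = 0 := by linear_combination this
    exact (mul_eq_zero.1 this).resolve_right hr0
  subst ha
  have he : F'.e u = ε • F.e u := by rw [h1]; module
  have hε : ε = 1 ∨ ε = -1 := by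
    have := hp'.ee
    rw [he, real_inner_smul_left, real_inner_smul_right, hp.ee] at this
    exact mul_self_eq_one_iff.1 (by linarith)
  have hε0 : ε ≠ 0 := by rcases hε with h | h <;> simp [h]
  have hd : d = 0 := by
    have h := congrArg (inner ℝ (F'.e u)) h2
    rw [he] at h
    simp only [inner_add_right, real_inner_smul_right, real_inner_smul_left, hp.ee, hp.eJx,
      inner_self_complexJ] at h
    have h3 : ε * inner ℝ (F.e u) (complexJ (ε • F.e u)) = 0 := by
      rw [map_smul, real_inner_smul_right, inner_self_complexJ]; ring
    have : ε * d = 0 := by linear_combination -h + F'.C u * h3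
    exact (mul_eq_zero.1 this).resolve_left hε0
  subst hd
  rw [he, map_smul] at h2
  obtain ⟨-, h3, -, h4⟩ := hp.coeff_eq_zero (a := 0) (b := F'.r u - δ * F.r u) (c := 0)
    (d := F'.C u * ε - δ * F.C u) (by linear_combination (norm := module) (1 : ℝ) • h2)
  have hε2 : ε * ε = 1 := mul_self_eq_one_iff.2 hε
  have hr : F'.r u = δ * F.r u := by linarith
  have hC : F'.C u = ε * δ * F.C u := by linear_combination ε * h4 - F'.C u * hε2
  have hδ : δ = 1 ∨ δ = -1 := by
    have h := F'.r_C u hu'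
    rw [hr, hC] at h
    exact mul_self_eq_one_iff.1 (by
      linear_combination h - δ ^ 2 * hrC - δ ^ 2 * F.C u ^ 2 * (hε2))
  rcases hε with rfl | rfl <;> rcases hδ with rfl | rfl
  · exact ⟨F', rfl, by simpa using he, by simpa using hr, by simpa using hC⟩
  · refine ⟨F'.flipNormal.flipTangent, rfl, ?_, ?_, ?_⟩
    · change - -F'.e u = _; simp [he]
    · change -F'.r u = _; simp [hr]
    · change -F'.C u = _; simp [hC]
  · refine ⟨F'.flipNormal, rfl, ?_, ?_, ?_⟩
    · change -F'.e u = _; simp [he]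
    · change F'.r u = _; simp [hr]
    · change -F'.C u = _; simp [hC]
  · refine ⟨F'.flipTangent, rfl, ?_, ?_, ?_⟩
    · change -F'.e u = _; simp [he]
    · change -F'.r u = _; simp [hr]
    · change F'.C u = _; simp [hC]

/-- A surface with a helicoidal frame with `b ≠ 0` lies in no hyperplane, not even locally: a vector
orthogonal to the surface is a multiple of the normal, whose derivative does not vanish. -/
theorem not_eventually_inner_eq_zero (F : HelicoidalFrame f U) {u : R2} (hu : u ∈ U)
    (hb : F.b u ≠ 0) {n : C2} (hn : n ≠ 0) : ¬ ∀ᶠ w in 𝓝 u, inner ℝ (f w) n = 0 := by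
  intro hev
  have hp := F.pair u hu
  have hd : ∀ (G : R2 → C2), ContDiffOn ℝ ∞ G U → (∀ᶠ w in 𝓝 u, inner ℝ (G w) n = 0) → 
      ∀ᶠ w in 𝓝 u, ∀ v, inner ℝ (fderiv ℝ G w v) n = 0 := by
    intro G hG h
    filter_upwards [h.eventually_nhds, F.isOpen.mem_nhds hu] with w hw hwU v
    have h1 := (hG.differentiableAt_of_isOpen F.isOpen hwU).hasFDerivAt.inner ℝ
      (hasFDerivAt_const n w)
    have h2 := h1.unique ((hasFDerivAt_const (0 : ℝ) w).congr_of_eventuallyEq hw)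
    have h3 := congrArg (fun L : R2 →L[ℝ] ℝ => L v) h2
    simpa [fderivInnerCLM_apply] using h3
  have hdα : ∀ᶠ w in 𝓝 u, inner ℝ (F.e w) n = 0 := by
    filter_upwards [hd f F.smooth_f hev, F.isOpen.mem_nhds hu] with w hw hwU
    rw [← F.f_β w hwU]
    exact hw _
  have h0 := hev.self_of_nhds
  have h1 := (hd f F.smooth_f hev).self_of_nhds (F.α u)
  have h2 := hdα.self_of_nhds
  have h3 := (hd F.e F.smooth_e hdα).self_of_nhds (F.α u)
  have hN := F.eq_smul_N hu h0 h1 h2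
  generalize inner ℝ (F.N u) n = a at hN
  rw [F.e_α hu, hN, N] at h3
  simp only [inner_sub_right, inner_add_left, real_inner_smul_right, real_inner_smul_left,
    inner_complexJ_complexJ, hp.xx, hp.ee, hp.xe, hp.ex] at h3
  have : a * F.b u = 0 := by linear_combination h3 + a * F.r_mul_ρ hu
  rcases mul_eq_zero.1 this with h | h
  · exact hn (by rw [hN, h, zero_smul])
  · exact hb h

end HelicoidalFrame

/-! ### Orthonormal frames of surfaces minimal for all Berger metrics -/

/-- An orthonormal frame `α`, `β` of the metric induced on a surface `f : U → S³`, with unit normal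
`N` and second fundamental form `(p, q; q, -p)`, such that the direction `A₂ α - A₁ β`, orthogonal
to the tangential part `A₁ α + A₂ β` of the Hopf field, is asymptotic. Such frames express
minimality for all Berger metrics. -/
structure SurfaceFrame (f : R2 → C2) (U : Set R2) where
  α : R2 → R2
  β : R2 → R2
  N : R2 → C2
  p : R2 → ℝ
  q : R2 → ℝ
  isOpen : IsOpen U
  smooth_f : ContDiffOn ℝ ∞ f U
  smooth_α : ContDiffOn ℝ ∞ α U
  smooth_β : ContDiffOn ℝ ∞ β U
  smooth_N : ContDiffOn ℝ ∞ N U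
  smooth_p : ContDiffOn ℝ ∞ p U
  smooth_q : ContDiffOn ℝ ∞ q U
  orthonormal : ∀ u ∈ U, Orthonormal ℝ ![f u, fderiv ℝ f u (α u), fderiv ℝ f u (β u), N u]
  N_α : ∀ u ∈ U, fderiv ℝ N u (α u) = -p u • fderiv ℝ f u (α u) - q u • fderiv ℝ f u (β u)
  N_β : ∀ u ∈ U, fderiv ℝ N u (β u) = -q u • fderiv ℝ f u (α u) + p u • fderiv ℝ f u (β u)
  asymptotic : ∀ u ∈ U,
    (inner ℝ (complexJ (f u)) (fderiv ℝ f u (β u)) ^ 2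
      - inner ℝ (complexJ (f u)) (fderiv ℝ f u (α u)) ^ 2) * p u
    - 2 * inner ℝ (complexJ (f u)) (fderiv ℝ f u (α u))
      * inner ℝ (complexJ (f u)) (fderiv ℝ f u (β u)) * q u = 0

theorem orthonormal_vec4_iff {x a b n : C2} : Orthonormal ℝ ![x, a, b, n] ↔
    (inner ℝ x x = 1 ∧ inner ℝ a a = 1 ∧ inner ℝ b b = 1 ∧ inner ℝ n n = 1) ∧
    inner ℝ x a = 0 ∧ inner ℝ x b = 0 ∧ inner ℝ x n = 0 ∧ inner ℝ a b = 0 ∧ inner ℝ a n = 0 ∧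
    inner ℝ b n = 0 := by
  rw [orthonormal_iff_ite]
  constructor
  · intro h
    refine ⟨⟨h 0 0, h 1 1, h 2 2, h 3 3⟩, h 0 1, h 0 2, h 0 3, h 1 2, h 1 3, h 2 3⟩
  · rintro ⟨⟨h0, h1, h2, h3⟩, h01, h02, h03, h12, h13, h23⟩ i j
    have h10 := real_inner_comm a x ▸ h01
    have h20 := real_inner_comm b x ▸ h02
    have h30 := real_inner_comm n x ▸ h03
    have h21 := real_inner_comm b a ▸ h12
    have h31 := real_inner_comm n a ▸ h13
    have h32 := real_inner_comm n b ▸ h23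
    fin_cases i <;> fin_cases j <;> assumption

theorem expand_of_orthonormal {x a b n : C2} (h : Orthonormal ℝ ![x, a, b, n]) (y : C2) :
    y = inner ℝ x y • x + inner ℝ a y • a + inner ℝ b y • b + inner ℝ n y • n := by
  have := sum_inner_smul_of_orthonormal h y
  simpa [Fin.sum_univ_four] using this.symm

namespace SurfaceFrame

variable {f : R2 → C2} {U : Set R2} (B : SurfaceFrame f U)

/-- The first component of the tangential part of the Hopf field. -/
noncomputable def A₁ (u : R2) : ℝ := inner ℝ (complexJ (f u)) (fderiv ℝ f u (B.α u))

/-- The second component of the tangential part of the Hopf field. -/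
noncomputable def A₂ (u : R2) : ℝ := inner ℝ (complexJ (f u)) (fderiv ℝ f u (B.β u))

/-- The normal component of the Hopf field. -/
noncomputable def C (u : R2) : ℝ := inner ℝ (complexJ (f u)) (B.N u)

include B in
theorem smooth_Jf : ContDiffOn ℝ ∞ (fun u => complexJ (f u)) U :=
  complexJ.contDiff.comp_contDiffOn B.smooth_f

theorem smooth_A₁ : ContDiffOn ℝ ∞ B.A₁ U :=
  B.smooth_Jf.inner ℝ (ContDiffOn.dirD B.isOpen B.smooth_f B.smooth_α)

theorem smooth_A₂ : ContDiffOn ℝ ∞ B.A₂ U :=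
  B.smooth_Jf.inner ℝ (ContDiffOn.dirD B.isOpen B.smooth_f B.smooth_β)

theorem smooth_C : ContDiffOn ℝ ∞ B.C U := B.smooth_Jf.inner ℝ B.smooth_N

/-- The restriction of a frame to a smaller open set. -/
def restrict {V : Set R2} (hV : IsOpen V) (h : V ⊆ U) : SurfaceFrame f V where
  α := B.α
  β := B.β
  N := B.N
  p := B.p
  q := B.q
  isOpen := hV
  smooth_f := B.smooth_f.mono h
  smooth_α := B.smooth_α.mono h
  smooth_β := B.smooth_β.mono h
  smooth_N := B.smooth_N.mono h
  smooth_p := B.smooth_p.mono h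
  smooth_q := B.smooth_q.mono h
  orthonormal u hu := B.orthonormal u (h hu)
  N_α u hu := B.N_α u (h hu)
  N_β u hu := B.N_β u (h hu)
  asymptotic u hu := B.asymptotic u (h hu)

/-- The frame rotated by the angle with cosine `c` and sine `s`. -/
def rotate {c s : R2 → ℝ} (hc : ContDiffOn ℝ ∞ c U) (hs : ContDiffOn ℝ ∞ s U)
    (hcs : ∀ u ∈ U, c u ^ 2 + s u ^ 2 = 1) : SurfaceFrame f U where
  α := fun u => c u • B.α u + s u • B.β u
  β := fun u => -s u • B.α u + c u • B.β u
  N := B.N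
  p := fun u => B.p u * (c u ^ 2 - s u ^ 2) + 2 * c u * s u * B.q u
  q := fun u => B.q u * (c u ^ 2 - s u ^ 2) - 2 * c u * s u * B.p u
  isOpen := B.isOpen
  smooth_f := B.smooth_f
  smooth_α := (hc.smul B.smooth_α).add (hs.smul B.smooth_β)
  smooth_β := (hs.neg.smul B.smooth_α).add (hc.smul B.smooth_β)
  smooth_N := B.smooth_N
  smooth_p := (B.smooth_p.mul ((hc.pow 2).sub (hs.pow 2))).add
    (((contDiffOn_const.mul hc).mul hs).mul B.smooth_q)
  smooth_q := (B.smooth_q.mul ((hc.pow 2).sub (hs.pow 2))).sub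
    (((contDiffOn_const.mul hc).mul hs).mul B.smooth_p)
  orthonormal u hu := by
    have h := B.orthonormal u hu
    have e := hcs u hu
    rw [orthonormal_vec4_iff] at h ⊢
    obtain ⟨⟨h0, h1, h2, h3⟩, h01, h02, h03, h12, h13, h23⟩ := h
    have h21 := real_inner_comm (fderiv ℝ f u (B.β u)) (fderiv ℝ f u (B.α u)) ▸ h12
    simp only [map_add, map_smul, inner_add_left, inner_add_right, real_inner_smul_left,
      real_inner_smul_right, h0, h1, h2, h3, h01, h02, h03, h12, h13, h23, h21]
    refine ⟨⟨trivial, ?_, ?_, trivial⟩, ?_, ?_, trivial, ?_, ?_, ?_⟩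
    · linear_combination e
    · linear_combination e
    all_goals ring
  N_α u hu := by
    have e := hcs u hu
    simp only [map_add, map_smul, B.N_α u hu, B.N_β u hu]
    match_scalars
    · linear_combination (B.p u * c u + s u * B.q u) * e
    · linear_combination (B.q u * c u - s u * B.p u) * e
  N_β u hu := by
    have e := hcs u hu
    simp only [map_add, map_smul, B.N_α u hu, B.N_β u hu]
    match_scalars
    · linear_combination (B.q u * c u - s u * B.p u) * e
    · linear_combination -(B.p u * c u + s u * B.q u) * e
  asymptotic u hu := by
    have e := hcs u hu
    have h := B.asymptotic u hu
    simp only [map_add, map_smul, inner_add_right, real_inner_smul_right]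
    linear_combination (c u ^ 2 + s u ^ 2) ^ 2 * h

/-- If `α` is an asymptotic direction along the tangential part of the Hopf field, the frame is
helicoidal, up to the choice of the sign of `β`. -/
theorem exists_helicoidalFrame (hp : ∀ u ∈ U, B.p u = 0) (hA : ∀ u ∈ U, B.A₂ u = 0) :
    ∃ F : HelicoidalFrame f U, ∀ u ∈ U, F.b u ^ 2 = B.q u ^ 2 := by
  let s : R2 → ℝ := fun u => inner ℝ (complexJ (fderiv ℝ f u (B.β u)))
    (B.C u • fderiv ℝ f u (B.α u) - B.A₁ u • B.N u)
  have hdα := ContDiffOn.dirD B.isOpen B.smooth_f B.smooth_α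
  have hdβ := ContDiffOn.dirD B.isOpen B.smooth_f B.smooth_β
  have hs : ContDiffOn ℝ ∞ s U := (complexJ.contDiff.comp_contDiffOn hdβ).inner ℝ
    ((B.smooth_C.smul hdα).sub (B.smooth_A₁.smul B.smooth_N))
  have key : ∀ u ∈ U, complexJ (f u) = B.A₁ u • fderiv ℝ f u (B.α u) + B.C u • B.N u ∧
      B.A₁ u ^ 2 + B.C u ^ 2 = 1 ∧ s u ^ 2 = 1 ∧
      s u • complexJ (fderiv ℝ f u (B.β u)) = B.C u • fderiv ℝ f u (B.α u) - B.A₁ u • B.N u := by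
    intro u hu
    have ho := B.orthonormal u hu
    have ho' := ho
    rw [orthonormal_vec4_iff] at ho'
    obtain ⟨⟨h0, h1, h2, h3⟩, h01, h02, h03, h12, h13, h23⟩ := ho'
    have hA₂ := hA u hu
    have e1 := expand_of_orthonormal ho (complexJ (f u))
    have e2 := expand_of_orthonormal ho (complexJ (fderiv ℝ f u (B.β u)))
    rw [inner_self_complexJ, real_inner_comm, real_inner_comm (complexJ (f u)),
      real_inner_comm (complexJ (f u))] at e1
    change _ = (0 : ℝ) • f u + B.A₁ u • fderiv ℝ f u (B.α u) + B.A₂ u • fderiv ℝ f u (B.β u)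
      + B.C u • B.N u at e1
    rw [hA₂] at e1
    have h02' : inner ℝ (f u) (complexJ (fderiv ℝ f u (B.β u))) = 0 := by
      rw [inner_complexJ_right]; exact neg_eq_zero.2 hA₂
    rw [h02', inner_self_complexJ] at e2
    have e1' : complexJ (f u) = B.A₁ u • fderiv ℝ f u (B.α u) + B.C u • B.N u := by
      rw [e1]; module
    have hs' : s u = inner ℝ (complexJ (fderiv ℝ f u (B.β u)))
      (B.C u • fderiv ℝ f u (B.α u) - B.A₁ u • B.N u) := rfl
    rw [inner_sub_right, real_inner_smul_right, real_inner_smul_right,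
      real_inner_comm, real_inner_comm (B.N u)] at hs'
    have hperp : inner ℝ (complexJ (f u)) (complexJ (fderiv ℝ f u (B.β u))) = 0 := by
      rw [inner_complexJ_complexJ, h02]
    have hn1 : inner ℝ (complexJ (f u)) (complexJ (f u)) = 1 := by
      rw [inner_complexJ_complexJ, h0]
    have hn2 : inner ℝ (complexJ (fderiv ℝ f u (B.β u))) (complexJ (fderiv ℝ f u (B.β u))) = 1 := by
      rw [inner_complexJ_complexJ, h2]
    generalize inner ℝ (fderiv ℝ f u (B.α u)) (complexJ (fderiv ℝ f u (B.β u))) = m,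
      inner ℝ (B.N u) (complexJ (fderiv ℝ f u (B.β u))) = n at e2 hs'
    have h31 := real_inner_comm (B.N u) (fderiv ℝ f u (B.α u)) ▸ h13
    rw [e1'] at hn1
    rw [e1', e2] at hperp
    rw [e2] at hn2
    simp only [inner_add_left, inner_add_right, real_inner_smul_left, real_inner_smul_right,
      h1, h3, h13, h31, zero_smul, add_zero, zero_add] at hn1 hn2 hperp
    have hm : m = s u * B.C u := by
      rw [hs']; linear_combination -m * hn1 + B.A₁ u * hperp
    have hn : n = -(s u * B.A₁ u) := by
      rw [hs']; linear_combination -n * hn1 + B.C u * hperp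
    have hss : s u ^ 2 = 1 := by
      rw [hm, hn] at hn2
      linear_combination hn2 - s u ^ 2 * hn1
    refine ⟨e1', by linear_combination hn1, hss, ?_⟩
    rw [e2, hm, hn]
    match_scalars
    · ring
    · linear_combination B.C u * hss
    · ring
    · linear_combination -B.A₁ u * hss
  have hN : ∀ u ∈ U, B.C u • complexJ (f u)
      - B.A₁ u • complexJ (s u • fderiv ℝ f u (B.β u)) = B.N u := by
    intro u hu
    obtain ⟨k1, k2, k3, k4⟩ := key u hu
    rw [map_smul, k4, k1]
    match_scalars
    · ring
    · linear_combination k2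
  have hNd : ∀ u ∈ U, fderiv ℝ (fun u => B.C u • complexJ (f u)
      - B.A₁ u • complexJ (s u • fderiv ℝ f u (B.β u))) u = fderiv ℝ B.N u := fun u hu =>
    (Filter.eventuallyEq_of_mem (B.isOpen.mem_nhds hu) hN).fderiv_eq
  have hα : ∀ u ∈ U, fderiv ℝ f u (B.α u) = B.A₁ u • complexJ (f u)
      + B.C u • complexJ (s u • fderiv ℝ f u (B.β u)) := by
    intro u hu
    obtain ⟨k1, k2, k3, k4⟩ := key u hu
    rw [map_smul, k4, k1]
    match_scalars
    · linear_combination -k2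
    · ring
  refine ⟨{
    α := B.α
    β := fun u => s u • B.β u
    e := fun u => s u • fderiv ℝ f u (B.β u)
    r := B.A₁
    C := B.C
    b := fun u => s u * B.q u
    isOpen := B.isOpen
    smooth_f := B.smooth_f
    smooth_α := B.smooth_α
    smooth_β := hs.smul B.smooth_β
    smooth_e := hs.smul hdβ
    smooth_r := B.smooth_A₁
    smooth_C := B.smooth_C
    smooth_b := hs.mul B.smooth_q
    pair := fun u hu => ?_
    r_C := fun u hu => (key u hu).2.1
    f_α := hα
    f_β := fun u _ => map_smul _ _ _
    N_α := fun u hu => ?_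
    N_β := fun u hu => ?_ }, fun u hu => ?_⟩
  · have ho' := B.orthonormal u hu
    rw [orthonormal_vec4_iff] at ho'
    obtain ⟨⟨h0, h1, h2, h3⟩, h01, h02, h03, h12, h13, h23⟩ := ho'
    refine ⟨h0, ?_, ?_, ?_⟩
    · rw [real_inner_smul_left, real_inner_smul_right, h2]
      linear_combination (key u hu).2.2.1
    · rw [real_inner_smul_right, h02, mul_zero]
    · rw [real_inner_smul_right]
      exact mul_eq_zero_of_right _ (hA u hu)
  · rw [hNd u hu, B.N_α u hu, hp u hu]
    match_scalars
    · ring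
    · linear_combination B.q u * (key u hu).2.2.1
  · rw [← hα u hu, hNd u hu, map_smul, B.N_β u hu, hp u hu]
    module
  · rw [mul_pow, (key u hu).2.2.1, one_mul]

end SurfaceFrame

/-! ### Existence of helicoidal frames -/

/-- If a product vanishes near `u`, and the zeros of the first factor near `u` have no interior
because its differential is nonzero where it vanishes, then the second factor vanishes. -/
theorem eventually_eq_zero_of_mul {A B : R2 → ℝ} {u : R2} (hA : ContDiffAt ℝ 1 A u)
    (hB : ∀ᶠ w in 𝓝 u, ContinuousAt B w) (hAB : ∀ᶠ w in 𝓝 u, A w * B w = 0)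
    (h : A u ≠ 0 ∨ fderiv ℝ A u ≠ 0) : ∀ᶠ w in 𝓝 u, B w = 0 := by
  rcases h with h | h
  · filter_upwards [hAB, hA.continuousAt.eventually_ne h] with w hw hw'
    exact (mul_eq_zero.1 hw).resolve_left hw'
  · have hc : ContinuousAt (fderiv ℝ A) u := (hA.fderiv_right (m := 0) (by norm_num)).continuousAt
    filter_upwards [hAB.eventually_nhds, hB, hc.eventually_ne h] with w hw hBw hdw
    by_contra hne
    apply hdw
    have : A =ᶠ[𝓝 w] fun _ => 0 := by
      filter_upwards [hw, hBw.eventually_ne hne] with y hy hy'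
      exact (mul_eq_zero.1 hy).resolve_right hy'
    rw [this.fderiv_eq]
    simp

/-- Along a ray starting at `u` (excluded) the quantity `b r² / (1 - b)²` is constant; so if `b`
tends to `0` at `u`, then it vanishes. -/
theorem HelicoidalFrame.b_eq_zero_of_tendsto {f : R2 → C2} {V : Set R2} (F : HelicoidalFrame f V)
    {u w : R2} (hV : ∀ τ ∈ Set.Ioc (0 : ℝ) 1, u + τ • (w - u) ∈ V)
    (hb : ∀ τ ∈ Set.Ioc (0 : ℝ) 1, |F.b (u + τ • (w - u))| ≤ 1 / 2)
    (hlim : Filter.Tendsto (fun τ : ℝ => F.b (u + τ • (w - u))) (𝓝[>] 0) (𝓝 0)) :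
    F.b w = 0 := by
  set γ : ℝ → R2 := fun τ => u + τ • (w - u) with hγ
  have hγd : ∀ τ, HasDerivAt γ (w - u) τ := fun τ =>
    (((hasDerivAt_id τ).smul_const (w - u)).const_add u).congr_deriv (one_smul _ _)
  set I : ℝ → ℝ := fun τ => F.b (γ τ) * F.r (γ τ) ^ 2 / (1 - F.b (γ τ)) ^ 2 with hI
  have hder : ∀ τ ∈ Set.Ioc (0 : ℝ) 1, HasDerivAt I 0 τ := by
    intro τ hτ
    have hu := hV τ hτ
    have h1 := (F.smooth_b.differentiableAt_of_isOpen F.isOpen hu).hasFDerivAt.comp_hasDerivAt τ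
      (hγd τ)
    have h2 := (F.smooth_r.differentiableAt_of_isOpen F.isOpen hu).hasFDerivAt.comp_hasDerivAt τ
      (hγd τ)
    rw [F.fderiv_apply _ hu, (F.codazzi hu).1, (F.codazzi hu).2] at h1
    rw [F.fderiv_apply _ hu, F.r_α hu, F.r_β hu] at h2
    have hne : (1 - F.b (γ τ)) ^ 2 ≠ 0 := by
      have := (abs_le.1 (hb τ hτ)).2
      have : 0 < 1 - F.b (γ τ) := by simp only [hγ]; linarith
      positivity
    refine ((h1.mul (h2.pow 2)).div ((h1.const_sub 1).pow 2) hne).congr_deriv ?_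
    rw [div_eq_zero_iff]
    left
    have h3 := F.r_mul_ρ hu
    have h4 := F.r_C _ hu
    simp only [Pi.mul_apply, Pi.pow_apply, Function.comp, smul_eq_mul, hγ]
    have h5 : F.r (u + τ • (w - u)) ^ 2 + F.r (u + τ • (w - u)) * F.ρ (u + τ • (w - u))
      = 1 - F.b (u + τ • (w - u)) := by linarith
    generalize F.b (u + τ • (w - u)) = b, F.r (u + τ • (w - u)) = r, F.C (u + τ • (w - u)) = C,
      F.ρ (u + τ • (w - u)) = ρ, F.θ₁ (u + τ • (w - u)) (w - u) = x,
      F.θ₂ (u + τ • (w - u)) (w - u) = y at *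
    norm_num
    linear_combination (-2 * y * b * C * r * (1 - b) * (1 + b)) * h5
  have hconst : ∀ τ ∈ Set.Ioc (0 : ℝ) 1, I τ = I 1 := by
    intro τ hτ
    exact (constant_of_has_deriv_right_zero
      (fun x hx => (hder x ⟨hτ.1.trans_le hx.1, hx.2⟩).continuousAt.continuousWithinAt)
      (fun x hx => (hder x ⟨hτ.1.trans_le hx.1, hx.2.le⟩).hasDerivWithinAt) 1
        ⟨hτ.2, le_rfl⟩).symm
  have hbound : ∀ τ ∈ Set.Ioc (0 : ℝ) 1, |I 1| ≤ 4 * |F.b (γ τ)| := by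
    intro τ hτ
    rw [← hconst τ hτ, hI]
    have h1 := abs_le.1 (hb τ hτ)
    have h2 := F.r_C _ (hV τ hτ)
    have h3 : (1 : ℝ) / 4 ≤ (1 - F.b (γ τ)) ^ 2 := by simp only [hγ]; nlinarith
    have h4 : F.r (γ τ) ^ 2 ≤ 1 := by simp only [hγ]; nlinarith [sq_nonneg (F.C (u + τ • (w - u)))]
    simp only
    rw [abs_div, abs_mul, abs_of_nonneg (sq_nonneg (F.r (γ τ))),
      abs_of_nonneg (sq_nonneg (1 - F.b (γ τ))), div_le_iff₀ (by linarith)]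
    have h5 := abs_nonneg (F.b (γ τ))
    nlinarith [sq_nonneg (F.r (γ τ)), mul_le_mul_of_nonneg_left h4 h5,
      mul_le_mul_of_nonneg_left h3 h5]
  have hI1 : I 1 = 0 := by
    have h0 : Filter.Tendsto (fun τ => 4 * |F.b (γ τ)|) (𝓝[>] 0) (𝓝 0) := by
      simpa using (hlim.abs).const_mul 4
    have h1 : |I 1| ≤ 0 := ge_of_tendsto h0 (by
      filter_upwards [Ioc_mem_nhdsGT zero_lt_one] with τ hτ using hbound τ hτ)
    exact abs_eq_zero.1 (le_antisymm h1 (abs_nonneg _))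
  have hγ1 : γ 1 = w := by simp [hγ]
  simp only [hI, hγ1] at hI1
  have h1 := hb 1 (by simp)
  have hγ1' : u + (1 : ℝ) • (w - u) = w := hγ1
  rw [hγ1'] at h1
  have h2 := abs_le.1 h1
  have hw : w ∈ V := by
    have := hV 1 (by simp)
    rwa [hγ1'] at this
  have hr : F.r w ≠ 0 := fun h => by
    have h3 := F.r_mul_ρ hw
    have h4 := F.r_C w hw
    rw [h] at h3 h4
    linarith
  rcases div_eq_zero_iff.1 hI1 with h | h
  · exact (mul_eq_zero.1 h).resolve_right (pow_ne_zero 2 hr)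
  · nlinarith

namespace SurfaceFrame

variable {f : R2 → C2} {U : Set R2} (B : SurfaceFrame f U)

include B in
theorem fderiv_complexJ_inner {G : R2 → C2} (hG : ContDiffOn ℝ ∞ G U) {u : R2} (hu : u ∈ U)
    (v : R2) : fderiv ℝ (fun w => inner ℝ (complexJ (f w)) (G w)) u v
      = inner ℝ (complexJ (f u)) (fderiv ℝ G u v) + inner ℝ (complexJ (fderiv ℝ f u v)) (G u) := by
  have h1 := complexJ.hasFDerivAt.comp u
    (B.smooth_f.differentiableAt_of_isOpen B.isOpen hu).hasFDerivAt
  have h2 := h1.inner ℝ (hG.differentiableAt_of_isOpen B.isOpen hu).hasFDerivAt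
  have h3 := congrArg (fun L : R2 →L[ℝ] ℝ => L v) h2.fderiv
  simpa [fderivInnerCLM_apply] using h3

theorem inner_N_fderiv {G : R2 → C2} (hG : ContDiffOn ℝ ∞ G U)
    (h0 : ∀ w ∈ U, inner ℝ (B.N w) (G w) = 0) {u : R2} (hu : u ∈ U) (v : R2) :
    inner ℝ (B.N u) (fderiv ℝ G u v) = -inner ℝ (fderiv ℝ B.N u v) (G u) := by
  have h1 := (B.smooth_N.differentiableAt_of_isOpen B.isOpen hu).hasFDerivAt
  have h2 := h1.inner ℝ (hG.differentiableAt_of_isOpen B.isOpen hu).hasFDerivAt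
  have h3 := h2.unique ((hasFDerivAt_const (0 : ℝ) u).congr_of_eventuallyEq
    (Filter.eventually_of_mem (B.isOpen.mem_nhds hu) h0))
  have h4 := congrArg (fun L : R2 →L[ℝ] ℝ => L v) h3
  simp [fderivInnerCLM_apply] at h4
  linarith

/-- The derivatives of the components of the tangential part of the Hopf field at one of its zeros.
The skew part `j` comes from the complex structure and does not vanish. -/
theorem fderiv_A {u : R2} (hu : u ∈ U) (h1 : B.A₁ u = 0) (h2 : B.A₂ u = 0) :
    ∃ j : ℝ, j ^ 2 = 1 ∧ B.C u ^ 2 = 1 ∧ fderiv ℝ B.A₁ u (B.α u) = B.C u * B.p u ∧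
      fderiv ℝ B.A₁ u (B.β u) = -j + B.C u * B.q u ∧
      fderiv ℝ B.A₂ u (B.α u) = j + B.C u * B.q u ∧
      fderiv ℝ B.A₂ u (B.β u) = -(B.C u * B.p u) := by
  have ho := B.orthonormal u hu
  have ho' := ho
  rw [orthonormal_vec4_iff] at ho'
  obtain ⟨⟨k0, k1, k2, k3⟩, k01, k02, k03, k12, k13, k23⟩ := ho'
  have k21 := real_inner_comm (fderiv ℝ f u (B.β u)) (fderiv ℝ f u (B.α u)) ▸ k12
  have k31 := real_inner_comm (B.N u) (fderiv ℝ f u (B.α u)) ▸ k13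
  have k32 := real_inner_comm (B.N u) (fderiv ℝ f u (B.β u)) ▸ k23
  have e1 := expand_of_orthonormal ho (complexJ (f u))
  rw [inner_self_complexJ, real_inner_comm, real_inner_comm (complexJ (f u)),
    real_inner_comm (complexJ (f u))] at e1
  change _ = (0 : ℝ) • f u + B.A₁ u • fderiv ℝ f u (B.α u) + B.A₂ u • fderiv ℝ f u (B.β u)
    + B.C u • B.N u at e1
  rw [h1, h2] at e1
  have e1' : complexJ (f u) = B.C u • B.N u := by rw [e1]; module
  have hC : B.C u ^ 2 = 1 := by
    have := inner_complexJ_complexJ (f u) (f u)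
    rw [e1', real_inner_smul_left, real_inner_smul_right, k0, k3] at this
    linarith
  have e2 := expand_of_orthonormal ho (complexJ (fderiv ℝ f u (B.α u)))
  have z0 : inner ℝ (f u) (complexJ (fderiv ℝ f u (B.α u))) = 0 := by
    rw [inner_complexJ_right]; exact neg_eq_zero.2 h1
  have z3 : inner ℝ (B.N u) (complexJ (fderiv ℝ f u (B.α u))) = 0 := by
    have := inner_complexJ_complexJ (f u) (fderiv ℝ f u (B.α u))
    rw [e1', real_inner_smul_left, k01] at this
    refine (mul_eq_zero.1 this).resolve_left fun h => ?_
    rw [h] at hC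
    norm_num at hC
  rw [z0, z3, inner_self_complexJ] at e2
  set j := inner ℝ (fderiv ℝ f u (B.β u)) (complexJ (fderiv ℝ f u (B.α u))) with hj
  have hj2 : j ^ 2 = 1 := by
    have := inner_complexJ_complexJ (fderiv ℝ f u (B.α u)) (fderiv ℝ f u (B.α u))
    rw [e2, k1] at this
    simp only [real_inner_smul_left, real_inner_smul_right, k2, zero_smul, zero_add,
      add_zero] at this
    linarith
  have hdα := ContDiffOn.dirD B.isOpen B.smooth_f B.smooth_α
  have hdβ := ContDiffOn.dirD B.isOpen B.smooth_f B.smooth_β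
  have hα : ∀ v, fderiv ℝ B.A₁ u v = B.C u * -inner ℝ (fderiv ℝ B.N u v) (fderiv ℝ f u (B.α u))
      + inner ℝ (complexJ (fderiv ℝ f u v)) (fderiv ℝ f u (B.α u)) := by
    intro v
    rw [show fderiv ℝ B.A₁ u v = _ from B.fderiv_complexJ_inner hdα hu v, e1',
      real_inner_smul_left, B.inner_N_fderiv hdα (fun w hw => ?_) hu]
    · rfl
    · rw [real_inner_comm]
      exact (orthonormal_vec4_iff.1 (B.orthonormal w hw)).2.2.2.2.2.1
  have hβ : ∀ v, fderiv ℝ B.A₂ u v = B.C u * -inner ℝ (fderiv ℝ B.N u v) (fderiv ℝ f u (B.β u))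
      + inner ℝ (complexJ (fderiv ℝ f u v)) (fderiv ℝ f u (B.β u)) := by
    intro v
    rw [show fderiv ℝ B.A₂ u v = _ from B.fderiv_complexJ_inner hdβ hu v, e1',
      real_inner_smul_left, B.inner_N_fderiv hdβ (fun w hw => ?_) hu]
    · rfl
    · rw [real_inner_comm]
      exact (orthonormal_vec4_iff.1 (B.orthonormal w hw)).2.2.2.2.2.2
  have j1 : inner ℝ (complexJ (fderiv ℝ f u (B.α u))) (fderiv ℝ f u (B.β u)) = j := by
    rw [real_inner_comm]
  have j2 : inner ℝ (complexJ (fderiv ℝ f u (B.β u))) (fderiv ℝ f u (B.α u)) = -j := by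
    rw [hj, inner_complexJ_right, neg_neg]
  refine ⟨j, hj2, hC, ?_, ?_, ?_, ?_⟩
  · rw [hα, B.N_α u hu, inner_complexJ_self]
    simp only [inner_sub_left, real_inner_smul_left, k1, k21]
    ring
  · rw [hα, B.N_β u hu, j2]
    simp only [inner_add_left, real_inner_smul_left, k1, k21]
    ring
  · rw [hβ, B.N_α u hu, j1]
    simp only [inner_sub_left, real_inner_smul_left, k2, k12]
    ring
  · rw [hβ, B.N_β u hu, inner_complexJ_self]
    simp only [inner_add_left, real_inner_smul_left, k2, k12]
    ring

/-- If `α` is asymptotic, the condition on the Hopf field becomes `A₁ A₂ = 0`. One of the factors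
vanishes near `u`, since by `fderiv_A` they cannot both vanish to second order at `u`; then `α` or
`β` is the direction of the tangential part of the Hopf field. -/
theorem exists_helicoidalFrame_of_p_eq_zero (hp : ∀ u ∈ U, B.p u = 0) (hq : ∀ u ∈ U, B.q u ≠ 0)
    {u : R2} (hu : u ∈ U) :
    ∃ V : Set R2, u ∈ V ∧ V ⊆ U ∧ ∃ F : HelicoidalFrame f V, ∀ w ∈ V, F.b w ≠ 0 := by
  have hU := B.isOpen.mem_nhds hu
  have hA : ∀ w ∈ U, B.A₁ w * B.A₂ w = 0 := by
    intro w hw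
    have h : (B.A₂ w ^ 2 - B.A₁ w ^ 2) * B.p w - 2 * B.A₁ w * B.A₂ w * B.q w = 0 :=
      B.asymptotic w hw
    rw [hp w hw] at h
    have : B.A₁ w * B.A₂ w * B.q w = 0 := by linarith
    exact (mul_eq_zero.1 this).resolve_right (hq w hw)
  have hA' : ∀ᶠ w in 𝓝 u, B.A₁ w * B.A₂ w = 0 := Filter.eventually_of_mem hU hA
  have s1 : ContDiffAt ℝ 1 B.A₁ u := (B.smooth_A₁.contDiffAt hU).of_le (by norm_cast)
  have s2 : ContDiffAt ℝ 1 B.A₂ u := (B.smooth_A₂.contDiffAt hU).of_le (by norm_cast)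
  have c1 : ∀ᶠ w in 𝓝 u, ContinuousAt B.A₁ w := Filter.eventually_of_mem hU fun w hw =>
    B.smooth_A₁.continuousOn.continuousAt (B.isOpen.mem_nhds hw)
  have c2 : ∀ᶠ w in 𝓝 u, ContinuousAt B.A₂ w := Filter.eventually_of_mem hU fun w hw =>
    B.smooth_A₂.continuousOn.continuousAt (B.isOpen.mem_nhds hw)
  have hcases : (∀ᶠ w in 𝓝 u, B.A₂ w = 0) ∨ ∀ᶠ w in 𝓝 u, B.A₁ w = 0 := by
    by_cases h1 : B.A₁ u ≠ 0 ∨ fderiv ℝ B.A₁ u ≠ 0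
    · exact .inl (eventually_eq_zero_of_mul s1 c2 hA' h1)
    by_cases h2 : B.A₂ u ≠ 0 ∨ fderiv ℝ B.A₂ u ≠ 0
    · exact .inr (eventually_eq_zero_of_mul s2 c1 (by simpa only [mul_comm] using hA') h2)
    push Not at h1 h2
    obtain ⟨j, hj, -, -, h3, h4, -⟩ := B.fderiv_A hu h1.1 h2.1
    rw [h1.2] at h3
    rw [h2.2] at h4
    simp at h3 h4
    have : j = 0 := by linarith
    rw [this] at hj
    norm_num at hj
  rcases hcases with h | h
  · obtain ⟨V, hV, hVo, huV⟩ := mem_nhds_iff.1 (Filter.inter_mem h hU)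
    let B' := B.restrict hVo fun w hw => (hV hw).2
    obtain ⟨F, hF⟩ := B'.exists_helicoidalFrame (fun w hw => hp w (hV hw).2) fun w hw => (hV hw).1
    refine ⟨V, huV, fun w hw => (hV hw).2, F, fun w hw => ?_⟩
    rw [← pow_ne_zero_iff two_ne_zero, hF w hw]
    exact pow_ne_zero 2 (hq w (hV hw).2)
  · obtain ⟨V, hV, hVo, huV⟩ := mem_nhds_iff.1 (Filter.inter_mem h hU)
    let B' := (B.restrict hVo fun w hw => (hV hw).2).rotate (c := fun _ => 0) (s := fun _ => 1)
      contDiffOn_const contDiffOn_const (fun _ _ => by norm_num)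
    obtain ⟨F, hF⟩ := B'.exists_helicoidalFrame
      (fun w hw => by
        change B.p w * (0 ^ 2 - 1 ^ 2) + 2 * 0 * 1 * B.q w = 0
        rw [hp w (hV hw).2]; ring)
      (fun w hw => by
        have h1 : B.A₁ w = 0 := (hV hw).1
        change inner ℝ (complexJ (f w)) (fderiv ℝ f w (-(1 : ℝ) • B.α w + (0 : ℝ) • B.β w)) = 0
        rw [zero_smul, add_zero, map_smul, real_inner_smul_right]
        exact mul_eq_zero_of_right _ h1)
    refine ⟨V, huV, fun w hw => (hV hw).2, F, fun w hw => ?_⟩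
    rw [← pow_ne_zero_iff two_ne_zero, hF w hw]
    change (B.q w * (0 ^ 2 - 1 ^ 2) - 2 * 0 * 1 * B.p w) ^ 2 ≠ 0
    have := hq w (hV hw).2
    simpa using this

/-- Near a point which is not umbilic there is a helicoidal frame: the asymptotic directions are
smooth there. -/
theorem exists_helicoidalFrame_of_not_umbilic {u : R2} (hu : u ∈ U)
    (h : B.p u ^ 2 + B.q u ^ 2 ≠ 0) :
    ∃ V : Set R2, u ∈ V ∧ V ⊆ U ∧ ∃ F : HelicoidalFrame f V, ∀ w ∈ V, F.b w ≠ 0 := by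
  -- A rotation by a right angle changes the sign of `q`.
  wlog hq : 0 ≤ B.q u generalizing B
  · let B' := B.rotate (c := fun _ => 0) (s := fun _ => 1)
      contDiffOn_const contDiffOn_const (fun _ _ => by norm_num)
    have e1 : B'.p u = -B.p u := by
      change B.p u * (0 ^ 2 - 1 ^ 2) + 2 * 0 * 1 * B.q u = _; ring
    have e2 : B'.q u = -B.q u := by
      change B.q u * (0 ^ 2 - 1 ^ 2) - 2 * 0 * 1 * B.p u = _; ring
    exact this B' (by rw [e1, e2, neg_sq, neg_sq]; exact h) (by rw [e2]; linarith)
  let l : R2 → ℝ := fun w => √(B.p w ^ 2 + B.q w ^ 2)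
  have hpos : ∀ w, 0 ≤ B.p w ^ 2 + B.q w ^ 2 := fun w => by positivity
  have hl2 : ∀ w, l w ^ 2 = B.p w ^ 2 + B.q w ^ 2 := fun w => Real.sq_sqrt (hpos w)
  have hlc : ContinuousOn l U :=
    ((B.smooth_p.continuousOn.pow 2).add (B.smooth_q.continuousOn.pow 2)).sqrt
  have hlu : 0 < l u := Real.sqrt_pos.2 (lt_of_le_of_ne (hpos u) h.symm)
  have hU := B.isOpen.mem_nhds hu
  have ev1 : ∀ᶠ w in 𝓝 u, 0 < l w := (hlc.continuousAt hU).eventually (lt_mem_nhds hlu)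
  have ev2 : ∀ᶠ w in 𝓝 u, 0 < l w + B.q w :=
    ((hlc.continuousAt hU).add (B.smooth_q.continuousOn.continuousAt hU)).eventually
      (lt_mem_nhds (by linarith : (0 : ℝ) < l u + B.q u))
  obtain ⟨V, hV, hVo, huV⟩ := mem_nhds_iff.1 (Filter.inter_mem (Filter.inter_mem ev1 ev2) hU)
  have hVU : V ⊆ U := fun w hw => (hV hw).2
  have hl : ∀ w ∈ V, 0 < l w := fun w hw => (hV hw).1.1
  have hlq : ∀ w ∈ V, 0 < l w + B.q w := fun w hw => (hV hw).1.2
  let B₀ := B.restrict hVo hVU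
  let m : R2 → ℝ := fun w => √(2 * l w * (l w + B.q w))
  have hm2 : ∀ w ∈ V, m w ^ 2 = 2 * l w * (l w + B.q w) := fun w hw =>
    Real.sq_sqrt (by have := hl w hw; have := hlq w hw; positivity)
  have hm0 : ∀ w ∈ V, m w ≠ 0 := fun w hw => by
    have := hl w hw; have := hlq w hw
    exact (Real.sqrt_pos.2 (by positivity)).ne'
  have hls : ContDiffOn ℝ ∞ l V := ((B₀.smooth_p.pow 2).add (B₀.smooth_q.pow 2)).sqrt
    fun w hw => (Real.sqrt_pos.1 (hl w hw)).ne'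
  have hms : ContDiffOn ℝ ∞ m V :=
    ((contDiffOn_const.mul hls).mul (hls.add B₀.smooth_q)).sqrt fun w hw => by
      have := hl w hw; have := hlq w hw
      positivity
  -- The half-angle rotation which moves `α` to an asymptotic direction.
  let B' := B₀.rotate (c := fun w => (l w + B.q w) / m w) (s := fun w => -B.p w / m w)
    ((hls.add B₀.smooth_q).div hms hm0) (B₀.smooth_p.neg.div hms hm0) (fun w hw => by
      have := hm0 w hw
      have h1 := hm2 w hw
      have h2 := hl2 w
      field_simp
      linear_combination -h1 - h2)
  have hp' : ∀ w ∈ V, B'.p w = 0 := fun w hw => by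
    change B.p w * (((l w + B.q w) / m w) ^ 2 - (-B.p w / m w) ^ 2)
      + 2 * ((l w + B.q w) / m w) * (-B.p w / m w) * B.q w = 0
    have := hm0 w hw
    field_simp
    linear_combination B.p w * hl2 w
  have hq' : ∀ w ∈ V, B'.q w ≠ 0 := fun w hw => by
    have e : B'.q w = l w := by
      change B.q w * (((l w + B.q w) / m w) ^ 2 - (-B.p w / m w) ^ 2)
        - 2 * ((l w + B.q w) / m w) * (-B.p w / m w) * B.p w = l w
      have := hm0 w hw
      field_simp
      rw [hm2 w hw]
      linear_combination (-2 * l w - B.q w) * hl2 w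
    rw [e]
    exact (hl w hw).ne'
  obtain ⟨W, h1, h2, h3⟩ := B'.exists_helicoidalFrame_of_p_eq_zero hp' hq' huV
  exact ⟨W, h1, h2.trans hVU, h3⟩

theorem fderiv_N_eq_zero {u : R2} (hu : u ∈ U) (hp : B.p u = 0) (hq : B.q u = 0) :
    fderiv ℝ B.N u = 0 := by
  have h1 := B.N_α u hu
  have h2 := B.N_β u hu
  rw [hp, hq] at h1 h2
  obtain ⟨⟨-, k1, k2, -⟩, -, -, -, k12, -, -⟩ := orthonormal_vec4_iff.1 (B.orthonormal u hu)
  have k21 := real_inner_comm (fderiv ℝ f u (B.β u)) (fderiv ℝ f u (B.α u)) ▸ k12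
  have hli : LinearIndependent ℝ ![B.α u, B.β u] := by
    rw [LinearIndependent.pair_iff]
    intro s t hst
    have h := congrArg (fderiv ℝ f u) hst
    rw [map_add, map_smul, map_smul, map_zero] at h
    have h3 := congrArg (inner ℝ (fderiv ℝ f u (B.α u))) h
    have h4 := congrArg (inner ℝ (fderiv ℝ f u (B.β u))) h
    simp only [inner_add_right, real_inner_smul_right, k1, k2, k12, k21, inner_zero_right] at h3 h4
    exact ⟨by linarith, by linarith⟩
  have hspan := hli.span_eq_top_of_card_eq_finrank' (by simp)
  ext1 v
  have hv : v ∈ Submodule.span ℝ (Set.range ![B.α u, B.β u]) := by rw [hspan]; trivial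
  simp only [Matrix.range_cons, Matrix.range_empty, Set.union_empty, Set.singleton_union] at hv
  obtain ⟨s, t, rfl⟩ := Submodule.mem_span_pair.1 hv
  rw [map_add, map_smul, map_smul, h1, h2, zero_apply]
  module

/-- Zeros of the tangential part of the Hopf field at umbilic points are isolated. -/
theorem eventually_A_ne_zero {u : R2} (hu : u ∈ U) (hp : B.p u = 0) (hq : B.q u = 0) :
    ∀ᶠ w in 𝓝[≠] u, 0 < B.A₁ w ^ 2 + B.A₂ w ^ 2 := by
  have hU := B.isOpen.mem_nhds hu
  have d1 := (B.smooth_A₁.differentiableAt_of_isOpen B.isOpen hu).hasFDerivAt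
  have d2 := (B.smooth_A₂.differentiableAt_of_isOpen B.isOpen hu).hasFDerivAt
  by_cases h : 0 < B.A₁ u ^ 2 + B.A₂ u ^ 2
  · refine Filter.Eventually.filter_mono nhdsWithin_le_nhds ?_
    exact ((d1.continuousAt.pow 2).add (d2.continuousAt.pow 2)).eventually (lt_mem_nhds h)
  · have h1 : B.A₁ u = 0 := by nlinarith [sq_nonneg (B.A₁ u), sq_nonneg (B.A₂ u)]
    have h2 : B.A₂ u = 0 := by nlinarith [sq_nonneg (B.A₁ u), sq_nonneg (B.A₂ u)]
    obtain ⟨j, hj, -, k1, k2, k3, k4⟩ := B.fderiv_A hu h1 h2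
    rw [hp] at k1 k4
    rw [hq] at k2 k3
    have hj0 : j ≠ 0 := by rintro rfl; norm_num at hj
    have hd := d1.prodMk d2
    set L := (fderiv ℝ B.A₁ u).prod (fderiv ℝ B.A₂ u) with hL
    have hsurj : Function.Surjective L := by
      rintro ⟨a, b⟩
      refine ⟨(b / j) • B.α u - (a / j) • B.β u, ?_⟩
      rw [hL, ContinuousLinearMap.prod_apply]
      simp only [map_sub, map_smul, k1, k2, k3, k4, smul_eq_mul]
      refine Prod.ext ?_ ?_
      · field_simp; ring
      · field_simp; ring
    have hinj : Function.Injective L := by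
      have := (LinearMap.injective_iff_surjective_of_finrank_eq_finrank (f := L.toLinearMap)
        (by simp)).2 hsurj
      exact this
    obtain ⟨K, -, hK⟩ := L.toLinearMap.exists_antilipschitzWith (LinearMap.ker_eq_bot.2 hinj)
    have := hd.eventually_ne (c := (0, 0)) ⟨K, hK⟩
    filter_upwards [this] with w hw
    by_contra hcon
    refine hw (Prod.ext ?_ ?_)
    · simp only; nlinarith [sq_nonneg (B.A₁ w), sq_nonneg (B.A₂ w)]
    · simp only; nlinarith [sq_nonneg (B.A₁ w), sq_nonneg (B.A₂ w)]

/-- Near an umbilic point the surface is totally geodesic. On a punctured neighbourhood there is a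
helicoidal frame, and `b ^ 2 = p ^ 2 + q ^ 2` tends to `0` at the point; so `b` vanishes, and the
normal is constant. -/
theorem exists_inner_eq_zero_of_umbilic {u : R2} (hu : u ∈ U) (hp : B.p u = 0) (hq : B.q u = 0) :
    ∃ n : C2, n ≠ 0 ∧ ∀ᶠ w in 𝓝 u, inner ℝ (f w) n = 0 := by
  have hU := B.isOpen.mem_nhds hu
  have hpc := B.smooth_p.continuousOn.continuousAt hU
  have hqc := B.smooth_q.continuousOn.continuousAt hU
  have ev1 : ∀ᶠ w in 𝓝 u, B.p w ^ 2 + B.q w ^ 2 < 1 / 4 :=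
    ((hpc.pow 2).add (hqc.pow 2)).eventually (gt_mem_nhds (by simp [hp, hq]))
  have ev2 : ∀ᶠ w in 𝓝 u, w ≠ u → 0 < B.A₁ w ^ 2 + B.A₂ w ^ 2 := by
    simpa [eventually_nhdsWithin_iff] using B.eventually_A_ne_zero hu hp hq
  obtain ⟨ε, hε, hball⟩ := Metric.mem_nhds_iff.1 (Filter.inter_mem (Filter.inter_mem ev1 ev2) hU)
  have hVU : Metric.ball u ε \ {u} ⊆ U := fun w hw => (hball hw.1).2
  set V := Metric.ball u ε \ {u} with hV
  have hVo : IsOpen V := Metric.isOpen_ball.sdiff isClosed_singleton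
  have hsmall : ∀ w ∈ V, B.p w ^ 2 + B.q w ^ 2 < 1 / 4 := fun w hw => (hball hw.1).1.1
  have hA : ∀ w ∈ V, 0 < B.A₁ w ^ 2 + B.A₂ w ^ 2 := fun w hw => (hball hw.1).1.2 hw.2
  let B₀ := B.restrict hVo hVU
  let m : R2 → ℝ := fun w => √(B.A₁ w ^ 2 + B.A₂ w ^ 2)
  have hm2 : ∀ w ∈ V, m w ^ 2 = B.A₁ w ^ 2 + B.A₂ w ^ 2 := fun w hw => Real.sq_sqrt (hA w hw).le
  have hm0 : ∀ w ∈ V, m w ≠ 0 := fun w hw => (Real.sqrt_pos.2 (hA w hw)).ne'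
  have hms : ContDiffOn ℝ ∞ m V :=
    ((B₀.smooth_A₁.pow 2).add (B₀.smooth_A₂.pow 2)).sqrt fun w hw => (hA w hw).ne'
  -- Away from `u` the frame is rotated to the tangential part of the Hopf field.
  let B' := B₀.rotate (c := fun w => B.A₁ w / m w) (s := fun w => B.A₂ w / m w)
    (B₀.smooth_A₁.div hms hm0) (B₀.smooth_A₂.div hms hm0) (fun w hw => by
      have := hm0 w hw
      field_simp
      exact (hm2 w hw).symm)
  obtain ⟨F, hF⟩ := B'.exists_helicoidalFrame
    (fun w hw => by
      change B.p w * ((B.A₁ w / m w) ^ 2 - (B.A₂ w / m w) ^ 2)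
        + 2 * (B.A₁ w / m w) * (B.A₂ w / m w) * B.q w = 0
      have := hm0 w hw
      have h : (B.A₂ w ^ 2 - B.A₁ w ^ 2) * B.p w - 2 * B.A₁ w * B.A₂ w * B.q w = 0 :=
        B.asymptotic w (hVU hw)
      field_simp
      linear_combination -h)
    (fun w hw => by
      change inner ℝ (complexJ (f w)) (fderiv ℝ f w (-(B.A₂ w / m w) • B.α w
        + (B.A₁ w / m w) • B.β w)) = 0
      rw [map_add, map_smul, map_smul, inner_add_right, real_inner_smul_right,
        real_inner_smul_right]
      change -(B.A₂ w / m w) * B.A₁ w + B.A₁ w / m w * B.A₂ w = 0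
      ring)
  have hb2 : ∀ w ∈ V, F.b w ^ 2 = B.p w ^ 2 + B.q w ^ 2 := fun w hw => by
    rw [hF w hw]
    change (B.q w * ((B.A₁ w / m w) ^ 2 - (B.A₂ w / m w) ^ 2)
        - 2 * (B.A₁ w / m w) * (B.A₂ w / m w) * B.p w) ^ 2 = _
    have h0 := hm0 w hw
    have h : (B.A₂ w ^ 2 - B.A₁ w ^ 2) * B.p w - 2 * B.A₁ w * B.A₂ w * B.q w = 0 :=
        B.asymptotic w (hVU hw)
    have h1 := hm2 w hw
    field_simp
    rw [show m w ^ 4 = (m w ^ 2) ^ 2 by ring, h1]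
    linear_combination (-((B.A₂ w ^ 2 - B.A₁ w ^ 2) * B.p w - 2 * B.A₁ w * B.A₂ w * B.q w)) * h
  have hb0 : ∀ w ∈ V, F.b w = 0 := by
    intro w hw
    have hray : ∀ τ ∈ Set.Ioc (0 : ℝ) 1, u + τ • (w - u) ∈ V := by
      intro τ hτ
      have hne : w - u ≠ 0 := sub_ne_zero.2 hw.2
      refine ⟨?_, by simp [hτ.1.ne', hne]⟩
      have h1 : ‖w - u‖ < ε := by simpa [dist_eq_norm] using hw.1
      rw [Metric.mem_ball, dist_eq_norm, add_sub_cancel_left, norm_smul,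
        Real.norm_of_nonneg hτ.1.le]
      nlinarith [hτ.1, hτ.2, norm_nonneg (w - u)]
    refine F.b_eq_zero_of_tendsto hray (fun τ hτ => ?_) ?_
    · have h1 := hsmall _ (hray τ hτ)
      rw [← hb2 _ (hray τ hτ)] at h1
      exact abs_le_of_sq_le_sq (by linarith) (by norm_num)
    · have hγ : Filter.Tendsto (fun τ : ℝ => u + τ • (w - u)) (𝓝[>] 0) (𝓝 u) := by
        have : Continuous fun τ : ℝ => u + τ • (w - u) := by fun_prop
        simpa using (this.tendsto 0).mono_left nhdsWithin_le_nhds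
      have h1 : Filter.Tendsto (fun τ : ℝ => √(B.p (u + τ • (w - u)) ^ 2
          + B.q (u + τ • (w - u)) ^ 2)) (𝓝[>] 0) (𝓝 0) := by
        have := (((hpc.tendsto.comp hγ).pow 2).add ((hqc.tendsto.comp hγ).pow 2)).sqrt
        simpa [hp, hq, Function.comp_def] using this
      refine squeeze_zero_norm' ?_ h1
      filter_upwards [Ioc_mem_nhdsGT zero_lt_one] with τ hτ
      rw [← hb2 _ (hray τ hτ), Real.sqrt_sq_eq_abs, Real.norm_eq_abs]
  have hzero : ∀ w ∈ Metric.ball u ε, B.p w = 0 ∧ B.q w = 0 := by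
    intro w hw
    by_cases hwu : w = u
    · rw [hwu]; exact ⟨hp, hq⟩
    · have h := hb2 w ⟨hw, hwu⟩
      rw [hb0 w ⟨hw, hwu⟩] at h
      constructor <;> nlinarith [sq_nonneg (B.p w), sq_nonneg (B.q w)]
  have hcst : ∀ w ∈ Metric.ball u ε, B.N w = B.N u := fun w hw =>
    Metric.isOpen_ball.is_const_of_fderiv_eq_zero (convex_ball u ε).isPreconnected
      (fun y hy => (B.smooth_N.differentiableAt_of_isOpen B.isOpen
        (hball hy).2).differentiableWithinAt)
      (fun y hy => B.fderiv_N_eq_zero (hball hy).2 (hzero y hy).1 (hzero y hy).2) hw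
      (Metric.mem_ball_self hε)
  refine ⟨B.N u, fun h => ?_, ?_⟩
  · have := (orthonormal_vec4_iff.1 (B.orthonormal u hu)).1.2.2.2
    rw [h, inner_zero_left] at this
    exact zero_ne_one this
  · filter_upwards [Metric.ball_mem_nhds u hε] with w hw
    rw [← hcst w hw]
    exact (orthonormal_vec4_iff.1 (B.orthonormal w (hball hw).2)).2.2.2.1

end SurfaceFrame

/-! ### The consequence of minimality for all Berger metrics -/

theorem bergerMetric_four (τ : ℝ) (x X Y : C2) : bergerMetric 4 τ x X Y
    = inner ℝ X Y + (τ ^ 2 - 1) * inner ℝ X (complexJ x) * inner ℝ Y (complexJ x) := by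
  simp only [bergerMetric, hopfJ_eq_complexJ]; ring

theorem christoffel_four (τ : ℝ) (x X Y Z : C2) : christoffel (bergerMetric 4 τ) x X Y Z
    = (τ ^ 2 - 1) * (inner ℝ Y (complexJ x) * inner ℝ Z (complexJ X)
      + inner ℝ X (complexJ x) * inner ℝ Z (complexJ Y)) := by
  have key : ∀ P Q W : C2, fderiv ℝ (fun y => bergerMetric 4 τ y P Q) x W = (τ ^ 2 - 1) *
      (inner ℝ P (complexJ W) * inner ℝ Q (complexJ x)
        + inner ℝ P (complexJ x) * inner ℝ Q (complexJ W)) := by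
    intro P Q W
    have hd : ∀ P : C2, HasFDerivAt (fun y => inner ℝ P (complexJ y))
        ((innerSL ℝ P) ∘L complexJ) x := fun P => ((innerSL ℝ P) ∘L complexJ).hasFDerivAt
    have h := (((hd P).const_mul (τ ^ 2 - 1)).mul (hd Q)).const_add (inner ℝ P Q)
    simp only [bergerMetric_four]
    have h' := congrArg (fun L : C2 →L[ℝ] ℝ => L W) h.fderiv
    refine h'.trans ?_
    simp
    ring
  rw [christoffel, key, key, key]
  have h1 : ∀ P Q : C2, inner ℝ P (complexJ Q) = -inner ℝ Q (complexJ P) := fun P Q => by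
    rw [inner_complexJ_right, real_inner_comm]
  rw [h1 Y X, h1 X Z, h1 Y Z]
  ring

theorem eq_sum_single (v : R2) :
    v = v 0 • EuclideanSpace.single 0 1 + v 1 • EuclideanSpace.single 1 1 := by
  ext i
  fin_cases i <;> simp

/-- Vanishing of the trace of a symmetric bilinear form `K` with respect to an inner product `G` is
expressed in any basis. -/
theorem trace_change_basis {G K : R2 → R2 → ℝ} (hG : Matrix (Fin 2) (Fin 2) ℝ)
    (hGe : ∀ v w, G v w = ∑ a, ∑ b, v a * w b * hG a b) (hK : Matrix (Fin 2) (Fin 2) ℝ)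
    (hKe : ∀ v w, K v w = ∑ a, ∑ b, v a * w b * hK a b) (hGs : hG 0 1 = hG 1 0)
    (hKs : hK 0 1 = hK 1 0) (htr : ∑ a, ∑ b, hG⁻¹ a b * hK a b = 0) {α β : R2}
    (hdet : G α α * G β β - G α β ^ 2 ≠ 0) :
    G β β * K α α - 2 * G α β * K α β + G α α * K β β = 0 := by
  have hd : G α α * G β β - G α β ^ 2 = (α 0 * β 1 - α 1 * β 0) ^ 2 * hG.det := by
    simp only [hGe, Matrix.det_fin_two, Fin.sum_univ_two, hGs]; ring
  have hd0 : hG.det ≠ 0 := fun h => hdet (by rw [hd, h, mul_zero])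
  have h1 : hG 1 1 * hK 0 0 - 2 * hG 1 0 * hK 1 0 + hG 0 0 * hK 1 1 = 0 := by
    rw [Matrix.inv_def, Matrix.adjugate_fin_two] at htr
    simp [Fin.sum_univ_two, hGs, hKs] at htr
    field_simp at htr
    linarith
  simp only [hGe, hKe, Fin.sum_univ_two, hGs, hKs]
  linear_combination (α 0 * β 1 - α 1 * β 0) ^ 2 * h1

/-- The mean curvature for the Berger metric with `κ = 4`, in an orthonormal basis of the round
metric: if it vanishes, then so does `H + (τ² - 1) σ(Z, Z)`, where `H` is the trace of the round
second fundamental form `σ` and `Z` is the tangential part of the Hopf field turned by a right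
angle. -/
theorem mean_curvature_identity {f : R2 → C2} {u : R2} (hf : ContDiffAt ℝ 2 f u) {α β : R2} {N : C2}
    (ho : Orthonormal ℝ ![f u, fderiv ℝ f u α, fderiv ℝ f u β, N])
    (hfD : ∀ v, inner ℝ (f u) (fderiv ℝ f u v) = 0) (hND : ∀ v, inner ℝ (fderiv ℝ f u v) N = 0)
    {τ : ℝ} (hτ : 1 ≤ τ)
    (hmin : ∀ N', IsBergerUnitNormal 4 τ f u N' → bergerMeanCurvature 4 τ f u N' = 0) :
    inner ℝ (fderiv ℝ (fderiv ℝ f) u α α) N + inner ℝ (fderiv ℝ (fderiv ℝ f) u β β) N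
      + (τ ^ 2 - 1) * (inner ℝ (complexJ (f u)) (fderiv ℝ f u β) ^ 2
          * inner ℝ (fderiv ℝ (fderiv ℝ f) u α α) N
        - 2 * inner ℝ (complexJ (f u)) (fderiv ℝ f u α) * inner ℝ (complexJ (f u)) (fderiv ℝ f u β)
          * inner ℝ (fderiv ℝ (fderiv ℝ f) u α β) N
        + inner ℝ (complexJ (f u)) (fderiv ℝ f u α) ^ 2
          * inner ℝ (fderiv ℝ (fderiv ℝ f) u β β) N) = 0 := by
  obtain ⟨⟨k0, k1, k2, k3⟩, k01, k02, k03, k12, k13, k23⟩ := orthonormal_vec4_iff.1 ho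
  set V := complexJ (f u) with hV
  set C := inner ℝ N V with hC
  have hVV : inner ℝ V V = 1 := by rw [hV, inner_complexJ_complexJ, k0]
  have hNV : inner ℝ V N = C := real_inner_comm _ _
  have hC1 : C ^ 2 ≤ 1 := by
    have h := real_inner_mul_inner_self_le N V
    rw [k3, hVV] at h
    linarith [h]
  set m := τ ^ 2 - 1 with hm
  have hmτ : 1 + m = τ ^ 2 := by rw [hm]; ring
  have hτ2 : τ ^ 2 ≠ 0 := by positivity
  -- The Berger unit normal is `l (N + μ V)`.
  set μ := -(m / τ ^ 2) * C with hμ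
  have hμ1 : μ + m * (C + μ) = 0 := by
    rw [hμ, hm]; field_simp; ring
  have hD : 0 < 1 + μ * C := by
    have : 1 + μ * C = (1 - C ^ 2) + C ^ 2 / τ ^ 2 := by rw [hμ, hm]; field_simp; ring
    rw [this]
    rcases eq_or_ne C 0 with h | h
    · rw [h]; norm_num
    · have : 0 < C ^ 2 / τ ^ 2 := by positivity
      linarith
  set l := (√(1 + μ * C))⁻¹ with hl
  have hl0 : l ≠ 0 := by rw [hl]; exact inv_ne_zero (Real.sqrt_pos.2 hD).ne'
  have hl2 : l ^ 2 * (1 + μ * C) = 1 := by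
    rw [hl, inv_pow, Real.sq_sqrt hD.le]; field_simp
  set N' := l • (N + μ • V) with hN'
  have hgN : ∀ W, bergerMetric 4 τ (f u) W N' = l * inner ℝ W N := by
    intro W
    rw [bergerMetric_four, hN']
    simp only [inner_add_left, inner_add_right, real_inner_smul_left, real_inner_smul_right,
      ← hV, hVV, ← hC, ← hm]
    linear_combination l * inner ℝ W V * hμ1
  have hun : IsBergerUnitNormal 4 τ f u N' := by
    refine ⟨?_, ?_, fun a => ?_⟩
    · rw [hN', real_inner_smul_right, inner_add_right, real_inner_smul_right, k03, hV,
        inner_self_complexJ]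
      ring
    · rw [hgN, hN', real_inner_smul_left, inner_add_left, real_inner_smul_left, k3, hNV]
      linear_combination hl2
    · rw [hgN, partialD, hND, mul_zero]
  have hmc := hmin N' hun
  have hsymm : ∀ v w, fderiv ℝ (fderiv ℝ f) u v w = fderiv ℝ (fderiv ℝ f) u w v :=
    fun v w => (hf.isSymmSndFDerivAt (by simp)).eq v w
  have hd : DifferentiableAt ℝ (fderiv ℝ f) u :=
    (hf.fderiv_right (m := 1) (by norm_num)).differentiableAt (by norm_num)
  have hpp : ∀ a b : Fin 2, partialD (partialD f b) a u
      = fderiv ℝ (fderiv ℝ f) u (EuclideanSpace.single a 1) (EuclideanSpace.single b 1) := by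
    intro a b
    have := (hd.hasFDerivAt.clm_apply
      (hasFDerivAt_const (EuclideanSpace.single b (1 : ℝ)) u)).fderiv
    unfold partialD
    rw [this]
    simp
  let G : R2 → R2 → ℝ := fun v w => inner ℝ (fderiv ℝ f u v) (fderiv ℝ f u w)
    + m * inner ℝ (fderiv ℝ f u v) V * inner ℝ (fderiv ℝ f u w) V
  let K : R2 → R2 → ℝ := fun v w => l * (inner ℝ (fderiv ℝ (fderiv ℝ f) u v w) N
    + m * (inner ℝ (fderiv ℝ f u w) V * inner ℝ N (complexJ (fderiv ℝ f u v))
      + inner ℝ (fderiv ℝ f u v) V * inner ℝ N (complexJ (fderiv ℝ f u w))))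
  have hGm : ∀ a b, bergerGram 4 τ f u a b
      = G (EuclideanSpace.single a 1) (EuclideanSpace.single b 1) := by
    intro a b
    simp only [bergerGram, Matrix.of_apply, bergerMetric_four, partialD, G, ← hV, hm]
  have hJN' : ∀ v, inner ℝ N' (complexJ (fderiv ℝ f u v))
      = l * inner ℝ N (complexJ (fderiv ℝ f u v)) := by
    intro v
    rw [hN', real_inner_smul_left, inner_add_left, real_inner_smul_left, hV,
      inner_complexJ_complexJ, hfD]
    ring
  have hKm : ∀ a b, bergerCovDeriv 4 τ f u a b N'
      = K (EuclideanSpace.single a 1) (EuclideanSpace.single b 1) := by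
    intro a b
    rw [bergerCovDeriv, hgN, hpp, christoffel_four]
    simp only [partialD, hJN', K, ← hV, ← hm]
    ring
  have hbil : ∀ (T : R2 → R2 → ℝ), (∀ a v b v' w, T (a • v + b • v') w = a * T v w + b * T v' w) →
      (∀ a v b v' w, T w (a • v + b • v') = a * T w v + b * T w v') →
      ∀ v w, T v w = ∑ a, ∑ b, v a * w b
        * (Matrix.of fun a b : Fin 2 =>
          T (EuclideanSpace.single a 1) (EuclideanSpace.single b 1)) a b := by
    intro T h1 h2 v w
    conv_lhs => rw [eq_sum_single v, eq_sum_single w]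
    rw [h1, h2, h2]
    simp only [Fin.sum_univ_two, Matrix.of_apply]
    ring
  have key := trace_change_basis (α := α) (β := β) _ (hbil G
      (fun a v b v' w => by
        simp only [G, map_add, map_smul, inner_add_left, real_inner_smul_left]; ring)
      (fun a v b v' w => by
        simp only [G, map_add, map_smul, inner_add_left, inner_add_right, real_inner_smul_left,
          real_inner_smul_right]; ring)) _ (hbil K
      (fun a v b v' w => by
        simp only [K, map_add, map_smul, add_apply, smul_apply, inner_add_left, inner_add_right,
          real_inner_smul_left, real_inner_smul_right]; ring)
      (fun a v b v' w => by
        simp only [K, map_add, map_smul, inner_add_left, inner_add_right,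
          real_inner_smul_left, real_inner_smul_right]; ring))
      (by simp only [Matrix.of_apply, G]; rw [real_inner_comm]; ring)
      (by simp only [Matrix.of_apply, K]; rw [hsymm]; ring)
      (by
        have e1 : (Matrix.of fun a b : Fin 2 => G (EuclideanSpace.single a 1)
          (EuclideanSpace.single b 1)) = bergerGram 4 τ f u := by
          ext a b; rw [hGm]; rfl
        rw [e1]
        simp only [Matrix.of_apply, ← hKm]
        rw [bergerMeanCurvature] at hmc
        linarith)
  have k21 := real_inner_comm (fderiv ℝ f u β) (fderiv ℝ f u α) ▸ k12
  -- The part of the covariant derivative from the Christoffel symbols is trace-free.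
  have hperp : inner ℝ V (fderiv ℝ f u α) * inner ℝ N (complexJ (fderiv ℝ f u α))
      + inner ℝ V (fderiv ℝ f u β) * inner ℝ N (complexJ (fderiv ℝ f u β)) = 0 := by
    have e := expand_of_orthonormal ho (complexJ N)
    have e1 : inner ℝ V (complexJ N) = 0 := by rw [hV, inner_complexJ_complexJ, k03]
    rw [e] at e1
    simp only [inner_add_right, real_inner_smul_right, inner_self_complexJ] at e1
    rw [hV, inner_complexJ_self] at e1
    rw [inner_complexJ_right (fderiv ℝ f u α), inner_complexJ_right (fderiv ℝ f u β),
      real_inner_comm N, real_inner_comm N] at e1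
    linarith
  have c1 := real_inner_comm V (fderiv ℝ f u α)
  have c2 := real_inner_comm V (fderiv ℝ f u β)
  simp only [G, K, k1, k2, k12, c1, c2] at key
  generalize inner ℝ V (fderiv ℝ f u α) = A₁, inner ℝ V (fderiv ℝ f u β) = A₂,
    inner ℝ N (complexJ (fderiv ℝ f u α)) = κ₁, inner ℝ N (complexJ (fderiv ℝ f u β)) = κ₂,
    inner ℝ (fderiv ℝ (fderiv ℝ f) u α α) N = h₁₁, inner ℝ (fderiv ℝ (fderiv ℝ f) u α β) N = h₁₂,
    inner ℝ (fderiv ℝ (fderiv ℝ f) u β β) N = h₂₂ at key hperp ⊢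
  have hm0 : 0 ≤ m := by rw [hm]; nlinarith
  have hdet : (1 + m * A₁ * A₁) * (1 + m * A₂ * A₂) - (0 + m * A₁ * A₂) ^ 2 ≠ 0 := by
    have : 0 < (1 + m * A₁ * A₁) * (1 + m * A₂ * A₂) - (0 + m * A₁ * A₂) ^ 2 := by
      have h1 : 0 ≤ m * A₁ ^ 2 := by positivity
      have h2 : 0 ≤ m * A₂ ^ 2 := by positivity
      nlinarith
    exact this.ne'
  have key := key hdet
  apply mul_left_cancel₀ hl0
  linear_combination key - 2 * l * m * hperp

/-! ### The local classification -/

theorem exists_unit_orthogonal (x a b : C2) :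
    ∃ n : C2, inner ℝ n n = 1 ∧ inner ℝ x n = 0 ∧ inner ℝ a n = 0 ∧ inner ℝ b n = 0 := by
  let K := Submodule.span ℝ (Set.range ![x, a, b])
  have hK : Module.finrank ℝ K ≤ 3 := by
    exact (finrank_range_le_card (R := ℝ) ![x, a, b]).trans (by simp)
  have hne : Kᗮ ≠ ⊥ := by
    intro h
    have h1 := Submodule.finrank_add_finrank_orthogonal K
    rw [h, finrank_bot, fact_finrank_C2.out] at h1
    omega
  obtain ⟨y, hy, hy0⟩ := Submodule.exists_mem_ne_zero_of_ne_bot hne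
  have hy' : ∀ z ∈ Set.range ![x, a, b], inner ℝ z y = 0 := fun z hz =>
    (Submodule.mem_orthogonal K y).1 hy z (Submodule.subset_span hz)
  have hn : ‖y‖ ≠ 0 := norm_ne_zero_iff.2 hy0
  refine ⟨‖y‖⁻¹ • y, ?_, ?_, ?_, ?_⟩
  · rw [real_inner_smul_left, real_inner_smul_right, real_inner_self_eq_norm_sq]
    field_simp
  · rw [real_inner_smul_right, hy' x ⟨0, rfl⟩, mul_zero]
  · rw [real_inner_smul_right, hy' a ⟨1, rfl⟩, mul_zero]
  · rw [real_inner_smul_right, hy' b ⟨2, rfl⟩, mul_zero]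

/-- Near each point of an immersed surface in `S³` there are smooth orthonormal tangent fields and a
smooth unit normal, obtained by orthonormalization. -/
theorem exists_orthonormal_frame {f : R2 → C2} {U : Set R2} (hU : IsOpen U)
    (hf : ContDiffOn ℝ ∞ f U) (h1 : ∀ u ∈ U, inner ℝ (f u) (f u) = 1)
    (hfD : ∀ u ∈ U, ∀ v, inner ℝ (f u) (fderiv ℝ f u v) = 0)
    (hi : ∀ u ∈ U, Function.Injective (fderiv ℝ f u)) {u₀ : R2} (hu₀ : u₀ ∈ U) :
    ∃ V : Set R2, u₀ ∈ V ∧ V ⊆ U ∧ IsOpen V ∧ ∃ α β : R2 → R2, ∃ N : R2 → C2,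
      ContDiffOn ℝ ∞ α V ∧ ContDiffOn ℝ ∞ β V ∧ ContDiffOn ℝ ∞ N V ∧
      (∀ u ∈ V, Orthonormal ℝ ![f u, fderiv ℝ f u (α u), fderiv ℝ f u (β u), N u]) ∧
      ∀ u ∈ V, ∀ v, inner ℝ (fderiv ℝ f u v) (N u) = 0 := by
  let e₀ : R2 := EuclideanSpace.single 0 1
  let e₁ : R2 := EuclideanSpace.single 1 1
  let X : R2 → C2 := fun u => fderiv ℝ f u e₀
  have hX : ContDiffOn ℝ ∞ X U := ContDiffOn.dirD hU hf contDiffOn_const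
  have hX0 : ∀ u ∈ U, X u ≠ 0 := fun u hu h => by
    have := hi u hu (h.trans (map_zero _).symm)
    simpa [e₀] using congrArg (fun v : R2 => v 0) this
  let α : R2 → R2 := fun u => ‖X u‖⁻¹ • e₀
  have hXn : ContDiffOn ℝ ∞ (fun u => ‖X u‖⁻¹) U := (hX.norm ℝ hX0).inv fun u hu =>
    norm_ne_zero_iff.2 (hX0 u hu)
  have hα : ContDiffOn ℝ ∞ α U := hXn.smul contDiffOn_const
  let a : R2 → C2 := fun u => fderiv ℝ f u (α u)
  have ha : ContDiffOn ℝ ∞ a U := ContDiffOn.dirD hU hf hα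
  have haa : ∀ u ∈ U, inner ℝ (a u) (a u) = 1 := fun u hu => by
    have := norm_ne_zero_iff.2 (hX0 u hu)
    simp only [a, α, map_smul, real_inner_smul_left, real_inner_smul_right]
    rw [show fderiv ℝ f u e₀ = X u from rfl, real_inner_self_eq_norm_sq]
    field_simp
  let d : R2 → ℝ := fun u => inner ℝ (a u) (fderiv ℝ f u e₁)
  have hd : ContDiffOn ℝ ∞ d U := ha.inner ℝ (ContDiffOn.dirD hU hf contDiffOn_const)
  let y : R2 → R2 := fun u => e₁ - d u • α u
  have hy : ContDiffOn ℝ ∞ y U := contDiffOn_const.sub (hd.smul hα)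
  let Y : R2 → C2 := fun u => fderiv ℝ f u (y u)
  have hY : ContDiffOn ℝ ∞ Y U := ContDiffOn.dirD hU hf hy
  have hY0 : ∀ u ∈ U, Y u ≠ 0 := fun u hu h => by
    have := hi u hu (h.trans (map_zero _).symm)
    simpa [y, α, e₀, e₁] using congrArg (fun v : R2 => v 1) this
  have haY : ∀ u ∈ U, inner ℝ (a u) (Y u) = 0 := fun u hu => by
    simp only [Y, y, map_sub, map_smul, inner_sub_right, real_inner_smul_right]
    rw [show fderiv ℝ f u (α u) = a u from rfl, haa u hu]
    simp [d]
  have hYn : ContDiffOn ℝ ∞ (fun u => ‖Y u‖⁻¹) U := (hY.norm ℝ hY0).inv fun u hu =>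
    norm_ne_zero_iff.2 (hY0 u hu)
  let β : R2 → R2 := fun u => ‖Y u‖⁻¹ • y u
  have hβ : ContDiffOn ℝ ∞ β U := hYn.smul hy
  let b : R2 → C2 := fun u => fderiv ℝ f u (β u)
  have hb : ContDiffOn ℝ ∞ b U := ContDiffOn.dirD hU hf hβ
  have hbY : ∀ u, b u = ‖Y u‖⁻¹ • Y u := fun u => map_smul _ _ _
  have hbb : ∀ u ∈ U, inner ℝ (b u) (b u) = 1 := fun u hu => by
    have := norm_ne_zero_iff.2 (hY0 u hu)
    rw [hbY, real_inner_smul_left, real_inner_smul_right, real_inner_self_eq_norm_sq]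
    field_simp
  have hab : ∀ u ∈ U, inner ℝ (a u) (b u) = 0 := fun u hu => by
    rw [hbY, real_inner_smul_right, haY u hu, mul_zero]
  obtain ⟨n, hn, hxn, han, hbn⟩ := exists_unit_orthogonal (f u₀) (a u₀) (b u₀)
  let m : R2 → C2 := fun u => n - inner ℝ (f u) n • f u - inner ℝ (a u) n • a u
    - inner ℝ (b u) n • b u
  have hm : ContDiffOn ℝ ∞ m U :=
    ((contDiffOn_const.sub ((hf.inner ℝ contDiffOn_const).smul hf)).sub
    ((ha.inner ℝ contDiffOn_const).smul ha)).sub ((hb.inner ℝ contDiffOn_const).smul hb)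
  have hm0 : m u₀ ≠ 0 := by
    intro h
    simp only [m, hxn, han, hbn, zero_smul, sub_zero] at h
    rw [h, inner_zero_left] at hn
    exact zero_ne_one hn
  obtain ⟨V, hV, hVo, huV⟩ := mem_nhds_iff.1 (Filter.inter_mem
    ((hm.continuousOn.continuousAt (hU.mem_nhds hu₀)).eventually_ne hm0) (hU.mem_nhds hu₀))
  have hVU : V ⊆ U := fun u hu => (hV hu).2
  have hmV : ∀ u ∈ V, m u ≠ 0 := fun u hu => (hV hu).1
  have hfa : ∀ u ∈ U, inner ℝ (f u) (a u) = 0 := fun u hu => hfD u hu _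
  have hfb : ∀ u ∈ U, inner ℝ (f u) (b u) = 0 := fun u hu => hfD u hu _
  have hm1 : ∀ u ∈ U, inner ℝ (f u) (m u) = 0 ∧ inner ℝ (a u) (m u) = 0 ∧
      inner ℝ (b u) (m u) = 0 := fun u hu => by
    have c1 := real_inner_comm (a u) (f u) ▸ hfa u hu
    have c2 := real_inner_comm (b u) (f u) ▸ hfb u hu
    have c3 := real_inner_comm (b u) (a u) ▸ hab u hu
    simp only [m, inner_sub_right, real_inner_smul_right, h1 u hu, haa u hu, hbb u hu, hfa u hu,
      hfb u hu, hab u hu, c1, c2, c3]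
    refine ⟨?_, ?_, ?_⟩ <;> ring
  let N : R2 → C2 := fun u => ‖m u‖⁻¹ • m u
  have hN : ContDiffOn ℝ ∞ N V := (((hm.mono hVU).norm ℝ hmV).inv fun u hu =>
    norm_ne_zero_iff.2 (hmV u hu)).smul (hm.mono hVU)
  refine ⟨V, huV, hVU, hVo, α, β, N, hα.mono hVU, hβ.mono hVU, hN, fun u hu => ?_,
    fun u hu v => ?_⟩
  · obtain ⟨q1, q2, q3⟩ := hm1 u (hVU hu)
    have hu' := hVU hu
    rw [orthonormal_vec4_iff]
    refine ⟨⟨h1 u hu', haa u hu', hbb u hu', ?_⟩, hfa u hu', hfb u hu', ?_, hab u hu', ?_, ?_⟩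
    · have := norm_ne_zero_iff.2 (hmV u hu)
      rw [real_inner_smul_left, real_inner_smul_right, real_inner_self_eq_norm_sq]
      field_simp
    · rw [real_inner_smul_right, q1, mul_zero]
    · rw [real_inner_smul_right]; exact mul_eq_zero_of_right _ q2
    · rw [real_inner_smul_right]; exact mul_eq_zero_of_right _ q3
  · obtain ⟨-, q2, q3⟩ := hm1 u (hVU hu)
    have n1 := norm_ne_zero_iff.2 (hX0 u (hVU hu))
    have n2 := norm_ne_zero_iff.2 (hY0 u (hVU hu))
    have e0 : e₀ = ‖X u‖ • α u := by simp only [α, smul_smul, mul_inv_cancel₀ n1, one_smul]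
    have e1 : e₁ = ‖Y u‖ • β u + d u • α u := by
      simp only [β, y, smul_smul, mul_inv_cancel₀ n2, one_smul]; abel
    have hv : v = v 0 • e₀ + v 1 • e₁ := eq_sum_single v
    rw [hv, e1, e0]
    simp only [map_add, map_smul, inner_add_left, real_inner_smul_left, N, real_inner_smul_right]
    rw [show inner ℝ (fderiv ℝ f u (α u)) (m u) = 0 from q2,
      show inner ℝ (fderiv ℝ f u (β u)) (m u) = 0 from q3]
    ring

theorem inner_fderiv_eq_zero {f : R2 → C2} {U : Set R2} (hU : IsOpen U) (hf : ContDiffOn ℝ ∞ f U)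
    (h1 : ∀ u ∈ U, inner ℝ (f u) (f u) = 1) {u : R2} (hu : u ∈ U) (v : R2) :
    inner ℝ (f u) (fderiv ℝ f u v) = 0 := by
  have hd := (hf.differentiableAt_of_isOpen hU hu).hasFDerivAt
  have h := (hd.inner ℝ hd).unique ((hasFDerivAt_const (1 : ℝ) u).congr_of_eventuallyEq
    (Filter.eventually_of_mem (hU.mem_nhds hu) h1))
  have h := congrArg (fun L : R2 →L[ℝ] ℝ => L v) h
  simp [fderivInnerCLM_apply] at h
  rw [real_inner_comm (f u)] at h
  linarith

/-- Minimality for the round metric, `τ = 1`, and for one further Berger metric, `τ = 2`, suffice: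
then the trace of the second fundamental form vanishes, and so does its value on the direction
orthogonal to the Hopf field. -/
theorem exists_surfaceFrame {f : R2 → C2} {U : Set R2} (hU : IsOpen U)
    (hf : ContDiffOn ℝ ∞ f U) (h1 : ∀ u ∈ U, inner ℝ (f u) (f u) = 1)
    (hi : ∀ u ∈ U, Function.Injective (fderiv ℝ f u))
    (hmin : ∀ τ : ℝ, 0 < τ → ∀ u ∈ U, ∀ N', IsBergerUnitNormal 4 τ f u N' →
      bergerMeanCurvature 4 τ f u N' = 0) {u₀ : R2} (hu₀ : u₀ ∈ U) :
    ∃ V : Set R2, u₀ ∈ V ∧ V ⊆ U ∧ Nonempty (SurfaceFrame f V) := by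
  have hfD := fun u hu => inner_fderiv_eq_zero hU hf h1 (u := u) hu
  obtain ⟨V, huV, hVU, hVo, α, β, N, hα, hβ, hN, ho, hND⟩ :=
    exists_orthonormal_frame hU hf h1 hfD hi hu₀
  have hfV := hf.mono hVU
  -- The Weingarten equation.
  have hW : ∀ u ∈ V, ∀ v w, inner ℝ (fderiv ℝ N u v) (fderiv ℝ f u w)
      = -inner ℝ (fderiv ℝ (fderiv ℝ f) u v w) (N u) := by
    intro u hu v w
    have hd2 : HasFDerivAt (fderiv ℝ f) (fderiv ℝ (fderiv ℝ f) u) u :=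
      ((hfV.fderiv_of_isOpen hVo (m := ∞) (by simp)).differentiableAt_of_isOpen hVo hu).hasFDerivAt
    have hdw := hd2.clm_apply (hasFDerivAt_const w u)
    have hdN := (hN.differentiableAt_of_isOpen hVo hu).hasFDerivAt
    have h := (hdw.inner ℝ hdN).unique ((hasFDerivAt_const (0 : ℝ) u).congr_of_eventuallyEq
      (Filter.eventually_of_mem (hVo.mem_nhds hu) fun y hy => hND y hy w))
    have h := congrArg (fun L : R2 →L[ℝ] ℝ => L v) h
    simp [fderivInnerCLM_apply] at h
    rw [real_inner_comm (fderiv ℝ N u v)] at h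
    linarith
  have hNN : ∀ u ∈ V, ∀ v, inner ℝ (N u) (fderiv ℝ N u v) = 0 := fun u hu =>
    inner_fderiv_eq_zero hVo hN (fun y hy => (orthonormal_vec4_iff.1 (ho y hy)).1.2.2.2) hu
  have hfN : ∀ u ∈ V, ∀ v, inner ℝ (f u) (fderiv ℝ N u v) = 0 := by
    intro u hu v
    have hdf := (hfV.differentiableAt_of_isOpen hVo hu).hasFDerivAt
    have hdN := (hN.differentiableAt_of_isOpen hVo hu).hasFDerivAt
    have h := (hdf.inner ℝ hdN).unique ((hasFDerivAt_const (0 : ℝ) u).congr_of_eventuallyEq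
      (Filter.eventually_of_mem (hVo.mem_nhds hu) fun y hy =>
        (orthonormal_vec4_iff.1 (ho y hy)).2.2.2.1))
    have h := congrArg (fun L : R2 →L[ℝ] ℝ => L v) h
    simp [fderivInnerCLM_apply] at h
    rwa [hND u hu v, add_zero] at h
  let p : R2 → ℝ := fun u => -inner ℝ (fderiv ℝ N u (α u)) (fderiv ℝ f u (α u))
  let q : R2 → ℝ := fun u => -inner ℝ (fderiv ℝ N u (α u)) (fderiv ℝ f u (β u))
  have hp : ContDiffOn ℝ ∞ p V := ((ContDiffOn.dirD hVo hN hα).inner ℝ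
    (ContDiffOn.dirD hVo hfV hα)).neg
  have hq : ContDiffOn ℝ ∞ q V := ((ContDiffOn.dirD hVo hN hα).inner ℝ
    (ContDiffOn.dirD hVo hfV hβ)).neg
  have hc2 : ∀ u ∈ V, ContDiffAt ℝ 2 f u := fun u hu =>
    (hfV.contDiffAt (hVo.mem_nhds hu)).of_le (by norm_cast)
  have hid := fun u hu τ hτ => mean_curvature_identity (hc2 u hu) (ho u hu) (hfD u (hVU hu))
    (hND u hu) (τ := τ) hτ (hmin τ (by linarith) u (hVU hu))
  have htr : ∀ u ∈ V, inner ℝ (fderiv ℝ N u (β u)) (fderiv ℝ f u (β u)) = p u := by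
    intro u hu
    have h := hid u hu 1 le_rfl
    simp only [p]
    rw [hW u hu, hW u hu]
    linarith
  have hsym : ∀ u ∈ V, inner ℝ (fderiv ℝ N u (β u)) (fderiv ℝ f u (α u)) = -q u := by
    intro u hu
    simp only [q]
    rw [hW u hu, hW u hu, ((hc2 u hu).isSymmSndFDerivAt (by simp)).eq (β u) (α u)]
    ring
  have hexp : ∀ u ∈ V, ∀ v, fderiv ℝ N u v
      = inner ℝ (fderiv ℝ N u v) (fderiv ℝ f u (α u)) • fderiv ℝ f u (α u)
        + inner ℝ (fderiv ℝ N u v) (fderiv ℝ f u (β u)) • fderiv ℝ f u (β u) := by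
    intro u hu v
    have e := expand_of_orthonormal (ho u hu) (fderiv ℝ N u v)
    rw [hfN u hu, hNN u hu] at e
    conv_lhs => rw [e]
    rw [real_inner_comm, real_inner_comm (fderiv ℝ N u v) (fderiv ℝ f u (β u))]
    module
  refine ⟨V, huV, hVU, ⟨{
    α := α, β := β, N := N, p := p, q := q, isOpen := hVo, smooth_f := hfV, smooth_α := hα
    smooth_β := hβ, smooth_N := hN, smooth_p := hp, smooth_q := hq, orthonormal := ho
    N_α := fun u hu => ?_, N_β := fun u hu => ?_, asymptotic := fun u hu => ?_ }⟩⟩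
  · rw [hexp u hu (α u)]
    simp only [p, q]
    module
  · rw [hexp u hu (β u), htr u hu, hsym u hu]
  · have h2 := hid u hu 2 (by norm_num)
    have h1' := hid u hu 1 le_rfl
    simp only [p, q]
    rw [hW u hu, hW u hu]
    generalize inner ℝ (complexJ (f u)) (fderiv ℝ f u (α u)) = A₁,
      inner ℝ (complexJ (f u)) (fderiv ℝ f u (β u)) = A₂,
      inner ℝ (fderiv ℝ (fderiv ℝ f) u (α u) (α u)) (N u) = h₁₁,
      inner ℝ (fderiv ℝ (fderiv ℝ f) u (α u) (β u)) (N u) = h₁₂,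
      inner ℝ (fderiv ℝ (fderiv ℝ f) u (β u) (β u)) (N u) = h₂₂ at *
    linear_combination h2 / 3 - (1 / 3 + A₁ ^ 2) * h1'

/-- The local classification: near each point the surface is totally geodesic, or it carries a
helicoidal frame with `b ≠ 0`. -/
theorem exists_hyperplane_or_helicoidalFrame {f : R2 → C2} {U : Set R2} (hU : IsOpen U)
    (hf : ContDiffOn ℝ ∞ f U) (h1 : ∀ u ∈ U, inner ℝ (f u) (f u) = 1)
    (hi : ∀ u ∈ U, Function.Injective (fderiv ℝ f u))
    (hmin : ∀ τ : ℝ, 0 < τ → ∀ u ∈ U, ∀ N', IsBergerUnitNormal 4 τ f u N' →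
      bergerMeanCurvature 4 τ f u N' = 0) {u : R2} (hu : u ∈ U) :
    (∃ n : C2, n ≠ 0 ∧ ∀ᶠ w in 𝓝 u, inner ℝ (f w) n = 0) ∨
    ∃ V : Set R2, u ∈ V ∧ V ⊆ U ∧ ∃ F : HelicoidalFrame f V, ∀ w ∈ V, F.b w ≠ 0 := by
  obtain ⟨V, huV, hVU, ⟨B⟩⟩ := exists_surfaceFrame hU hf h1 hi hmin hu
  by_cases h : B.p u ^ 2 + B.q u ^ 2 = 0
  · left
    exact B.exists_inner_eq_zero_of_umbilic huV
      (by nlinarith [sq_nonneg (B.p u), sq_nonneg (B.q u)])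
      (by nlinarith [sq_nonneg (B.p u), sq_nonneg (B.q u)])
  · right
    obtain ⟨W, h2, h3, h4⟩ := B.exists_helicoidalFrame_of_not_umbilic huV h
    exact ⟨W, h2, h3.trans hVU, h4⟩

/-! ### Immersions of a surface in charts -/

theorem contMDiff_coe_immersion {M : Type*} [TopologicalSpace M] [ChartedSpace R2 M]
    {Φ : M → S3} (hΦ : IsSmoothImmersion Φ) :
    ContMDiff (𝓡 2) 𝓘(ℝ, C2) ∞ (fun p => (Φ p : C2)) :=
  contMDiff_coe_sphere.comp hΦ.1

theorem injective_mfderiv_coe_immersion {M : Type*} [TopologicalSpace M] [ChartedSpace R2 M]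
    {Φ : M → S3} (hΦ : IsSmoothImmersion Φ) (p : M) :
    Function.Injective (mfderiv (𝓡 2) 𝓘(ℝ, C2) (fun p => (Φ p : C2)) p) := by
  have h : mfderiv (𝓡 2) 𝓘(ℝ, C2) (fun p => (Φ p : C2)) p
      = (mfderiv (𝓡 3) 𝓘(ℝ, C2) (fun x : S3 => (x : C2)) (Φ p)).comp
        (mfderiv (𝓡 2) (𝓡 3) Φ p) :=
    mfderiv_comp p ((contMDiff_coe_sphere (m := 1)).mdifferentiable one_ne_zero (Φ p))
      (hΦ.1.mdifferentiable (by simp) p)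
  rw [h]
  have h3 := injective_mvfderiv_subtypeVal_sphere (E := C2) (n := 3) (Φ p)
  exact (show Function.Injective (mfderiv (𝓡 3) 𝓘(ℝ, C2) (fun x : S3 => (x : C2)) (Φ p))
    from h3).comp (hΦ.2 p)

section Charts

variable {M : Type*} [TopologicalSpace M] [ChartedSpace R2 M] [IsManifold (𝓡 2) ∞ M] {X : M → C2}

theorem contDiffOn_comp_chart_symm (hX : ContMDiff (𝓡 2) 𝓘(ℝ, C2) ∞ X) (p : M) :
    ContDiffOn ℝ ∞ (fun v => X ((chartAt R2 p).symm v)) (chartAt R2 p).target :=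
  contMDiffOn_iff_contDiffOn.1 (hX.comp_contMDiffOn (contMDiffOn_chart_symm (I := 𝓡 2) (x := p)))

theorem contDiffOn_chart_transition (p q : M) :
    ContDiffOn ℝ ∞ (fun v => chartAt R2 q ((chartAt R2 p).symm v))
      ((chartAt R2 p).target ∩ (chartAt R2 p).symm ⁻¹' (chartAt R2 q).source) :=
  contMDiffOn_iff_contDiffOn.1 ((contMDiffOn_chart (I := 𝓡 2) (x := q)).comp
    ((contMDiffOn_chart_symm (I := 𝓡 2) (x := p)).mono Set.inter_subset_left)
    Set.inter_subset_right)

theorem injective_fderiv_comp_chart_symm (hX : ContMDiff (𝓡 2) 𝓘(ℝ, C2) ∞ X)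
    (hi : ∀ p, Function.Injective (mfderiv (𝓡 2) 𝓘(ℝ, C2) X p)) (p : M) {u : R2}
    (hu : u ∈ (chartAt R2 p).target) :
    Function.Injective (fderiv ℝ (fun v => X ((chartAt R2 p).symm v)) u) := by
  have : IsManifold (𝓡 2) 1 M := IsManifold.of_le (n := ∞) (by simp)
  have hφ := mdifferentiable_chart (I := 𝓡 2) p
  have h : mfderiv 𝓘(ℝ, R2) 𝓘(ℝ, C2) (fun v => X ((chartAt R2 p).symm v)) u
      = (mfderiv (𝓡 2) 𝓘(ℝ, C2) X ((chartAt R2 p).symm u)).comp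
        (mfderiv (𝓡 2) (𝓡 2) (chartAt R2 p).symm u) :=
    mfderiv_comp u (hX.mdifferentiable (by simp) _) (hφ.mdifferentiableAt_symm hu)
  rw [← mfderiv_eq_fderiv, h]
  refine (hi _).comp (Function.LeftInverse.injective
    (g := mfderiv (𝓡 2) (𝓡 2) (chartAt R2 p) ((chartAt R2 p).symm u)) fun v => ?_)
  exact congrArg (fun L : R2 →L[ℝ] R2 => L v) (hφ.comp_symm_deriv hu)

end Charts

/-! ### Surfaces in a hyperplane -/

/-- The position vector and the tangent plane of an immersed surface of `S³` span a hyperplane, so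
the vector orthogonal to it is unique up to a factor. -/
theorem exists_eq_smul_of_eventually_inner_eq_zero {f : R2 → C2} {U : Set R2} (hU : IsOpen U)
    (hf : ContDiffOn ℝ ∞ f U) (h1 : ∀ u ∈ U, inner ℝ (f u) (f u) = 1)
    (hi : ∀ u ∈ U, Function.Injective (fderiv ℝ f u)) {u : R2} (hu : u ∈ U) {m n : C2}
    (hm0 : m ≠ 0) (hm : ∀ᶠ w in 𝓝 u, inner ℝ (f w) m = 0) (hn : ∀ᶠ w in 𝓝 u, inner ℝ (f w) n = 0) :
    ∃ a : ℝ, n = a • m := by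
  obtain ⟨V, huV, hVU, hV, α, β, N, -, -, -, ho, -⟩ := exists_orthonormal_frame hU hf h1
    (fun u hu v => inner_fderiv_eq_zero hU hf h1 hu v) hi hu
  have hd := (hf.differentiableAt_of_isOpen hU hu).hasFDerivAt
  have key : ∀ y : C2, (∀ᶠ w in 𝓝 u, inner ℝ (f w) y = 0) → y = inner ℝ (N u) y • N u := by
    intro y hy
    have h0 := hy.self_of_nhds
    have h2 : ∀ v, inner ℝ (fderiv ℝ f u v) y = 0 := fun v => by
      have h := (hd.inner ℝ (hasFDerivAt_const y u)).unique
        ((hasFDerivAt_const (0 : ℝ) u).congr_of_eventuallyEq hy)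
      have h := congrArg (fun L : R2 →L[ℝ] ℝ => L v) h
      simpa using h
    have h3 := expand_of_orthonormal (ho u huV) y
    rw [h0, h2, h2] at h3
    simpa using h3
  have h4 := key m hm
  have h5 := key n hn
  have h6 : inner ℝ (N u) m ≠ 0 := fun h => hm0 (by rw [h4, h, zero_smul])
  refine ⟨inner ℝ (N u) n / inner ℝ (N u) m, ?_⟩
  rw [h5]
  conv_rhs => rw [h4]
  rw [smul_smul, inner_smul_right, inner_smul_right]
  have hN : inner ℝ (N u) (N u) = (1 : ℝ) := by
    exact (orthonormal_vec4_iff.1 (ho u huV)).1.2.2.2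
  rw [hN]
  congr 1
  field_simp

section Surfaces

variable {M : Type*} [TopologicalSpace M] [ChartedSpace R2 M] {X : M → C2}

/-- A property near `p` and near its image in the chart at `q`. -/
theorem eventually_chart_symm_iff {P : M → Prop} {p : M} (q : M) (hp : p ∈ (chartAt R2 q).source) :
    (∀ᶠ v in 𝓝 (chartAt R2 q p), P ((chartAt R2 q).symm v)) ↔ ∀ᶠ x in 𝓝 p, P x := by
  rw [← (chartAt R2 q).symm_map_nhds_eq hp, Filter.eventually_map]

/-- If near each point an immersed surface lies in some hyperplane, then it lies in one
hyperplane. -/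
theorem exists_forall_inner_eq_zero [ConnectedSpace M] [IsManifold (𝓡 2) ∞ M]
    (hX : ContMDiff (𝓡 2) 𝓘(ℝ, C2) ∞ X)
    (hi : ∀ p, Function.Injective (mfderiv (𝓡 2) 𝓘(ℝ, C2) X p)) (h1 : ∀ p, inner ℝ (X p) (X p) = 1)
    (h : ∀ p, ∃ n : C2, n ≠ 0 ∧ ∀ᶠ x in 𝓝 p, inner ℝ (X x) n = 0) :
    ∃ n : C2, n ≠ 0 ∧ ∀ p, inner ℝ (X p) n = 0 := by
  obtain ⟨p₀⟩ : Nonempty M := inferInstance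
  obtain ⟨n, hn, hp₀⟩ := h p₀
  refine ⟨n, hn, fun p => ?_⟩
  have hopen : IsOpen {p | ∀ᶠ x in 𝓝 p, inner ℝ (X x) n = 0} := isOpen_setOfPred_eventually_nhds
  have hclosed : IsClosed {p | ∀ᶠ x in 𝓝 p, inner ℝ (X x) n = 0} := by
    refine isClosed_of_closure_subset fun q hq => ?_
    obtain ⟨m, hm, hqm⟩ := h q
    obtain ⟨q', h2, h3⟩ := mem_closure_iff_nhds.1 hq _ (Filter.inter_mem hqm.eventually_nhds
      (chart_source_mem_nhds R2 q))
    obtain ⟨a, rfl⟩ := exists_eq_smul_of_eventually_inner_eq_zero (chartAt R2 q).open_target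
      (contDiffOn_comp_chart_symm hX q) (fun u _ => h1 _)
      (fun u hu => injective_fderiv_comp_chart_symm hX hi q hu) ((chartAt R2 q).map_source h2.2) hm
      ((eventually_chart_symm_iff (P := fun x => inner ℝ (X x) m = 0) q h2.2).2 h2.1)
      ((eventually_chart_symm_iff (P := fun x => inner ℝ (X x) n = 0) q h2.2).2 h3)
    filter_upwards [hqm] with x hx
    rw [real_inner_smul_right, hx, mul_zero]
  have := IsClopen.eq_univ ⟨hclosed, hopen⟩ ⟨p₀, hp₀⟩
  exact (show p ∈ {p | ∀ᶠ x in 𝓝 p, inner ℝ (X x) n = 0} by rw [this]; trivial).self_of_nhds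

end Surfaces

/-! ### Surfaces with helicoidal frames -/

section Helicoidal

variable {M : Type*} [TopologicalSpace M] [ChartedSpace R2 M] {X : M → C2}
  {c k : ℝ} {v₁ v₂ : C2}

/-- In the chart at `q` there is near `p` a helicoidal frame with `b ≠ 0` which agrees at `p`
with the helicoid with parameters `c`, `v₁`, `v₂`. -/
def MatchesNear (X : M → C2) (c k : ℝ) (v₁ v₂ : C2) (q p : M) : Prop :=
  p ∈ (chartAt R2 q).source ∧
  ∃ V : Set R2, chartAt R2 q p ∈ V ∧
    ∃ F : HelicoidalFrame (fun v => X ((chartAt R2 q).symm v)) V, (∀ w ∈ V, F.b w ≠ 0) ∧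
      ∃ s t, F.Matches c k v₁ v₂ (chartAt R2 q p) s t

/-- Away from the zeros of `r` the pull-back of a frame matches the same helicoid, and such points
are dense. -/
theorem MatchesNear.change_chart [IsManifold (𝓡 2) ∞ M] {q p : M}
    (h : MatchesNear X c k v₁ v₂ q p) {q' : M} (hp' : p ∈ (chartAt R2 q').source) :
    MatchesNear X c k v₁ v₂ q' p := by
  unfold MatchesNear at h ⊢
  set φ := chartAt R2 q with hφ
  set ψ := chartAt R2 q' with hψ
  obtain ⟨hp, V, hpV, F, hb, s, t, hF⟩ := h
  set V₁ := (φ.target ∩ φ.symm ⁻¹' ψ.source) ∩ V with hV₁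
  have hV₁o : IsOpen V₁ := (φ.isOpen_inter_preimage_symm ψ.open_source).inter F.isOpen
  set V₂ := (ψ.target ∩ ψ.symm ⁻¹' φ.source) ∩ (fun v => φ (ψ.symm v)) ⁻¹' V₁ with hV₂
  have hτ := contDiffOn_chart_transition q' q
  have hσ := contDiffOn_chart_transition q q'
  have hV₂o : IsOpen V₂ :=
    hτ.continuousOn.isOpen_inter_preimage (ψ.isOpen_inter_preimage_symm φ.open_source) hV₁o
  let F₁ := F.restrict hV₁o Set.inter_subset_right
  let G : HelicoidalFrame (fun v => X (ψ.symm v)) V₂ := F₁.pullback hV₂o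
    (hτ.mono Set.inter_subset_left) (hσ.mono Set.inter_subset_left) (fun _ hu => hu.2)
    (fun y hy => by
      change φ (ψ.symm (ψ (φ.symm y))) = y
      rw [ψ.left_inv hy.1.2, φ.right_inv hy.1.1])
    (fun u hu => by
      change ψ (φ.symm (φ (ψ.symm u))) = u
      rw [φ.left_inv hu.1.2, ψ.right_inv hu.1.1])
    (fun u hu => by
      change X (ψ.symm u) = X (φ.symm (φ (ψ.symm u)))
      rw [φ.left_inv hu.1.2])
  have hGb : ∀ w ∈ V₂, G.b w ≠ 0 := fun w hw => hb _ hw.2.2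
  have hp₁ : φ p ∈ V₁ := ⟨⟨φ.map_source hp, by rwa [Set.mem_preimage, φ.left_inv hp]⟩, hpV⟩
  have hp₂ : ψ p ∈ V₂ := ⟨⟨ψ.map_source hp', by rwa [Set.mem_preimage, ψ.left_inv hp']⟩,
    by rwa [Set.mem_preimage, ψ.left_inv hp']⟩
  obtain ⟨ε₁, hε₁, hB₁⟩ := Metric.isOpen_iff.1 hV₁o _ hp₁
  obtain ⟨ε₂, hε₂, hB₂⟩ := Metric.isOpen_iff.1 hV₂o _ hp₂
  -- The comparison takes place at a point near `p` where `r ≠ 0`.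
  have hcont : ContinuousAt (fun v => ψ (φ.symm v)) (φ p) :=
    hσ.continuousOn.continuousAt
      ((φ.isOpen_inter_preimage_symm ψ.open_source).mem_nhds hp₁.1)
  have hnear : ∀ᶠ w in 𝓝 (φ p), w ∈ Metric.ball (φ p) ε₁ ∧ ψ (φ.symm w) ∈ Metric.ball (ψ p) ε₂ := by
    refine Filter.Eventually.and (Metric.ball_mem_nhds _ hε₁) (hcont.preimage_mem_nhds ?_)
    rw [φ.left_inv hp]
    exact Metric.ball_mem_nhds _ hε₂
  obtain ⟨w, ⟨hw₁, hw₂⟩, hwr⟩ := F₁.exists_r_ne_zero hp₁ hnear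
  have hwV := hB₁ hw₁
  obtain ⟨s₁, t₁, h₁, -⟩ := F.exists_matches_of_segment hb hF (u := w)
    (((convex_ball _ _).segment_subset (Metric.mem_ball_self hε₁) hw₁).trans
      (hB₁.trans Set.inter_subset_right))
  have hw : φ (ψ.symm (ψ (φ.symm w))) = w := by rw [ψ.left_inv hwV.1.2, φ.right_inv hwV.1.1]
  have h₂ : G.Matches c k v₁ v₂ (ψ (φ.symm w)) s₁ t₁ := by
    refine h₁.congr G hwV.2 (hB₂ hw₂) ?_ ?_ ?_ ?_ ?_ hwr
    · exact congrArg X (ψ.left_inv hwV.1.2)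
    · exact congrArg F.e hw
    · exact congrArg F.r hw
    · exact congrArg F.C hw
    · exact congrArg F.b hw
  obtain ⟨s₃, t₃, h₃, -⟩ := G.exists_matches_of_segment hGb h₂ (u := ψ p)
    (((convex_ball _ _).segment_subset hw₂ (Metric.mem_ball_self hε₂)).trans hB₂)
  exact ⟨hp', V₂, hp₂, G, hGb, s₃, t₃, h₃⟩

/-- If a surface has a helicoidal frame on a convex set, and agrees with a helicoid at one point of
it, then it does so at each point. -/
theorem MatchesNear.of_convex {q p p' : M} {B : Set R2} (hB : Convex ℝ B)
    (F : HelicoidalFrame (fun v => X ((chartAt R2 q).symm v)) B) (hb : ∀ w ∈ B, F.b w ≠ 0)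
    (hpB : chartAt R2 q p ∈ B) (hpB' : chartAt R2 q p' ∈ B) (hp' : p' ∈ (chartAt R2 q).source)
    (h : MatchesNear X c k v₁ v₂ q p) : MatchesNear X c k v₁ v₂ q p' := by
  obtain ⟨hp, V, hpV, F', hb', s, t, hF'⟩ := h
  obtain ⟨ε, hε, hεV⟩ := Metric.isOpen_iff.1 (F'.isOpen.inter F.isOpen) _ ⟨hpV, hpB⟩
  obtain ⟨w, hw, hwr⟩ := F'.exists_r_ne_zero hpV (Metric.ball_mem_nhds _ hε)
  obtain ⟨s₁, t₁, h₁, -⟩ := F'.exists_matches_of_segment hb' hF' (u := w)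
    (((convex_ball _ _).segment_subset (Metric.mem_ball_self hε) hw).trans
      (hεV.trans Set.inter_subset_left))
  obtain ⟨G, hGb, hGe, hGr, hGC⟩ := F'.exists_frame_eq F (hεV hw).1 (hεV hw).2 hwr
  have h₂ := h₁.transfer G (hεV hw).1 (hεV hw).2 hGe hGr hGC hwr
  have hGb' : ∀ w ∈ B, G.b w ≠ 0 := fun w hw => by rw [hGb]; exact hb w hw
  obtain ⟨s₃, t₃, h₃, -⟩ := G.exists_matches_of_segment hGb' h₂ (u := chartAt R2 q p')
    (hB.segment_subset (hεV hw).2 hpB')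
  exact ⟨hp', B, hpB', G, hGb', s₃, t₃, h₃⟩

/-- A connected surface with helicoidal frames near all points agrees everywhere with the helicoid
it agrees with at one point. -/
theorem matchesNear_of_connected [ConnectedSpace M] [IsManifold (𝓡 2) ∞ M]
    (h : ∀ p : M, ∃ V, chartAt R2 p p ∈ V ∧
      ∃ F : HelicoidalFrame (fun v => X ((chartAt R2 p).symm v)) V, ∀ w ∈ V, F.b w ≠ 0)
    {p₀ : M} (h₀ : MatchesNear X c k v₁ v₂ p₀ p₀) (p : M) : MatchesNear X c k v₁ v₂ p p := by
  have key : ∀ q : M, ∀ᶠ p in 𝓝 q,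
      (MatchesNear X c k v₁ v₂ p p ↔ MatchesNear X c k v₁ v₂ q q) := by
    intro q
    obtain ⟨V, hqV, F, hb⟩ := h q
    obtain ⟨ε, hε, hεV⟩ := Metric.isOpen_iff.1 F.isOpen _ hqV
    let G := F.restrict Metric.isOpen_ball hεV
    have hGb : ∀ w ∈ Metric.ball (chartAt R2 q q) ε, G.b w ≠ 0 := fun w hw => hb w (hεV hw)
    filter_upwards [chart_source_mem_nhds R2 q, ((chartAt R2 q).continuousAt
      (mem_chart_source R2 q)).preimage_mem_nhds (Metric.ball_mem_nhds _ hε)] with p hp hpB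
    constructor
    · intro hpp
      exact MatchesNear.of_convex (convex_ball _ _) G hGb hpB (Metric.mem_ball_self hε)
        (mem_chart_source R2 q) (hpp.change_chart hp)
    · intro hqq
      exact (MatchesNear.of_convex (convex_ball _ _) G hGb (Metric.mem_ball_self hε) hpB hp
        hqq).change_chart (mem_chart_source R2 p)
  have hopen : IsOpen {p | MatchesNear X c k v₁ v₂ p p} :=
    isOpen_iff_mem_nhds.2 fun q hq => (key q).mono fun p hp => hp.2 hq
  have hclosed : IsClosed {p | MatchesNear X c k v₁ v₂ p p} :=
    ⟨isOpen_iff_mem_nhds.2 fun q hq => (key q).mono fun p hp hpp => hq (hp.1 hpp)⟩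
  have := IsClopen.eq_univ ⟨hclosed, hopen⟩ ⟨p₀, h₀⟩
  exact (show p ∈ {p | MatchesNear X c k v₁ v₂ p p} by rw [this]; trivial)

/-- A surface which agrees with a helicoid at `p` is covered near `p` by small pieces of it. -/
theorem MatchesNear.eventually {p : M} (h : MatchesNear X c k v₁ v₂ p p) :
    ∃ q : ℝ × ℝ, X p = helicoid c v₁ v₂ q.1 q.2 ∧
      ∀ W ∈ 𝓝 q, ∀ᶠ x in 𝓝 p, ∃ y ∈ W, X x = helicoid c v₁ v₂ y.1 y.2 := by
  unfold MatchesNear at h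
  set φ := chartAt R2 p with hφ
  set f : R2 → C2 := fun v => X (φ.symm v) with hf
  obtain ⟨hp, V, hpV, F, hb, s, t, hF⟩ := h
  have hfp : ∀ x ∈ φ.source, X x = f (φ x) := fun x hx => by rw [hf]; simp [φ.left_inv hx]
  refine ⟨(s, t), by rw [hfp p hp]; exact hF.f_eq, fun W hW => ?_⟩
  obtain ⟨ε, hε, hεW⟩ := Metric.mem_nhds_iff.1 hW
  -- A bound for the coframe near `p`.
  set B : R2 → ℝ := fun y => ‖fderiv ℝ f y‖ * ‖F.e y‖ + |k * (F.g y)⁻¹| *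
    (‖fderiv ℝ f y‖ * ‖F.r y • complexJ (f y) + F.C y • complexJ (F.e y)‖) with hB
  have hDf := F.smooth_f.continuousOn_fderiv_of_isOpen F.isOpen (by simp)
  have hBc : ContinuousOn B V := by
    refine (hDf.norm.mul F.smooth_e.continuousOn.norm).add
      (((continuousOn_const.mul ((F.smooth_g hb).continuousOn.inv₀
        fun y hy => (F.g_pos (hb y hy)).ne')).abs).mul (hDf.norm.mul (ContinuousOn.norm ?_)))
    exact (F.smooth_r.continuousOn.smul (complexJ.continuous.comp_continuousOn
      F.smooth_f.continuousOn)).add (F.smooth_C.continuousOn.smul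
        (complexJ.continuous.comp_continuousOn F.smooth_e.continuousOn))
  set m := B (φ p) + 1 with hm
  have hm0 : 0 < m := by positivity
  have hBm : ∀ᶠ y in 𝓝 (φ p), B y < m ∧ y ∈ V :=
    ((hBc.continuousAt (F.isOpen.mem_nhds hpV)).eventually_lt_const (by rw [hm]; linarith)).and
      (F.isOpen.mem_nhds hpV)
  obtain ⟨δ, hδ, hδB⟩ := Metric.mem_nhds_iff.1 hBm
  have hη : 0 < min δ (ε / (2 * m)) := by positivity
  filter_upwards [chart_source_mem_nhds R2 p, (φ.continuousAt hp).preimage_mem_nhds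
    (Metric.ball_mem_nhds _ hη)] with x hx hxB
  have hxn : ‖φ x - φ p‖ < min δ (ε / (2 * m)) := by rwa [← dist_eq_norm]
  have hseg : segment ℝ (φ p) (φ x) ⊆ Metric.ball (φ p) δ :=
    (convex_ball _ _).segment_subset (Metric.mem_ball_self hδ)
      (Metric.ball_subset_ball (min_le_left _ _) hxB)
  obtain ⟨s', t', h', hK⟩ := F.exists_matches_of_segment hb hF (u := φ x)
    fun y hy => (hδB (hseg hy)).2
  refine ⟨(s', t'), hεW ?_, by rw [hfp x hx]; exact h'.f_eq⟩
  have hKb := hK (m * ‖φ x - φ p‖) fun y hy => by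
    have hBy := (hδB (hseg hy)).1.le
    have hn := norm_nonneg (φ x - φ p)
    have hDle := (fderiv ℝ f y).le_opNorm (φ x - φ p)
    have e1 : |F.θ₂ y (φ x - φ p)| ≤ ‖fderiv ℝ f y‖ * ‖F.e y‖ * ‖φ x - φ p‖ := by
      refine (abs_real_inner_le_norm _ _).trans ?_
      calc _ ≤ (‖fderiv ℝ f y‖ * ‖φ x - φ p‖) * ‖F.e y‖ := by gcongr
        _ = _ := by ring
    have e2 : |k * (F.g y)⁻¹ * F.θ₁ y (φ x - φ p)| ≤ |k * (F.g y)⁻¹| *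
        (‖fderiv ℝ f y‖ * ‖F.r y • complexJ (f y) + F.C y • complexJ (F.e y)‖) *
          ‖φ x - φ p‖ := by
      rw [abs_mul, mul_assoc |k * (F.g y)⁻¹|]
      gcongr
      refine (abs_real_inner_le_norm _ _).trans ?_
      calc _ ≤ (‖fderiv ℝ f y‖ * ‖φ x - φ p‖)
            * ‖F.r y • complexJ (f y) + F.C y • complexJ (F.e y)‖ := by gcongr
        _ = _ := by ring
    refine ⟨e1.trans (mul_le_mul_of_nonneg_right ((le_add_of_nonneg_right ?_).trans hBy) hn),
      e2.trans (mul_le_mul_of_nonneg_right ((le_add_of_nonneg_left ?_).trans hBy) hn)⟩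
    all_goals positivity
  have hlt : m * ‖φ x - φ p‖ < ε := by
    have := hxn.trans_le (min_le_right _ _)
    rw [lt_div_iff₀ (by positivity)] at this
    nlinarith [norm_nonneg (φ x - φ p)]
  rw [Metric.mem_ball, Prod.dist_eq, max_lt_iff, Real.dist_eq, Real.dist_eq]
  exact ⟨hKb.1.trans_lt hlt, hKb.2.trans_lt hlt⟩

end Helicoidal

/-! ### Reparametrization -/

/-- A surface which is covered near `p` by arbitrarily small pieces of an immersion `Ψ` near `q` is
a reparametrization of `Ψ` near `p`: the parameter is recovered by a local left inverse of `Ψ`. -/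
theorem exists_reparametrization {M : Type*} [TopologicalSpace M] [ChartedSpace R2 M]
    {X : M → C2} (hX : ContMDiff (𝓡 2) 𝓘(ℝ, C2) ∞ X) {p : M}
    (hi : Function.Injective (mfderiv (𝓡 2) 𝓘(ℝ, C2) X p)) {Ψ : ℝ × ℝ → C2}
    (hΨ : ContDiff ℝ ∞ Ψ) {q : ℝ × ℝ} (hq : Function.Injective (fderiv ℝ Ψ q)) (hpq : X p = Ψ q)
    (hW : ∀ W ∈ 𝓝 q, ∀ᶠ x in 𝓝 p, ∃ y ∈ W, X x = Ψ y) :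
    ∃ h : M → ℝ × ℝ, h p = q ∧ ContMDiffAt (𝓡 2) 𝓘(ℝ, ℝ × ℝ) ∞ h p ∧
      Function.Bijective (mfderiv (𝓡 2) 𝓘(ℝ, ℝ × ℝ) h p) ∧ ∀ᶠ x in 𝓝 p, X x = Ψ (h x) := by
  obtain ⟨L₀, hL₀⟩ := LinearMap.exists_leftInverse_of_injective
    (fderiv ℝ Ψ q : ℝ × ℝ →ₗ[ℝ] C2) (LinearMap.ker_eq_bot.2 hq)
  let L : C2 →L[ℝ] ℝ × ℝ := LinearMap.toContinuousLinearMap L₀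
  have hL : ∀ v, L (fderiv ℝ Ψ q v) = v := fun v => congrArg (fun T : ℝ × ℝ →ₗ[ℝ] ℝ × ℝ => T v) hL₀
  have hG : ContDiffAt ℝ ∞ (fun y => L (Ψ y)) q := (L.contDiff.comp hΨ).contDiffAt
  have hG' : HasFDerivAt (fun y => L (Ψ y))
      (ContinuousLinearEquiv.refl ℝ (ℝ × ℝ) : ℝ × ℝ →L[ℝ] ℝ × ℝ) q := by
    refine (L.hasFDerivAt.comp q (hΨ.differentiable (by simp) q).hasFDerivAt).congr_fderiv ?_
    ext <;> simp [hL]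
  let e := hG.toOpenPartialHomeomorph _ hG' (by simp)
  have heq : q ∈ e.source := hG.mem_toOpenPartialHomeomorph_source hG' (by simp)
  have hinv : ∀ y ∈ e.source, e.symm (L (Ψ y)) = y := fun y hy => e.left_inv hy
  have hsymm : ContDiffAt ℝ ∞ e.symm (L (X p)) := by
    rw [hpq]; exact hG.to_localInverse hG' (by simp)
  have hh : ContMDiffAt (𝓡 2) 𝓘(ℝ, ℝ × ℝ) ∞ (fun x => e.symm (L (X x))) p :=
    (hsymm.comp (X p) (f := L) L.contDiff.contDiffAt).contMDiffAt.comp p hX.contMDiffAt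
  have hp : e.symm (L (X p)) = q := by rw [hpq]; exact hinv q heq
  have hev : ∀ᶠ x in 𝓝 p, X x = Ψ (e.symm (L (X x))) := by
    filter_upwards [hW _ (e.open_source.mem_nhds heq)] with x ⟨y, hy, hxy⟩
    rw [hxy, hinv y hy]
  refine ⟨fun x => e.symm (L (X x)), hp, hh, ?_, hev⟩
  have hmd := hh.mdifferentiableAt (by simp)
  have hchain : mfderiv (𝓡 2) 𝓘(ℝ, C2) X p
      = (mfderiv 𝓘(ℝ, ℝ × ℝ) 𝓘(ℝ, C2) Ψ (e.symm (L (X p)))).comp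
        (mfderiv (𝓡 2) 𝓘(ℝ, ℝ × ℝ) (fun x => e.symm (L (X x))) p) := by
    rw [Filter.EventuallyEq.mfderiv_eq (show X =ᶠ[𝓝 p] Ψ ∘ fun x => e.symm (L (X x)) from hev)]
    exact mfderiv_comp p (hΨ.contMDiff.mdifferentiable (by simp) _) hmd
  have hinj : Function.Injective (mfderiv (𝓡 2) 𝓘(ℝ, ℝ × ℝ) (fun x => e.symm (L (X x))) p) := by
    refine Function.Injective.of_comp
      (f := mfderiv 𝓘(ℝ, ℝ × ℝ) 𝓘(ℝ, C2) Ψ (e.symm (L (X p)))) ?_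
    rw [hchain] at hi
    exact hi
  refine ⟨hinj, ?_⟩
  let T : R2 →L[ℝ] ℝ × ℝ := mfderiv (𝓡 2) 𝓘(ℝ, ℝ × ℝ) (fun x => e.symm (L (X x))) p
  exact (LinearMap.injective_iff_surjective_of_finrank_eq_finrank (f := (T : R2 →ₗ[ℝ] ℝ × ℝ))
    (by simp)).1 hinj

/-! ### Congruences -/

theorem rotJ_eq_exp_smul (θ : ℝ) (v : C2) : rotJ θ v = Complex.exp (Complex.I * (θ : ℝ)) • v := by
  rw [mul_comm, Complex.exp_mul_I, ← Complex.ofReal_cos, ← Complex.ofReal_sin, add_smul, mul_smul]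
  rfl

/-- A unitary basis of `ℂ²` is the image of the standard one by a congruence commuting with `J`,
which takes the standard helicoids to the ones built on that basis. -/
theorem exists_congruence_helicoidMap {v₁ v₂ : C2} (h : IsUnitaryPair v₁ v₂) :
    ∃ A : C2 ≃ₗᵢ[ℝ] C2, IsBergerCongruence A ∧
      ∀ c q, A (helicoidMap c q) = helicoid c v₁ v₂ q.1 q.2 := by
  have hc : ∀ x y : C2, inner ℂ x y = ⟨inner ℝ x y, inner ℝ (complexJ x) y⟩ := fun x y => by
    apply Complex.ext
    · rfl
    · change _ = (inner ℂ (Complex.I • x) y : ℂ).re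
      rw [inner_smul_left]
      simp
  have ho : Orthonormal ℂ ![v₁, v₂] := by
    rw [orthonormal_iff_ite]
    intro i j
    fin_cases i <;> fin_cases j <;>
      simp [hc, h.xx, h.ee, h.xe, h.ex, h.Jxe, h.Jex, -inner_self_eq_norm_sq_to_K,
        Complex.ext_iff]
  have hs : ⊤ ≤ Submodule.span ℂ (Set.range ![v₁, v₂]) :=
    (ho.linearIndependent.span_eq_top_of_card_eq_finrank' (by simp)).ge
  let E := (OrthonormalBasis.mk ho hs).repr.symm
  have hE : ∀ x : C2, E x = x 0 • v₁ + x 1 • v₂ := fun x => by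
    have := (OrthonormalBasis.mk ho hs).sum_repr_symm x
    rw [OrthonormalBasis.coe_mk, Fin.sum_univ_two] at this
    exact this.symm
  refine ⟨⟨E.toLinearEquiv.restrictScalars ℝ, E.norm_map⟩, Or.inl fun x => E.map_smul _ x,
    fun c q => ?_⟩
  change E (helicoidMap c q) = _
  rw [hE, helicoid, rotJ_eq_exp_smul, rotJ_eq_exp_smul]
  simp only [helicoidMap, PiLp.toLp_apply, Matrix.cons_val_zero, Matrix.cons_val_one, mul_smul]
  rfl

theorem contDiff_helicoid (c : ℝ) (v₁ v₂ : C2) :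
    ContDiff ℝ ∞ fun q : ℝ × ℝ => helicoid c v₁ v₂ q.1 q.2 := by
  unfold helicoid rotJ
  have h1 : ContDiff ℝ ∞ fun q : ℝ × ℝ => q.1 := contDiff_fst
  have h2 : ContDiff ℝ ∞ fun q : ℝ × ℝ => q.2 := contDiff_snd
  have h3 : ContDiff ℝ ∞ fun q : ℝ × ℝ => c * q.2 := contDiff_const.mul h2
  exact (h1.cos.smul ((h3.cos.smul contDiff_const).add (h3.sin.smul contDiff_const))).add
    (h1.sin.smul ((h2.cos.smul contDiff_const).add (h2.sin.smul contDiff_const)))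

/-! ### The equator -/

theorem helicoid_zero (v₁ v₂ : C2) (s t : ℝ) :
    helicoid 0 v₁ v₂ s t = Real.cos s • v₁ + (Real.sin s * Real.cos t) • v₂
      + (Real.sin s * Real.sin t) • complexJ v₂ := by
  simp only [helicoid, rotJ, zero_mul, Real.cos_zero, Real.sin_zero]
  module

theorem sin_ne_zero_of_injective_fderiv {v₁ v₂ : C2} {q : ℝ × ℝ}
    (h : Function.Injective (fderiv ℝ (fun q : ℝ × ℝ => helicoid 0 v₁ v₂ q.1 q.2) q)) :
    Real.sin q.1 ≠ 0 := by
  intro hs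
  have h1 := ((contDiff_helicoid 0 v₁ v₂).differentiable (by simp) (q.1, q.2)).hasFDerivAt
  have h2 := h1.comp_hasDerivAt q.2 ((hasDerivAt_const q.2 q.1).prodMk (hasDerivAt_id q.2))
  have h3 : ((fun q : ℝ × ℝ => helicoid 0 v₁ v₂ q.1 q.2) ∘ fun t => (q.1, t))
      = fun _ => Real.cos q.1 • v₁ := by
    funext t
    simp [helicoid_zero, hs]
  have h4 := h2.unique (h3 ▸ hasDerivAt_const q.2 (Real.cos q.1 • v₁))
  have h5 := h (h4.trans (map_zero _).symm)
  simp at h5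

/-- A continuous choice of the angle near `θ₀`. -/
theorem exists_continuousAt_angle (θ₀ : ℝ) :
    ∃ θ : ℂ → ℝ, ContinuousAt θ ⟨Real.cos θ₀, Real.sin θ₀⟩ ∧ θ ⟨Real.cos θ₀, Real.sin θ₀⟩ = θ₀ ∧
      ∀ x y : ℝ, x ^ 2 + y ^ 2 = 1 → Real.cos (θ ⟨x, y⟩) = x ∧ Real.sin (θ ⟨x, y⟩) = y := by
  have hexp : (⟨Real.cos θ₀, Real.sin θ₀⟩ : ℂ) = Complex.exp (θ₀ * Complex.I) := by
    apply Complex.ext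
    · rw [Complex.exp_ofReal_mul_I_re]
    · rw [Complex.exp_ofReal_mul_I_im]
  have h1 : (⟨Real.cos θ₀, Real.sin θ₀⟩ : ℂ) * Complex.exp (-(θ₀ * Complex.I)) = 1 := by
    rw [hexp, ← Complex.exp_add, add_neg_cancel, Complex.exp_zero]
  refine ⟨fun z => θ₀ + (z * Complex.exp (-(θ₀ * Complex.I))).arg, ?_, ?_, ?_⟩
  · refine continuousAt_const.add (ContinuousAt.comp (g := Complex.arg) ?_ (by fun_prop))
    rw [h1]
    exact Complex.continuousAt_arg (by simp)
  · simp only [h1, Complex.arg_one, add_zero]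
  · intro x y hxy
    set z : ℂ := ⟨x, y⟩ * Complex.exp (-(θ₀ * Complex.I)) with hz
    have hn : ‖z‖ = 1 := by
      rw [hz, norm_mul, ← neg_mul, ← Complex.ofReal_neg, Complex.norm_exp_ofReal_mul_I, mul_one]
      have : ‖(⟨x, y⟩ : ℂ)‖ ^ 2 = 1 := by
        rw [← Complex.normSq_eq_norm_sq, Complex.normSq_mk]; linarith
      nlinarith [norm_nonneg (⟨x, y⟩ : ℂ)]
    have h2 : Complex.exp ((θ₀ + z.arg : ℝ) * Complex.I) = ⟨x, y⟩ := by
      have h3 := Complex.norm_mul_exp_arg_mul_I z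
      rw [hn, Complex.ofReal_one, one_mul] at h3
      rw [Complex.ofReal_add, add_mul, Complex.exp_add, h3, hz, mul_left_comm, ← Complex.exp_add,
        add_neg_cancel, Complex.exp_zero, mul_one]
    constructor
    · rw [← Complex.exp_ofReal_mul_I_re, h2]
    · rw [← Complex.exp_ofReal_mul_I_im, h2]

/-- A surface in the equator `⟨J v₁, ·⟩ = 0` is covered near `p` by small pieces of `Φ₀`, away from
the singular points of this map. -/
theorem eventually_eq_helicoid_zero {M : Type*} [TopologicalSpace M] {X : M → C2} {p : M}
    (hX : ContinuousAt X p) (h1 : ∀ x, inner ℝ (X x) (X x) = 1) {v₁ v₂ : C2}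
    (hv : IsUnitaryPair v₁ v₂) (hJ : ∀ x, inner ℝ (complexJ v₁) (X x) = 0) {s t : ℝ}
    (hp : X p = helicoid 0 v₁ v₂ s t) (hs : Real.sin s ≠ 0) {W : Set (ℝ × ℝ)} (hW : W ∈ 𝓝 (s, t)) :
    ∀ᶠ x in 𝓝 p, ∃ y ∈ W, X x = helicoid 0 v₁ v₂ y.1 y.2 := by
  set a : M → ℝ := fun x => inner ℝ v₁ (X x) with ha
  set b : M → ℝ := fun x => inner ℝ v₂ (X x) with hb
  set d : M → ℝ := fun x => inner ℝ (complexJ v₂) (X x) with hd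
  have hac : ContinuousAt a p := continuousAt_const.inner hX
  have hbc : ContinuousAt b p := continuousAt_const.inner hX
  have hdc : ContinuousAt d p := continuousAt_const.inner hX
  have hexp : ∀ x, X x = a x • v₁ + b x • v₂ + d x • complexJ v₂ := fun x => by
    have := hv.expand (X x)
    rw [hJ x, zero_smul, add_zero] at this
    exact this
  have hsq : ∀ x, a x ^ 2 + (b x ^ 2 + d x ^ 2) = 1 := fun x => by
    have h := hv.inner_comb (a x) 0 (b x) (d x) (a x) 0 (b x) (d x)
    rw [zero_smul, add_zero, ← hexp x, h1 x] at h
    linarith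
  have hap : a p = Real.cos s := by
    simp [ha, hp, helicoid_zero, inner_add_right, real_inner_smul_right, hv.xx, hv.xe, hv.xJe,
      -inner_self_eq_norm_sq_to_K]
  have hbp : b p = Real.sin s * Real.cos t := by
    simp [hb, hp, helicoid_zero, inner_add_right, real_inner_smul_right, hv.ee, hv.ex,
      -inner_self_eq_norm_sq_to_K]
  have hdp : d p = Real.sin s * Real.sin t := by
    simp [hd, hp, helicoid_zero, inner_add_right, real_inner_smul_right, hv.ee, hv.Jex,
      inner_complexJ_complexJ, -inner_self_eq_norm_sq_to_K]
  -- The sine of the first parameter, with the sign it has at `p`.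
  set ρ : M → ℝ := fun x => SignType.sign (Real.sin s) * √(b x ^ 2 + d x ^ 2) with hρ
  have hsgn : (SignType.sign (Real.sin s) : ℝ) ^ 2 = 1 := by
    rcases hs.lt_or_gt with h | h
    · simp [sign_neg h]
    · simp [sign_pos h]
  have hρc : ContinuousAt ρ p :=
    continuousAt_const.mul ((hbc.pow 2).add (hdc.pow 2)).sqrt
  have hρp : ρ p = Real.sin s := by
    have : b p ^ 2 + d p ^ 2 = Real.sin s ^ 2 := by
      rw [hbp, hdp]; linear_combination Real.sin s ^ 2 * Real.sin_sq_add_cos_sq t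
    simp only [hρ, this, Real.sqrt_sq_eq_abs]
    exact sign_mul_abs _
  have hρ2 : ∀ x, ρ x ^ 2 = b x ^ 2 + d x ^ 2 := fun x => by
    simp only [hρ, mul_pow, hsgn, one_mul]
    exact Real.sq_sqrt (by positivity)
  have hρ0 : ∀ᶠ x in 𝓝 p, ρ x ≠ 0 := hρc.eventually_ne (by rwa [hρp])
  obtain ⟨θ, hθc, hθ0, hθ⟩ := exists_continuousAt_angle s
  obtain ⟨η, hηc, hη0, hη⟩ := exists_continuousAt_angle t
  have hmk : ∀ {y z : M → ℝ}, ContinuousAt y p → ContinuousAt z p →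
      ContinuousAt (fun x => (⟨y x, z x⟩ : ℂ)) p := fun hy hz =>
    Complex.equivRealProdCLM.symm.continuous.continuousAt.comp (hy.prodMk hz)
  have hbd : (⟨b p / ρ p, d p / ρ p⟩ : ℂ) = ⟨Real.cos t, Real.sin t⟩ := by
    rw [hbp, hdp, hρp, mul_div_cancel_left₀ _ hs, mul_div_cancel_left₀ _ hs]
  have haρ : (⟨a p, ρ p⟩ : ℂ) = ⟨Real.cos s, Real.sin s⟩ := by rw [hap, hρp]
  have hρp0 : ρ p ≠ 0 := by rwa [hρp]
  have hc1 : ContinuousAt (fun x => θ ⟨a x, ρ x⟩) p :=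
    ContinuousAt.comp (g := θ) (by rw [haρ]; exact hθc) (hmk hac hρc)
  have hc2 : ContinuousAt (fun x => η ⟨b x / ρ x, d x / ρ x⟩) p :=
    ContinuousAt.comp (g := η) (by rw [hbd]; exact hηc)
      (hmk (hbc.div hρc hρp0) (hdc.div hρc hρp0))
  have hc := hc1.prodMk hc2
  have hev := hc.preimage_mem_nhds (t := W) (by rwa [haρ, hbd, hθ0, hη0])
  filter_upwards [hev, hρ0] with x hx hx0
  refine ⟨_, hx, ?_⟩
  obtain ⟨e1, e2⟩ := hθ (a x) (ρ x) (by rw [hρ2]; exact hsq x)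
  obtain ⟨e3, e4⟩ := hη (b x / ρ x) (d x / ρ x) (by
    rw [div_pow, div_pow, ← add_div, ← hρ2]; exact div_self (pow_ne_zero 2 hx0))
  rw [helicoid_zero, e1, e2, e3, e4, mul_div_cancel₀ _ hx0, mul_div_cancel₀ _ hx0]
  exact hexp x

theorem exists_eq_helicoid_zero {x v₁ v₂ : C2} (h1 : inner ℝ x x = 1) (hv : IsUnitaryPair v₁ v₂)
    (hJ : inner ℝ (complexJ v₁) x = 0) : ∃ s t, x = helicoid 0 v₁ v₂ s t := by
  set a : ℝ := inner ℝ v₁ x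
  set z : ℂ := ⟨inner ℝ v₂ x, inner ℝ (complexJ v₂) x⟩ with hz
  have hexp : x = a • v₁ + z.re • v₂ + z.im • complexJ v₂ := by
    have := hv.expand x
    rw [hJ, zero_smul, add_zero] at this
    exact this
  have hsq : a ^ 2 + ‖z‖ ^ 2 = 1 := by
    have h := hv.inner_comb a 0 z.re z.im a 0 z.re z.im
    rw [zero_smul, add_zero, ← hexp, h1] at h
    rw [← Complex.normSq_eq_norm_sq, Complex.normSq_apply]
    linarith
  obtain ⟨θ, -, -, hθ⟩ := exists_continuousAt_angle 0
  obtain ⟨e1, e2⟩ := hθ _ _ hsq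
  refine ⟨θ ⟨a, ‖z‖⟩, z.arg, ?_⟩
  rw [helicoid_zero, e1, e2, Complex.norm_mul_cos_arg, Complex.norm_mul_sin_arg]
  exact hexp

/-! ### The classification -/

theorem exists_isUnitaryPair_complexJ_eq {n : C2} (hn : n ≠ 0) :
    ∃ v₁ v₂ : C2, IsUnitaryPair v₁ v₂ ∧ complexJ v₁ = ‖n‖⁻¹ • n := by
  have hn' : ‖n‖ ≠ 0 := norm_ne_zero_iff.2 hn
  set v₁ := -(‖n‖⁻¹ • complexJ n) with hv
  have hJ : complexJ v₁ = ‖n‖⁻¹ • n := by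
    rw [hv, map_neg, map_smul, complexJ_complexJ, smul_neg, neg_neg]
  obtain ⟨v₂, h22, h12, hJ2, -⟩ := exists_unit_orthogonal v₁ (complexJ v₁) 0
  refine ⟨v₁, v₂, ⟨?_, h22, h12, hJ2⟩, hJ⟩
  rw [← inner_complexJ_complexJ, hJ, real_inner_smul_left, real_inner_smul_right,
    real_inner_self_eq_norm_sq]
  field_simp

theorem proposition1 {M : Type*} [TopologicalSpace M] [T2Space M] [SecondCountableTopology M]
    [ConnectedSpace M] [ChartedSpace R2 M] [IsManifold (𝓡 2) ∞ M]
    (Φ : M → S3) (hΦ : IsSmoothImmersion Φ)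
    (hmin : ∀ κ τ : ℝ, 0 < κ → τ ≠ 0 → IsBergerMinimal κ τ Φ) :
    ∃ c : ℝ, ∃ A : C2 ≃ₗᵢ[ℝ] C2, IsBergerCongruence A ∧
      IsPieceOf (fun p => (Φ p : C2)) (fun q => A (helicoidMap c q)) := by
  set X : M → C2 := fun p => (Φ p : C2) with hXdef
  have hX : ContMDiff (𝓡 2) 𝓘(ℝ, C2) ∞ X := contMDiff_coe_immersion hΦ
  have hi : ∀ p, Function.Injective (mfderiv (𝓡 2) 𝓘(ℝ, C2) X p) :=
    injective_mfderiv_coe_immersion hΦ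
  have h1 : ∀ p, inner ℝ (X p) (X p) = 1 := fun p => by
    rw [real_inner_self_eq_norm_sq, norm_eq_of_mem_sphere, one_pow]
  have hloc : ∀ p, (∃ n : C2, n ≠ 0 ∧ ∀ᶠ x in 𝓝 p, inner ℝ (X x) n = 0) ∨
      ∃ V, chartAt R2 p p ∈ V ∧
        ∃ F : HelicoidalFrame (fun v => X ((chartAt R2 p).symm v)) V, ∀ w ∈ V, F.b w ≠ 0 := by
    intro p
    rcases exists_hyperplane_or_helicoidalFrame (chartAt R2 p).open_target
      (contDiffOn_comp_chart_symm hX p) (fun u _ => h1 _)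
      (fun u hu => injective_fderiv_comp_chart_symm hX hi p hu)
      (fun τ hτ u hu N' hN' => hmin 4 τ (by norm_num) hτ.ne' _
        (IsManifold.chart_mem_maximalAtlas p) u hu N' hN') (mem_chart_target R2 p) with
      ⟨n, hn, hev⟩ | ⟨V, hpV, -, F, hF⟩
    · exact Or.inl ⟨n, hn, (eventually_chart_symm_iff (P := fun x => inner ℝ (X x) n = 0) p
        (mem_chart_source R2 p)).1 hev⟩
    · exact Or.inr ⟨V, hpV, F, hF⟩
  -- It suffices to cover `X` by small pieces of a helicoid.
  have hmain : ∀ (c : ℝ) (v₁ v₂ : C2), IsUnitaryPair v₁ v₂ →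
      (∀ p, ∃ q : ℝ × ℝ, X p = helicoid c v₁ v₂ q.1 q.2 ∧
        (Function.Injective (fderiv ℝ (fun q : ℝ × ℝ => helicoid c v₁ v₂ q.1 q.2) q) →
          ∀ W ∈ 𝓝 q, ∀ᶠ x in 𝓝 p, ∃ y ∈ W, X x = helicoid c v₁ v₂ y.1 y.2)) →
      ∃ c : ℝ, ∃ A : C2 ≃ₗᵢ[ℝ] C2, IsBergerCongruence A ∧
        IsPieceOf X (fun q => A (helicoidMap c q)) := by
    intro c v₁ v₂ hv h
    obtain ⟨A, hA, hAh⟩ := exists_congruence_helicoidMap hv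
    refine ⟨c, A, hA, fun p => ?_⟩
    simp only [hAh]
    obtain ⟨q, hq, hW⟩ := h p
    exact ⟨q, hq, fun hinj => exists_reparametrization hX (hi p) (contDiff_helicoid c v₁ v₂) hinj hq
      (hW hinj)⟩
  set T : Set M := {p | ∃ n : C2, n ≠ 0 ∧ ∀ᶠ x in 𝓝 p, inner ℝ (X x) n = 0} with hT
  have hTo : IsOpen T := isOpen_iff_mem_nhds.2 fun p ⟨n, hn, hp⟩ => by
    filter_upwards [hp.eventually_nhds] with x hx using ⟨n, hn, hx⟩
  have hTc : IsClosed T := by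
    refine ⟨isOpen_iff_mem_nhds.2 fun p hp => ?_⟩
    obtain ⟨V, hpV, F, hb⟩ := (hloc p).resolve_left hp
    filter_upwards [chart_source_mem_nhds R2 p, ((chartAt R2 p).continuousAt
      (mem_chart_source R2 p)).preimage_mem_nhds (F.isOpen.mem_nhds hpV)] with x hx hxV
    rintro ⟨n, hn, hev⟩
    have hxV' : chartAt R2 p x ∈ V := hxV
    exact F.not_eventually_inner_eq_zero hxV' (hb _ hxV') hn
      ((eventually_chart_symm_iff (P := fun x => inner ℝ (X x) n = 0) p hx).2 hev)
  rcases isClopen_iff.1 ⟨hTc, hTo⟩ with hT0 | hT1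
  · have hfr := fun p => (hloc p).resolve_left fun hp => by
      have : p ∈ T := hp
      rw [hT0] at this
      exact this
    obtain ⟨p₀⟩ : Nonempty M := inferInstance
    obtain ⟨V, hpV, F, hb⟩ := hfr p₀
    obtain ⟨c, k, v₁, v₂, s, hv, hm⟩ := F.exists_matches hpV (hb _ hpV)
    have hp₀ : MatchesNear X c k v₁ v₂ p₀ p₀ :=
      ⟨mem_chart_source R2 p₀, V, hpV, F, hb, s, 0, hm⟩
    refine hmain c v₁ v₂ hv fun p => ?_
    obtain ⟨q, hq, hW⟩ := (matchesNear_of_connected hfr hp₀ p).eventually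
    exact ⟨q, hq, fun _ => hW⟩
  · obtain ⟨n, hn, hXn⟩ := exists_forall_inner_eq_zero hX hi h1 fun p => by
      have : p ∈ T := by rw [hT1]; trivial
      exact this
    obtain ⟨v₁, v₂, hv, hJ⟩ := exists_isUnitaryPair_complexJ_eq hn
    have hXJ : ∀ x, inner ℝ (complexJ v₁) (X x) = 0 := fun x => by
      rw [hJ, real_inner_comm, real_inner_smul_right, hXn, mul_zero]
    refine hmain 0 v₁ v₂ hv fun p => ?_
    obtain ⟨s, t, hst⟩ := exists_eq_helicoid_zero (h1 p) hv (hXJ p)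
    refine ⟨(s, t), hst, fun hinj W hW => ?_⟩
    have hs : Real.sin s ≠ 0 :=
      sin_ne_zero_of_injective_fderiv (v₁ := v₁) (v₂ := v₂) (q := (s, t)) hinj
    exact eventually_eq_helicoid_zero hX.continuous.continuousAt h1 hv hXJ hst hs hW
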